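/- **Setting.** Let $k$ be an algebraically closed field of characteristic zero and fix $i\in k$ with $i^2=-1$. Let $\widehat S=k[t^q\mid q\in\mathbb Q]$ with the derivation $\delta=\frac{d}{dt}$ (so $\delta(t^q)=q\,t^{q-1}$), and put $\delta^{(j)}=\delta^j/j!$. Let $\sigma^1=\begin{pmatrix}0&1\\1&0\end{pmatrix}$, $\sigma^2=\begin{pmatrix}0&-i\\i&0\end{pmatrix}$, $\sigma^3=\begin{pmatrix}1&0\\0&-1\end{pmatrix}$ and $J^s=\frac12\sigma^s$. The $N=4$ conformal superalgebra $\mathcal A$ over $k$ is the free $k[\partial]$-module with even generators $L,J^1,J^2,J^3$ and odd generators $G^1,G^2,\overline G^1,\overline G^2$. Its $\lambda$-bracket $[a_\lambda b]=\sum_{n\ge0}\frac{\lambda^n}{n!}a_{(n)}b$ is determined by sesquilinearity, $[\partial a_\lambda b]=-\lambda[a_\lambda b]$ and $[a_\lambda\partial b]=(\partial+\lambda)[a_\lambda b]$, by skew-symmetry, $[a_\lambda b]=-(-1)^{p(a)p(b)}[b_{-\lambda-\partial}a]$, and by $$[L_\lambda L]=(\partial+2\lambda)L,\quad [L_\lambda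 J^s]=(\partial+\lambda)J^s,\quad [L_\lambda G^a]=(\partial+\tfrac32\lambda)G^a,\quad [L_\lambda\overline G^a]=(\partial+\tfrac32\lambda)\overline G^a,$$ $$[J^m{}_\lambda J^n]=J^mJ^n-J^nJ^m,\quad [J^s{}_\lambda G^a]=-\tfrac12\sum_b\sigma^s_{ab}G^b,\quad [J^s{}_\lambda\overline G^a]=\tfrac12\sum_b\sigma^s_{ba}\overline G^b,$$ $$[G^a{}_\lambda G^b]=[\overline G^a{}_\lambda\overline G^b]=0,\quad [G^a{}_\lambda\overline G^b]=2\delta_{ab}L-2(\partial+2\lambda)\sum_s\sigma^s_{ab}J^s .$$ On $\mathcal A\otimes_k\widehat S$ the derivation is $\partial\otimes1+1\otimes\delta$, the grading is the one of $\mathcal A$, and the $n$-products are $(a\otimes r)_{(n)}(b\otimes s)=\sum_{j\ge0}(a_{(n+j)}b)\otimes\delta^{(j)}(r)s$. Let $\mathrm{Aut}_{\widehat{\mathcal S}}(\mathcal A\otimes_k\widehat S)$ be the group of bijective $\widehat S$-linear parity-preserving maps $\mathcal A\otimes_k\widehat S\to\mathcal A\otimes_k\widehat S$ that respect all $n$-products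 and commute with the derivation. Identify $\mathfrak{sl}_2(\widehat S)$ with $\bigoplus_s J^s\otimes\widehat S$, and for $v=(v_1,v_2)^T\in\widehat S^2$ write $G(v)=G^1\otimes v_1+G^2\otimes v_2$ and $\overline G(v)=\overline G^1\otimes v_1+\overline G^2\otimes v_2$. Let $\varepsilon=\begin{pmatrix}0&1\\-1&0\end{pmatrix}$, and let $Y'$ denote the entrywise derivative of a matrix $Y$. **Proposition.** There is a unique group isomorphism $$\Phi:\ \frac{\mathbf{SL}_2(\widehat S)\times\mathbf{SL}_2(k)}{\langle(-I,-I)\rangle}\ \longrightarrow\ \mathrm{Aut}_{\widehat{\mathcal S}}(\mathcal A\otimes_k\widehat S)$$ such that for all $Y\in\mathbf{SL}_2(\widehat S)$ and $X=\begin{pmatrix}c&-e\\d&f\end{pmatrix}\in\mathbf{SL}_2(k)$ the automorphism $\sigma=\Phi(Y,X)$ satisfies $$\sigma(L\otimes1)=L\otimes1+Y'Y^{-1},\qquad \sigma(J^s\otimes1)=YJ^sY^{-1}\quad(s=1,2,3),$$ $$\sigma(G(v))=c\,G\big((Y^{-1})^Tv\big)+d\,\overline G\big(Y\varepsilon v\big),\qquad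 \sigma(\overline G(v))=e\,G\big((Y^{-1})^T\varepsilon v\big)+f\,\overline G\big(Yv\big)$$ for all $v\in\widehat S^2$. In particular every automorphism is given by these formulas for some pair $(Y,X)$, and every such pair defines an automorphism. -/

import Mathlib

open scoped TensorProduct Polynomial Matrix MatrixGroups

noncomputable section

namespace ConformalSuper

/-! ### Differential rings and conformal superalgebras -/

section Basic

variable {k S : Type*} [Field k] [CommRing S] [Algebra k S]

/-- The divided power `δ^(j) = δ^j / j!` of a `k`-linear derivation `δ` of `S`. -/
def dpow (δ : Derivation k S S) (j : ℕ) : S →ₗ[k] S :=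
  ((j.factorial : k)⁻¹) • ((δ : S →ₗ[k] S) ^ j)

theorem dpow_zero_apply (δ : Derivation k S S) (r : S) : dpow δ 0 r = r := by
  simp [dpow]

theorem succ_smul_dpow_succ [CharZero k] (δ : Derivation k S S) (j : ℕ) (r : S) :
    ((j : k) + 1) • dpow δ (j + 1) r = δ (dpow δ j r) := by
  have h : ((j : k) + 1) ≠ 0 := by exact_mod_cast Nat.succ_ne_zero j
  have h2 : ((j.factorial : ℕ) : k) ≠ 0 := by exact_mod_cast j.factorial_ne_zero
  simp only [dpow, LinearMap.smul_apply, pow_succ', Module.End.mul_apply, Nat.factorial_succ,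
    Nat.cast_mul, Nat.cast_succ, smul_smul, Derivation.coeFn_coe, Derivation.map_smul]
  congr 1
  field_simp

theorem succ_smul_dpow_succ' [CharZero k] (δ : Derivation k S S) (j : ℕ) (r : S) :
    ((j : k) + 1) • dpow δ (j + 1) r = dpow δ j (δ r) := by
  rw [succ_smul_dpow_succ]
  simp only [dpow, LinearMap.smul_apply, Derivation.map_smul]
  congr 1
  have := LinearMap.congr_fun ((Commute.refl (δ : S →ₗ[k] S)).pow_right j).eq r
  simpa using this

theorem dpow_mul [CharZero k] (δ : Derivation k S S) (m : ℕ) (r s : S) :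
    dpow δ m (r * s) = ∑ p ∈ Finset.HasAntidiagonal.antidiagonal m, dpow δ p.1 r * dpow δ p.2 s := by
  induction m with
  | zero => simp [dpow_zero_apply]
  | succ m ih =>
    have h : ((m : k) + 1) ≠ 0 := by exact_mod_cast Nat.succ_ne_zero m
    apply (smul_right_injective S h)
    simp only
    rw [succ_smul_dpow_succ, ih, map_sum, Finset.smul_sum]
    have e : ∀ p ∈ Finset.HasAntidiagonal.antidiagonal (m + 1),
        ((m : k) + 1) • (dpow δ p.1 r * dpow δ p.2 s)
          = (p.1 : k) • (dpow δ p.1 r * dpow δ p.2 s)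
            + (p.2 : k) • (dpow δ p.1 r * dpow δ p.2 s) := by
      intro p hp
      rw [← add_smul]
      congr 1
      have := Finset.HasAntidiagonal.mem_antidiagonal.1 hp
      exact_mod_cast this.symm
    rw [Finset.sum_congr rfl e, Finset.sum_add_distrib, Finset.Nat.sum_antidiagonal_succ,
      Finset.Nat.sum_antidiagonal_succ']
    simp only [Nat.cast_zero, zero_smul, zero_add, Nat.cast_succ]
    rw [← Finset.sum_add_distrib]
    refine Finset.sum_congr rfl fun p _ => ?_
    rw [← smul_mul_assoc, ← mul_smul_comm, succ_smul_dpow_succ, succ_smul_dpow_succ,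
      Derivation.leibniz]
    simp only [smul_eq_mul]
    ring

/-- A conformal superalgebra over the differential `k`-ring `(S, δ)`, with underlying `S`-module
`A`: a `ℤ/2`-grading of `A` by `S`-submodules, an even `k`-linear endomorphism `der`, and
`k`-bilinear `n`-products `a_(n) b` for `n ≥ 0`. The sums over all `j ≥ 0` are finite because of
`nProd_eventually_zero`. -/
structure ConformalSuperalgebra (δ : Derivation k S S)
    (A : Type*) [AddCommGroup A] [Module k A] [Module S A] [IsScalarTower k S A] where
  parity : ZMod 2 → Submodule S A
  parity_isCompl : IsCompl (parity 0) (parity 1)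
  der : A →ₗ[k] A
  der_mem : ∀ p, ∀ a ∈ parity p, der a ∈ parity p
  nProd : ℕ → A →ₗ[k] A →ₗ[k] A
  nProd_mem : ∀ n p q, ∀ a ∈ parity p, ∀ b ∈ parity q, nProd n a b ∈ parity (p + q)
  nProd_eventually_zero : ∀ a b, ∃ N, ∀ n ≥ N, nProd n a b = 0
  nProd_der_left : ∀ n a b, nProd n (der a) b = -((n : k) • nProd (n - 1) a b)
  nProd_der_right : ∀ n a b,
    nProd n a (der b) = der (nProd n a b) + (n : k) • nProd (n - 1) a b
  der_smul : ∀ (r : S) a, der (r • a) = r • der a + δ r • a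
  nProd_smul_right : ∀ n (r : S) a b, nProd n a (r • b) = r • nProd n a b
  nProd_smul_left : ∀ n (r : S) a b,
    nProd n (r • a) b = ∑ᶠ j : ℕ, dpow δ j r • nProd (n + j) a b

namespace ConformalSuperalgebra

variable {δ : Derivation k S S} {A : Type*} [AddCommGroup A] [Module k A] [Module S A]
  [IsScalarTower k S A]

/-- The group of automorphisms of a conformal superalgebra over `(S, δ)`: the bijective `S`-linear
maps that preserve the parity, respect all `n`-products and commute with the derivation. -/
def Aut (𝒜 : ConformalSuperalgebra δ A) : Subgroup (A ≃ₗ[S] A) where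
  carrier := {σ | (∀ p, ∀ a ∈ 𝒜.parity p, σ a ∈ 𝒜.parity p) ∧
    (∀ n a b, σ (𝒜.nProd n a b) = 𝒜.nProd n (σ a) (σ b)) ∧
    (∀ a, σ (𝒜.der a) = 𝒜.der (σ a))}
  one_mem' := ⟨fun _ _ h => h, fun _ _ _ => rfl, fun _ => rfl⟩
  mul_mem' := by
    rintro σ τ ⟨h1, h2, h3⟩ ⟨g1, g2, g3⟩
    refine ⟨fun p a ha => h1 p _ (g1 p a ha), fun n a b => ?_, fun a => ?_⟩
    · simp only [LinearEquiv.mul_apply, g2, h2]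
    · simp only [LinearEquiv.mul_apply, g3, h3]
  inv_mem' := by
    rintro σ ⟨h1, h2, h3⟩
    have key : ∀ p q, IsCompl (𝒜.parity p) (𝒜.parity q) →
        ∀ a ∈ 𝒜.parity p, σ⁻¹ a ∈ 𝒜.parity p := by
      intro p q hpq a ha
      obtain ⟨x, hx, y, hy, hxy⟩ := Submodule.mem_sup.1
        (hpq.sup_eq_top ▸ Submodule.mem_top : σ⁻¹ a ∈ 𝒜.parity p ⊔ 𝒜.parity q)
      have e : σ y = a - σ x := by
        rw [eq_sub_iff_add_eq, add_comm, ← map_add, hxy]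
        exact σ.apply_symm_apply a
      have hz : σ y = 0 := (Submodule.disjoint_def.1 hpq.disjoint) _
        (e ▸ Submodule.sub_mem _ ha (h1 p x hx)) (h1 q y hy)
      have hy0 : y = 0 := by simpa using hz
      rw [← hxy, hy0, add_zero]
      exact hx
    refine ⟨fun p => ?_, fun n a b => ?_, fun a => ?_⟩
    · fin_cases p
      · exact key 0 1 𝒜.parity_isCompl
      · exact key 1 0 𝒜.parity_isCompl.symm
    · apply σ.injective
      rw [h2]
      change σ (σ.symm _) = 𝒜.nProd n (σ (σ.symm a)) (σ (σ.symm b))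
      simp
    · apply σ.injective
      rw [h3]
      change σ (σ.symm _) = 𝒜.der (σ (σ.symm a))
      simp

end ConformalSuperalgebra

end Basic

/-! ### Base change of a conformal superalgebra over `k` to a differential `k`-ring -/

theorem finsum_eq_sum_range {M : Type*} [AddCommMonoid M] {f : ℕ → M} {N : ℕ}
    (h : ∀ n ≥ N, f n = 0) : ∑ᶠ j, f j = ∑ j ∈ Finset.range N, f j := by
  apply finsum_eq_sum_of_support_subset
  intro j hj
  by_contra hc
  exact hj (h j (by simpa using hc))

namespace ConformalSuperalgebra

section BaseChange

variable {k A S : Type*} [Field k] [AddCommGroup A] [Module k A]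
  [CommRing S] [Algebra k S]

/-- The `j`-th summand of the `n`-product after base change:
`(r ⊗ a, s ⊗ b) ↦ δ^(j)(r) s ⊗ a_(n+j) b`. -/
def bcTerm (𝒜 : ConformalSuperalgebra (0 : Derivation k k k) A) (δ : Derivation k S S)
    (n j : ℕ) : S ⊗[k] A →ₗ[k] S ⊗[k] A →ₗ[k] S ⊗[k] A :=
  TensorProduct.map₂ ((LinearMap.mul k S) ∘ₗ dpow δ j) (𝒜.nProd (n + j))

theorem bcTerm_tmul (𝒜 : ConformalSuperalgebra (0 : Derivation k k k) A) (δ : Derivation k S S)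
    (n j : ℕ) (r s : S) (a b : A) :
    bcTerm 𝒜 δ n j (r ⊗ₜ a) (s ⊗ₜ b) = (dpow δ j r * s) ⊗ₜ 𝒜.nProd (n + j) a b := rfl

theorem bcTerm_eventually (𝒜 : ConformalSuperalgebra (0 : Derivation k k k) A)
    (δ : Derivation k S S) (x y : S ⊗[k] A) :
    ∃ N, ∀ n j, N ≤ n + j → bcTerm 𝒜 δ n j x y = 0 := by
  induction x using TensorProduct.induction_on with
  | zero => exact ⟨0, by simp⟩
  | add x x' hx hx' =>
    obtain ⟨N, h⟩ := hx
    obtain ⟨N', h'⟩ := hx'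
    refine ⟨max N N', fun n j hj => ?_⟩
    rw [map_add, LinearMap.add_apply, h n j (le_trans (le_max_left _ _) hj),
      h' n j (le_trans (le_max_right _ _) hj), add_zero]
  | tmul r a =>
    induction y using TensorProduct.induction_on with
    | zero => exact ⟨0, by simp⟩
    | add x x' hx hx' =>
      obtain ⟨N, h⟩ := hx
      obtain ⟨N', h'⟩ := hx'
      refine ⟨max N N', fun n j hj => ?_⟩
      rw [map_add, h n j (le_trans (le_max_left _ _) hj),
        h' n j (le_trans (le_max_right _ _) hj), add_zero]
    | tmul s b =>
      obtain ⟨N, h⟩ := 𝒜.nProd_eventually_zero a b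
      exact ⟨N, fun n j hj => by rw [bcTerm_tmul, h _ hj, TensorProduct.tmul_zero]⟩

theorem bcTerm_support (𝒜 : ConformalSuperalgebra (0 : Derivation k k k) A)
    (δ : Derivation k S S) (n : ℕ) (x y : S ⊗[k] A) :
    (Function.support fun j => bcTerm 𝒜 δ n j x y).Finite := by
  obtain ⟨N, h⟩ := bcTerm_eventually 𝒜 δ x y
  refine (Finset.finite_toSet (Finset.range N)).subset fun j hj => ?_
  by_contra hc
  exact hj (h n j (by have : N ≤ j := by simpa using hc
                      omega))

/-- The `n`-product of the base change:
`(r ⊗ a)_(n) (s ⊗ b) = ∑_{j ≥ 0} δ^(j)(r) s ⊗ a_(n+j) b`, extended bilinearly. -/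
def bcProd (𝒜 : ConformalSuperalgebra (0 : Derivation k k k) A) (δ : Derivation k S S)
    (n : ℕ) : S ⊗[k] A →ₗ[k] S ⊗[k] A →ₗ[k] S ⊗[k] A :=
  LinearMap.mk₂ k (fun x y => ∑ᶠ j : ℕ, bcTerm 𝒜 δ n j x y)
    (fun x x' y => by
      simp only [map_add, LinearMap.add_apply]
      exact finsum_add_distrib (bcTerm_support 𝒜 δ n x y) (bcTerm_support 𝒜 δ n x' y))
    (fun c x y => by
      simp only [map_smul, LinearMap.smul_apply]
      exact (smul_finsum' c (bcTerm_support 𝒜 δ n x y)).symm)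
    (fun x y y' => by
      simp only [map_add]
      exact finsum_add_distrib (bcTerm_support 𝒜 δ n x y) (bcTerm_support 𝒜 δ n x y'))
    (fun c x y => by
      simp only [map_smul]
      exact (smul_finsum' c (bcTerm_support 𝒜 δ n x y)).symm)

theorem bcProd_tmul (𝒜 : ConformalSuperalgebra (0 : Derivation k k k) A) (δ : Derivation k S S)
    (n : ℕ) (r s : S) (a b : A) {N : ℕ} (hN : ∀ m ≥ N, 𝒜.nProd m a b = 0) {M : ℕ}
    (hM : N ≤ n + M) :
    bcProd 𝒜 δ n (r ⊗ₜ a) (s ⊗ₜ b)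
      = ∑ j ∈ Finset.range M, (dpow δ j r * s) ⊗ₜ[k] 𝒜.nProd (n + j) a b := by
  refine finsum_eq_sum_range (f := fun j => bcTerm 𝒜 δ n j (r ⊗ₜ a) (s ⊗ₜ b)) fun j hj => ?_
  simp only [bcTerm_tmul]
  rw [hN _ (by omega), TensorProduct.tmul_zero]

/-- The derivation of the base change: `r ⊗ a ↦ r ⊗ ∂ a + δ r ⊗ a`. -/
def bcDer (𝒜 : ConformalSuperalgebra (0 : Derivation k k k) A) (δ : Derivation k S S) :
    S ⊗[k] A →ₗ[k] S ⊗[k] A :=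
  TensorProduct.map LinearMap.id 𝒜.der + TensorProduct.map (δ : S →ₗ[k] S) LinearMap.id

theorem bcDer_tmul (𝒜 : ConformalSuperalgebra (0 : Derivation k k k) A) (δ : Derivation k S S)
    (r : S) (a : A) : bcDer 𝒜 δ (r ⊗ₜ a) = r ⊗ₜ 𝒜.der a + δ r ⊗ₜ a := rfl

theorem bcProd_eventually (𝒜 : ConformalSuperalgebra (0 : Derivation k k k) A)
    (δ : Derivation k S S) (x y : S ⊗[k] A) : ∃ N, ∀ n ≥ N, bcProd 𝒜 δ n x y = 0 := by
  obtain ⟨N, h⟩ := bcTerm_eventually 𝒜 δ x y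
  refine ⟨N, fun n hn => ?_⟩
  refine (finsum_congr (g := fun _ => 0) fun j => h n j (by omega)).trans finsum_zero

theorem bcProd_der_left [CharZero k] (𝒜 : ConformalSuperalgebra (0 : Derivation k k k) A)
    (δ : Derivation k S S) (n : ℕ) (x y : S ⊗[k] A) :
    bcProd 𝒜 δ n (bcDer 𝒜 δ x) y = -((n : k) • bcProd 𝒜 δ (n - 1) x y) := by
  induction x using TensorProduct.induction_on with
  | zero => simp
  | add x x' hx hx' => simp only [map_add, LinearMap.add_apply, hx, hx', smul_add, neg_add]
  | tmul r a =>
    induction y using TensorProduct.induction_on with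
    | zero => simp
    | add x x' hx hx' => simp only [map_add, hx, hx', smul_add, neg_add]
    | tmul s b =>
      obtain ⟨N, h⟩ := 𝒜.nProd_eventually_zero a b
      have h' : ∀ m ≥ N + 1, 𝒜.nProd m (𝒜.der a) b = 0 := fun m hm => by
        rw [𝒜.nProd_der_left, h _ (by omega), smul_zero, neg_zero]
      rw [bcDer_tmul, map_add, LinearMap.add_apply,
        bcProd_tmul 𝒜 δ n r s (𝒜.der a) b h' (M := N + 1) (by omega),
        bcProd_tmul 𝒜 δ n (δ r) s a b h (M := N) (by omega),
        bcProd_tmul 𝒜 δ (n - 1) r s a b h (M := N + 1) (by omega),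
        Finset.sum_range_succ', Finset.sum_range_succ' _ N, add_right_comm,
        ← Finset.sum_add_distrib, smul_add, neg_add, Finset.smul_sum, ← Finset.sum_neg_distrib]
      congr 1
      · refine Finset.sum_congr rfl fun j _ => ?_
        rw [𝒜.nProd_der_left, ← succ_smul_dpow_succ', smul_mul_assoc, TensorProduct.smul_tmul,
          ← TensorProduct.tmul_add]
        rcases n with _ | n
        · simp
        · have e1 : n + 1 + (j + 1) - 1 = n + 1 + j := by omega
          have e2 : n + 1 - 1 + (j + 1) = n + 1 + j := by omega
          rw [e1, e2, ← TensorProduct.tmul_smul, ← TensorProduct.tmul_neg]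
          congr 1
          push_cast
          module
      · simp only [add_zero, 𝒜.nProd_der_left]
        rw [TensorProduct.tmul_neg, TensorProduct.tmul_smul]

theorem bcProd_der_right (𝒜 : ConformalSuperalgebra (0 : Derivation k k k) A)
    [CharZero k] (δ : Derivation k S S) (n : ℕ) (x y : S ⊗[k] A) :
    bcProd 𝒜 δ n x (bcDer 𝒜 δ y)
      = bcDer 𝒜 δ (bcProd 𝒜 δ n x y) + (n : k) • bcProd 𝒜 δ (n - 1) x y := by
  induction x using TensorProduct.induction_on with
  | zero => simp
  | add x x' hx hx' =>
    simp only [map_add, LinearMap.add_apply, hx, hx', smul_add]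
    abel
  | tmul r a =>
    induction y using TensorProduct.induction_on with
    | zero => simp
    | add x x' hx hx' =>
      simp only [map_add, hx, hx', smul_add]
      abel
    | tmul s b =>
      obtain ⟨N, h⟩ := 𝒜.nProd_eventually_zero a b
      have h' : ∀ m ≥ N + 1, 𝒜.nProd m a (𝒜.der b) = 0 := fun m hm => by
        rw [𝒜.nProd_der_right, h _ (by omega), h _ (by omega), smul_zero, map_zero, add_zero]
      rw [bcDer_tmul, map_add,
        bcProd_tmul 𝒜 δ n r s a (𝒜.der b) h' (M := N + 1) (by omega),
        bcProd_tmul 𝒜 δ n r (δ s) a b h (M := N + 1) (by omega),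
        bcProd_tmul 𝒜 δ n r s a b h (M := N + 1) (by omega),
        bcProd_tmul 𝒜 δ (n - 1) r s a b h (M := N + 2) (by omega),
        map_sum]
      have e : ∀ j ∈ Finset.range (N + 1),
          (dpow δ j r * s) ⊗ₜ[k] 𝒜.nProd (n + j) a (𝒜.der b)
            + (dpow δ j r * δ s) ⊗ₜ[k] 𝒜.nProd (n + j) a b
          = bcDer 𝒜 δ ((dpow δ j r * s) ⊗ₜ[k] 𝒜.nProd (n + j) a b)
            + (((n : k) + j) • ((dpow δ j r * s) ⊗ₜ[k] 𝒜.nProd (n + j - 1) a b)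
            - ((j : k) + 1) • ((dpow δ (j + 1) r * s) ⊗ₜ[k] 𝒜.nProd (n + j) a b)) := by
        intro j _
        rw [bcDer_tmul, 𝒜.nProd_der_right, Derivation.leibniz, ← succ_smul_dpow_succ]
        simp only [TensorProduct.tmul_add, TensorProduct.add_tmul, TensorProduct.tmul_smul,
          smul_eq_mul, Nat.cast_add, mul_smul_comm, ← TensorProduct.smul_tmul']
        rw [mul_comm s]
        abel
      rw [← Finset.sum_add_distrib, Finset.sum_congr rfl e, Finset.sum_add_distrib]
      congr 1
      have f : ∀ j : ℕ, ((n : k) + j) • ((dpow δ j r * s) ⊗ₜ[k] 𝒜.nProd (n + j - 1) a b)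
            - ((j : k) + 1) • ((dpow δ (j + 1) r * s) ⊗ₜ[k] 𝒜.nProd (n + j) a b)
          = (n : k) • ((dpow δ j r * s) ⊗ₜ[k] 𝒜.nProd (n - 1 + j) a b)
            - (((j + 1 : ℕ) : k) • ((dpow δ (j + 1) r * s) ⊗ₜ[k] 𝒜.nProd (n + (j + 1) - 1) a b)
              - (j : k) • ((dpow δ j r * s) ⊗ₜ[k] 𝒜.nProd (n + j - 1) a b)) := by
        intro j
        have e0 : n + (j + 1) - 1 = n + j := by omega
        rw [e0]
        rcases n with _ | n
        · push_cast
          module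
        · have e1 : n + 1 - 1 + j = n + 1 + j - 1 := by omega
          rw [e1]
          push_cast
          module
      rw [Finset.sum_congr rfl fun j _ => f j, Finset.sum_sub_distrib,
        Finset.sum_range_sub (fun j => (j : k) • ((dpow δ j r * s) ⊗ₜ[k]
          𝒜.nProd (n + j - 1) a b)), Finset.smul_sum, Finset.sum_range_succ _ (N + 1)]
      have z1 : 𝒜.nProd (n + (N + 1) - 1) a b = 0 := h _ (by omega)
      rcases n with _ | n
      · simp at z1
        simp [z1]
      · have z2 : 𝒜.nProd (n + 1 - 1 + (N + 1)) a b = 0 := h _ (by omega)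
        rw [z1, z2]
        simp

theorem bcDer_smul (𝒜 : ConformalSuperalgebra (0 : Derivation k k k) A)
    (δ : Derivation k S S) (r : S) (x : S ⊗[k] A) :
    bcDer 𝒜 δ (r • x) = r • bcDer 𝒜 δ x + δ r • x := by
  induction x using TensorProduct.induction_on with
  | zero => simp
  | add x x' hx hx' =>
    simp only [map_add, hx, hx', smul_add]
    abel
  | tmul s a =>
    simp only [TensorProduct.smul_tmul', bcDer_tmul, smul_eq_mul, Derivation.leibniz, smul_add,
      TensorProduct.add_tmul]
    rw [mul_comm s]
    abel

theorem bcProd_smul_right (𝒜 : ConformalSuperalgebra (0 : Derivation k k k) A)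
    (δ : Derivation k S S) (n : ℕ) (r : S) (x y : S ⊗[k] A) :
    bcProd 𝒜 δ n x (r • y) = r • bcProd 𝒜 δ n x y := by
  induction x using TensorProduct.induction_on with
  | zero => simp
  | add x x' hx hx' => simp only [map_add, LinearMap.add_apply, hx, hx', smul_add]
  | tmul s a =>
    induction y using TensorProduct.induction_on with
    | zero => simp
    | add x x' hx hx' => simp only [map_add, hx, hx', smul_add]
    | tmul s' b =>
      obtain ⟨N, h⟩ := 𝒜.nProd_eventually_zero a b
      rw [TensorProduct.smul_tmul', bcProd_tmul 𝒜 δ n s _ a b h (M := N) (by omega),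
        bcProd_tmul 𝒜 δ n s _ a b h (M := N) (by omega), Finset.smul_sum]
      refine Finset.sum_congr rfl fun j _ => ?_
      rw [TensorProduct.smul_tmul', smul_eq_mul, smul_eq_mul, mul_left_comm]

theorem bcProd_smul_left_aux [CharZero k] (𝒜 : ConformalSuperalgebra (0 : Derivation k k k) A)
    (δ : Derivation k S S) (n : ℕ) (r : S) (x y : S ⊗[k] A) :
    ∃ N₀, ∀ N ≥ N₀, bcProd 𝒜 δ n (r • x) y
      = ∑ j ∈ Finset.range N, dpow δ j r • bcProd 𝒜 δ (n + j) x y := by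
  induction x using TensorProduct.induction_on with
  | zero => exact ⟨0, by simp⟩
  | add x x' hx hx' =>
    obtain ⟨N, h⟩ := hx
    obtain ⟨N', h'⟩ := hx'
    refine ⟨max N N', fun M hM => ?_⟩
    simp only [smul_add, map_add, LinearMap.add_apply, Finset.sum_add_distrib]
    rw [h M (le_trans (le_max_left _ _) hM), h' M (le_trans (le_max_right _ _) hM)]
  | tmul s a =>
    induction y using TensorProduct.induction_on with
    | zero => exact ⟨0, by simp⟩
    | add x x' hx hx' =>
      obtain ⟨N, h⟩ := hx
      obtain ⟨N', h'⟩ := hx'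
      refine ⟨max N N', fun M hM => ?_⟩
      simp only [smul_add, map_add, Finset.sum_add_distrib]
      rw [h M (le_trans (le_max_left _ _) hM), h' M (le_trans (le_max_right _ _) hM)]
    | tmul s' b =>
      obtain ⟨N, h⟩ := 𝒜.nProd_eventually_zero a b
      refine ⟨N, fun M hM => ?_⟩
      rw [TensorProduct.smul_tmul', bcProd_tmul 𝒜 δ n _ s' a b h (M := M) (by omega)]
      have e : ∀ j ∈ Finset.range M, dpow δ j r • bcProd 𝒜 δ (n + j) (s ⊗ₜ a) (s' ⊗ₜ b)
          = ∑ i ∈ Finset.range (M - j),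
            (dpow δ j r * dpow δ i s * s') ⊗ₜ[k] 𝒜.nProd (n + (j + i)) a b := by
        intro j hj
        rw [bcProd_tmul 𝒜 δ (n + j) s s' a b h (M := M - j) (by omega), Finset.smul_sum]
        refine Finset.sum_congr rfl fun i _ => ?_
        rw [TensorProduct.smul_tmul', smul_eq_mul, mul_assoc, add_assoc]
      rw [Finset.sum_congr rfl e, Finset.sum_sigma']
      simp only [smul_eq_mul, dpow_mul, Finset.sum_mul, TensorProduct.sum_tmul]
      rw [Finset.sum_sigma']
      refine Finset.sum_bij' (fun p _ => ⟨p.2.1, p.2.2⟩) (fun p _ => ⟨p.1 + p.2, (p.1, p.2)⟩)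
        ?_ ?_ ?_ ?_ ?_
      · rintro ⟨m, i, j⟩ hp
        simp only [Finset.mem_sigma, Finset.mem_range, Finset.HasAntidiagonal.mem_antidiagonal] at hp ⊢
        omega
      · rintro ⟨i, j⟩ hp
        simp only [Finset.mem_sigma, Finset.mem_range, Finset.HasAntidiagonal.mem_antidiagonal] at hp ⊢
        exact ⟨by omega, trivial⟩
      · rintro ⟨m, i, j⟩ hp
        simp only [Finset.mem_sigma, Finset.mem_range, Finset.HasAntidiagonal.mem_antidiagonal] at hp
        obtain ⟨_, rfl⟩ := hp
        rfl
      · rintro ⟨i, j⟩ hp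
        rfl
      · rintro ⟨m, i, j⟩ hp
        simp only [Finset.mem_sigma, Finset.mem_range, Finset.HasAntidiagonal.mem_antidiagonal] at hp
        obtain ⟨_, rfl⟩ := hp
        rfl

theorem bcProd_smul_left [CharZero k] (𝒜 : ConformalSuperalgebra (0 : Derivation k k k) A)
    (δ : Derivation k S S) (n : ℕ) (r : S) (x y : S ⊗[k] A) :
    bcProd 𝒜 δ n (r • x) y = ∑ᶠ j : ℕ, dpow δ j r • bcProd 𝒜 δ (n + j) x y := by
  obtain ⟨N₀, h⟩ := bcProd_smul_left_aux 𝒜 δ n r x y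
  obtain ⟨N₁, h'⟩ := bcProd_eventually 𝒜 δ x y
  rw [finsum_eq_sum_range (N := max N₀ N₁) fun j hj => ?_, h _ (le_max_left _ _)]
  rw [h' _ (by have := le_trans (le_max_right N₀ N₁) hj
               omega), smul_zero]

theorem baseChange_disjoint {P Q : Submodule k A} (h : IsCompl P Q) :
    Disjoint (P.baseChange S) (Q.baseChange S) := by
  rw [Submodule.disjoint_def]
  intro x hx hy
  have key : ∀ {P Q : Submodule k A} (h : IsCompl P Q), ∀ x ∈ P.baseChange S,
      (Q.projection P h.symm).baseChange S x = 0 := by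
    intro P Q h x hx
    rw [Submodule.baseChange_eq_span] at hx
    induction hx using Submodule.span_induction with
    | zero => simp
    | add x y _ _ hx hy => rw [map_add, hx, hy, add_zero]
    | smul r x _ hx => rw [map_smul, hx, smul_zero]
    | mem x hx =>
      obtain ⟨a, ha, rfl⟩ := hx
      simp only [TensorProduct.mk_apply, LinearMap.baseChange_tmul]
      rw [(Submodule.projection_apply_eq_zero_iff h.symm).2 ha, TensorProduct.tmul_zero]
  have e : (P.projection Q h).baseChange S + (Q.projection P h.symm).baseChange S = LinearMap.id := by
    rw [← LinearMap.baseChange_add, Submodule.projection_add_projection_eq_id]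
    exact LinearMap.baseChange_id
  have := LinearMap.congr_fun e x
  rw [LinearMap.add_apply, key h x hx, key h.symm x hy] at this
  simpa using this.symm

/-- The base change `𝒜 ⊗_k (S, δ)` of a conformal superalgebra `𝒜` over `k` (with its zero
derivation) to the differential `k`-ring `(S, δ)`; it is a conformal superalgebra over `(S, δ)`.
The underlying `S`-module is written `S ⊗[k] A`. -/
def baseChange [CharZero k] (𝒜 : ConformalSuperalgebra (0 : Derivation k k k) A)
    (δ : Derivation k S S) : ConformalSuperalgebra δ (S ⊗[k] A) where
  parity p := (𝒜.parity p).baseChange S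
  parity_isCompl := by
    refine ⟨baseChange_disjoint 𝒜.parity_isCompl, ?_⟩
    rw [codisjoint_iff, eq_top_iff]
    rintro x -
    induction x using TensorProduct.induction_on with
    | zero => exact Submodule.zero_mem _
    | add x y hx hy => exact Submodule.add_mem _ hx hy
    | tmul r a =>
      obtain ⟨u, hu, v, hv, rfl⟩ := Submodule.mem_sup.1
        (𝒜.parity_isCompl.sup_eq_top ▸ Submodule.mem_top : a ∈ 𝒜.parity 0 ⊔ 𝒜.parity 1)
      rw [TensorProduct.tmul_add]
      exact Submodule.add_mem _
        (Submodule.mem_sup_left (Submodule.tmul_mem_baseChange_of_mem r hu))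
        (Submodule.mem_sup_right (Submodule.tmul_mem_baseChange_of_mem r hv))
  der := bcDer 𝒜 δ
  der_mem p x hx := by
    rw [Submodule.baseChange_eq_span] at hx
    induction hx using Submodule.span_induction with
    | zero => simp
    | add x y _ _ hx hy =>
      rw [map_add]
      exact Submodule.add_mem _ hx hy
    | smul r x h1 hx =>
      rw [← Submodule.baseChange_eq_span] at h1
      rw [bcDer_smul]
      exact Submodule.add_mem _ (Submodule.smul_mem _ _ hx) (Submodule.smul_mem _ _ h1)
    | mem x h =>
      obtain ⟨a, ha, rfl⟩ := h
      rw [TensorProduct.mk_apply, bcDer_tmul]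
      exact Submodule.add_mem _ (Submodule.tmul_mem_baseChange_of_mem _ (𝒜.der_mem p a ha))
        (Submodule.tmul_mem_baseChange_of_mem _ ha)
  nProd := bcProd 𝒜 δ
  nProd_mem n p q x hx y hy := by
    rw [Submodule.baseChange_eq_span] at hx hy
    induction hy using Submodule.span_induction with
    | zero => simp
    | add y y' _ _ h h' =>
      rw [map_add]
      exact Submodule.add_mem _ h h'
    | smul r y _ h =>
      rw [bcProd_smul_right]
      exact Submodule.smul_mem _ _ h
    | mem y h =>
      obtain ⟨b, hb, rfl⟩ := h
      revert n
      induction hx using Submodule.span_induction with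
      | zero => simp
      | add y y' _ _ h h' =>
        intro n
        rw [map_add, LinearMap.add_apply]
        exact Submodule.add_mem _ (h n) (h' n)
      | smul r y _ h =>
        intro n
        obtain ⟨N, hN⟩ := bcProd_smul_left_aux 𝒜 δ n r y (TensorProduct.mk k S A 1 b)
        rw [hN N le_rfl]
        exact Submodule.sum_mem _ fun j _ => Submodule.smul_mem _ _ (h _)
      | mem x h =>
        intro n
        obtain ⟨a, ha, rfl⟩ := h
        obtain ⟨N, h⟩ := 𝒜.nProd_eventually_zero a b
        rw [TensorProduct.mk_apply, TensorProduct.mk_apply,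
          bcProd_tmul 𝒜 δ n _ _ a b h (M := N) (by omega)]
        exact Submodule.sum_mem _ fun j _ =>
          Submodule.tmul_mem_baseChange_of_mem _ (𝒜.nProd_mem _ p q a ha b hb)
  nProd_eventually_zero := bcProd_eventually 𝒜 δ
  nProd_der_left := bcProd_der_left 𝒜 δ
  nProd_der_right := bcProd_der_right 𝒜 δ
  der_smul := bcDer_smul 𝒜 δ
  nProd_smul_right := bcProd_smul_right 𝒜 δ
  nProd_smul_left := bcProd_smul_left 𝒜 δ

end BaseChange

end ConformalSuperalgebra

/-! ### The ring of polynomials in all rational powers of `t`, with `d/dt` -/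

/-- `Ŝ = k[t^q | q ∈ ℚ]`, where `t^q` is `AddMonoidAlgebra.single q 1`. -/
abbrev Shat (k : Type*) [Field k] : Type _ := AddMonoidAlgebra k ℚ

/-- The `k`-linear map `t^q ↦ q t^(q-1)`. -/
def ddtLinear (k : Type*) [Field k] : Shat k →ₗ[k] Shat k :=
  (Finsupp.lsum k fun q : ℚ => (q : k) • AddMonoidAlgebra.lsingle (q - 1)) ∘ₗ
    (AddMonoidAlgebra.coeffLinearEquiv k).toLinearMap

theorem ddtLinear_single (k : Type*) [Field k] (q : ℚ) (c : k) :
    ddtLinear k (AddMonoidAlgebra.single q c) = AddMonoidAlgebra.single (q - 1) ((q : k) * c) := by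
  simp [ddtLinear]

/-- The derivation `d/dt` of `Ŝ`. -/
def ddt (k : Type*) [Field k] [CharZero k] : Derivation k (Shat k) (Shat k) :=
  Derivation.mk' (ddtLinear k) fun a b => by
    induction a using AddMonoidAlgebra.induction_linear with
    | zero => simp
    | add f g hf hg =>
      simp only [add_mul, map_add, hf, hg, smul_eq_mul, mul_add]
      ring
    | single p c =>
      induction b using AddMonoidAlgebra.induction_linear with
      | zero => simp
      | add f g hf hg =>
        simp only [add_mul, map_add, hf, hg, smul_eq_mul, mul_add]
        ring
      | single q d =>
        simp only [AddMonoidAlgebra.single_mul_single, ddtLinear_single, smul_eq_mul]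
        rw [show p + (q - 1) = p + q - 1 by ring, show q + (p - 1) = p + q - 1 by ring,
          ← AddMonoidAlgebra.single_add]
        congr 1
        push_cast
        ring

/-! ### The `N = 4` conformal superalgebra -/

/-- The generators of the `N = 4` conformal superalgebra over `k[∂]`. -/
inductive Gen : Type
  | L : Gen
  | J (s : Fin 3) : Gen
  | G (a : Fin 2) : Gen
  | Gbar (a : Fin 2) : Gen
  deriving DecidableEq, Fintype

/-- `L` and `J^s` are even, `G^a` and `Ḡ^a` are odd. -/
def Gen.parity : Gen → ZMod 2
  | .L => 0
  | .J _ => 0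
  | .G _ => 1
  | .Gbar _ => 1

section N4

variable {k : Type*} [Field k]

/-- The Pauli matrices, for a square root `i` of `-1`. -/
def pauli (i : k) : Fin 3 → Matrix (Fin 2) (Fin 2) k :=
  ![!![0, 1; 1, 0], !![0, -i; i, 0], !![1, 0; 0, -1]]

/-- The matrices `J^s = σ^s / 2`, a basis of `sl₂(k)`. -/
def Jmat (i : k) (s : Fin 3) : Matrix (Fin 2) (Fin 2) k := (1 / 2 : k) • pauli i s

/-- The free `k[∂]`-module on the generators; the variable of `k[X]` is `∂`. -/
abbrev N4 (k : Type*) [Field k] : Type _ := Gen → k[X]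

/-- The `λ`-brackets `[u_λ v]` of the generators, with coefficients in `k[∂][λ]`: the outer
variable is `λ`, the inner one is `∂`. The brackets `[J_λ L]`, `[G_λ L]`, `[G_λ J]`, `[Ḡ_λ G]` and
so on are those that skew-symmetry `[v_λ u] = -(-1)^{p(u)p(v)} [u_{-λ-∂} v]` prescribes. A traceless
matrix `M` is `∑_s tr(M σ^s) J^s`, whence the value of `[J^m_λ J^n] = J^m J^n - J^n J^m`. -/
def genBracket (i : k) : Gen → Gen → (Gen → k[X][X]) :=
  let lam : k[X][X] := Polynomial.X
  let del : k[X][X] := Polynomial.C Polynomial.X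
  let c : k → k[X][X] := fun a => Polynomial.C (Polynomial.C a)
  fun u v => match u, v with
  | .L, .L => Pi.single .L (del + 2 * lam)
  | .L, .J s => Pi.single (.J s) (del + lam)
  | .L, .G a => Pi.single (.G a) (del + c (3 / 2) * lam)
  | .L, .Gbar a => Pi.single (.Gbar a) (del + c (3 / 2) * lam)
  | .J s, .L => Pi.single (.J s) lam
  | .J m, .J n => ∑ s, Pi.single (.J s)
      (c (Matrix.trace ((Jmat i m * Jmat i n - Jmat i n * Jmat i m) * pauli i s)))
  | .J s, .G a => ∑ b, Pi.single (.G b) (c (-(1 / 2) * pauli i s a b))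
  | .J s, .Gbar a => ∑ b, Pi.single (.Gbar b) (c ((1 / 2) * pauli i s b a))
  | .G a, .L => Pi.single (.G a) (c (1 / 2) * del + c (3 / 2) * lam)
  | .G a, .J s => ∑ b, Pi.single (.G b) (c ((1 / 2) * pauli i s a b))
  | .G _, .G _ => 0
  | .G a, .Gbar b => Pi.single .L (c (if a = b then 2 else 0))
      - ∑ s, Pi.single (.J s) (2 * (del + 2 * lam) * c (pauli i s a b))
  | .Gbar a, .L => Pi.single (.Gbar a) (c (1 / 2) * del + c (3 / 2) * lam)
  | .Gbar a, .J s => ∑ b, Pi.single (.Gbar b) (c (-(1 / 2) * pauli i s b a))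
  | .Gbar b, .G a => Pi.single .L (c (if a = b then 2 else 0))
      + ∑ s, Pi.single (.J s) (2 * (del + 2 * lam) * c (pauli i s a b))
  | .Gbar _, .Gbar _ => 0

theorem genBracket_parity (i : k) (u v w : Gen) (h : w.parity ≠ u.parity + v.parity) :
    genBracket i u v w = 0 := by
  cases u <;> cases v <;> cases w <;>
    first
      | exact absurd rfl h
      | simp [genBracket, Finset.sum_apply]

/-- The `λ`-bracket of `N4 k`, the sesquilinear extension of `genBracket`:
`[p(∂) u _λ q(∂) v] = p(-λ) q(∂ + λ) [u_λ v]`. -/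
def lambdaBracket (i : k) (x y : N4 k) : Gen → k[X][X] := fun w =>
  ∑ u, ∑ v, Polynomial.aeval (-Polynomial.X : k[X][X]) (x u) *
    Polynomial.aeval (Polynomial.C Polynomial.X + Polynomial.X : k[X][X]) (y v) *
      genBracket i u v w

/-- The `n`-product of `N4 k`, determined by `[x_λ y] = ∑_n (λ^n / n!) x_(n) y`. -/
def n4Prod (i : k) (n : ℕ) : N4 k →ₗ[k] N4 k →ₗ[k] N4 k :=
  LinearMap.mk₂ k (fun x y w => (n.factorial : k) • (lambdaBracket i x y w).coeff n)
    (fun x x' y => by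
      ext1 w
      simp only [lambdaBracket, Pi.add_apply, map_add, add_mul, Finset.sum_add_distrib,
        Polynomial.coeff_add, smul_add])
    (fun c x y => by
      ext1 w
      simp only [lambdaBracket, Pi.smul_apply, map_smul, smul_mul_assoc, ← Finset.smul_sum,
        Polynomial.coeff_smul]
      rw [smul_comm])
    (fun x y y' => by
      ext1 w
      simp only [lambdaBracket, Pi.add_apply, map_add, add_mul, mul_add, Finset.sum_add_distrib,
        Polynomial.coeff_add, smul_add])
    (fun c x y => by
      ext1 w
      simp only [lambdaBracket, Pi.smul_apply, map_smul, smul_mul_assoc, mul_smul_comm,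
        ← Finset.smul_sum, Polynomial.coeff_smul]
      rw [smul_comm])

theorem n4Prod_apply (i : k) (n : ℕ) (x y : N4 k) (w : Gen) :
    n4Prod i n x y w = (n.factorial : k) • (lambdaBracket i x y w).coeff n := rfl

/-- Multiplication by `∂`. -/
def n4Der (k : Type*) [Field k] : N4 k →ₗ[k] N4 k where
  toFun x := fun u => Polynomial.X * x u
  map_add' x y := by
    ext1 u
    simp [mul_add]
  map_smul' c x := by
    ext1 u
    simp

theorem lambdaBracket_der_left (i : k) (x y : N4 k) (w : Gen) :
    lambdaBracket i (n4Der k x) y w = -(Polynomial.X * lambdaBracket i x y w) := by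
  simp only [lambdaBracket, n4Der, LinearMap.coe_mk, AddHom.coe_mk, map_mul, Polynomial.aeval_X,
    Finset.mul_sum, ← Finset.sum_neg_distrib]
  refine Finset.sum_congr rfl fun u _ => Finset.sum_congr rfl fun v _ => ?_
  ring

theorem lambdaBracket_der_right (i : k) (x y : N4 k) (w : Gen) :
    lambdaBracket i x (n4Der k y) w = Polynomial.C Polynomial.X * lambdaBracket i x y w
      + Polynomial.X * lambdaBracket i x y w := by
  simp only [lambdaBracket, n4Der, LinearMap.coe_mk, AddHom.coe_mk, map_mul, Polynomial.aeval_X,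
    Finset.mul_sum, ← Finset.sum_add_distrib]
  refine Finset.sum_congr rfl fun u _ => Finset.sum_congr rfl fun v _ => ?_
  ring

/-- The elements whose coordinates vanish on the generators of parity other than `p`. -/
def n4Parity (k : Type*) [Field k] (p : ZMod 2) : Submodule k (N4 k) where
  carrier := {x | ∀ u : Gen, u.parity ≠ p → x u = 0}
  zero_mem' := fun _ _ => rfl
  add_mem' := fun {x y} hx hy u hu => by
    rw [Pi.add_apply, hx u hu, hy u hu, add_zero]
  smul_mem' := fun c x hx u hu => by
    rw [Pi.smul_apply, hx u hu, smul_zero]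

theorem zmod_two_cases (p : ZMod 2) : p = 0 ∨ p = 1 := by
  fin_cases p
  · exact Or.inl rfl
  · exact Or.inr rfl

/-- The `N = 4` conformal superalgebra over `k`; the parameter `i` is the square root of `-1`
that occurs in the second Pauli matrix. -/
def n4 (i : k) : ConformalSuperalgebra (0 : Derivation k k k) (N4 k) where
  parity := n4Parity k
  parity_isCompl := by
    constructor
    · rw [Submodule.disjoint_def]
      intro x hx hy
      ext1 u
      rcases zmod_two_cases u.parity with h | h
      · exact hy u (by simp [h])
      · exact hx u (by simp [h])
    · rw [codisjoint_iff, eq_top_iff]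
      rintro x -
      refine Submodule.mem_sup.2 ⟨fun u => if u.parity = 0 then x u else 0, ?_,
        fun u => if u.parity = 0 then 0 else x u, ?_, ?_⟩
      · intro u hu
        exact if_neg hu
      · intro u hu
        rcases zmod_two_cases u.parity with h | h
        · exact if_pos h
        · exact absurd h hu
      · ext1 u
        by_cases h : u.parity = 0 <;> simp [h]
  der := n4Der k
  der_mem p x hx u hu := by
    change Polynomial.X * x u = 0
    rw [hx u hu, mul_zero]
  nProd := n4Prod i
  nProd_mem n p q x hx y hy w hw := by
    have h : lambdaBracket i x y w = 0 := by
      refine Finset.sum_eq_zero fun u _ => Finset.sum_eq_zero fun v _ => ?_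
      by_cases hu : u.parity = p
      · by_cases hv : v.parity = q
        · rw [genBracket_parity i u v w (by rw [hu, hv]; exact hw), mul_zero]
        · rw [hy v hv, map_zero, mul_zero, zero_mul]
      · rw [hx u hu, map_zero, zero_mul, zero_mul]
    rw [n4Prod_apply, h, Polynomial.coeff_zero, smul_zero]
  nProd_eventually_zero x y := by
    refine ⟨(Finset.univ.sup fun w => (lambdaBracket i x y w).natDegree) + 1, fun n hn => ?_⟩
    ext1 w
    rw [n4Prod_apply, Polynomial.coeff_eq_zero_of_natDegree_lt, smul_zero, Pi.zero_apply]
    have := Finset.le_sup (f := fun w => (lambdaBracket i x y w).natDegree) (Finset.mem_univ w)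
    omega
  nProd_der_left n x y := by
    ext1 w
    simp only [Pi.neg_apply, Pi.smul_apply, n4Prod_apply, lambdaBracket_der_left,
      Polynomial.coeff_neg, smul_neg]
    rcases n with _ | n
    · simp
    · rw [Polynomial.coeff_X_mul, smul_smul, Nat.add_sub_cancel, Nat.factorial_succ, Nat.cast_mul]
  nProd_der_right n x y := by
    ext1 w
    simp only [Pi.add_apply, Pi.smul_apply, n4Prod_apply, lambdaBracket_der_right,
      Polynomial.coeff_add, smul_add, Polynomial.coeff_C_mul]
    refine congrArg₂ (· + ·) ?_ ?_
    · simp [n4Der, n4Prod_apply]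
    · rcases n with _ | n
      · simp
      · rw [Polynomial.coeff_X_mul, smul_smul, Nat.add_sub_cancel, Nat.factorial_succ,
          Nat.cast_mul]
  der_smul r x := by simp
  nProd_smul_right n r x y := by simp
  nProd_smul_left n r x y := by
    rw [finsum_eq_single _ 0]
    · simp [dpow_zero_apply]
    · intro j hj
      have : dpow (0 : Derivation k k k) j r = 0 := by
        simp [dpow, zero_pow hj]
      rw [this, zero_smul]

end N4

/-! ### Notation for elements of `𝒜 ⊗ Ŝ` -/

section Elements

variable {k : Type*} [Field k]

/-- The generator `u`, as an element of `N4 k`. -/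
def gen (u : Gen) : N4 k := Pi.single u 1

/-- The inclusion of `sl₂(Ŝ)` in `𝒜 ⊗ Ŝ`: it sends `∑_s f_s J^s` to `∑_s J^s ⊗ f_s`, where
`f_s = tr(M σ^s)` for a traceless matrix `M`. -/
def ofSl2 (i : k) (M : Matrix (Fin 2) (Fin 2) (Shat k)) : Shat k ⊗[k] N4 k :=
  ∑ s, Matrix.trace (M * (pauli i s).map (algebraMap k (Shat k))) ⊗ₜ[k] gen (Gen.J s)

/-- `(a, b)ᵗ ⊗ (1, 0)ᵗ := G^1 ⊗ a + G^2 ⊗ b`. -/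
def gVec (v : Fin 2 → Shat k) : Shat k ⊗[k] N4 k := ∑ a, v a ⊗ₜ[k] gen (Gen.G a)

/-- `(a, b)ᵗ ⊗ (0, 1)ᵗ := Ḡ^1 ⊗ a + Ḡ^2 ⊗ b`. -/
def gbarVec (v : Fin 2 → Shat k) : Shat k ⊗[k] N4 k := ∑ a, v a ⊗ₜ[k] gen (Gen.Gbar a)

/-- The subgroup of `SL₂(Ŝ) × SL₂(k)` generated by `(-I, -I)`. -/
def signs (k : Type*) [Field k] : Subgroup (SL(2, Shat k) × SL(2, k)) :=
  Subgroup.zpowers (-1, -1)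

instance signs_normal (k : Type*) [Field k] : (signs k).Normal := by
  refine ⟨fun x hx g => ?_⟩
  obtain ⟨n, rfl⟩ := Subgroup.mem_zpowers_iff.1 hx
  have h : Commute g (-1, -1) := by
    refine Prod.ext ?_ ?_ <;> simp
  have e := (h.zpow_right n).eq
  rw [e, mul_inv_cancel_right]
  exact hx

end Elements

end ConformalSuper

end

open ConformalSuper

/-
Let `∂` be the total derivation of `S ⊗ 𝒜`. Every element is uniquely `∑ₙ ∂ⁿ xₙ` with `xₙ` in the
`S`-span of the generators, so an `S`-linear map commuting with `∂` is determined by the images of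
the generators, and such images extend to an endomorphism as soon as they respect the brackets of
generators. Every pair `(Y, X)` thereby gives an automorphism: `Y` acts as a gauge transformation
and `X` rotates `G` into `Ḡ`.

Conversely, let `σ` be an automorphism. Comparing the highest powers of `∂` in brackets with
currents shows that `σ` sends currents to currents, `L` to `L + M` with `M ∈ sl₂(S)`, and the
span of the odd generators to itself; on the latter it is a `2 × 2` block matrix, whose block
`A : G → G` may be assumed nonzero after a rotation. The bracket with the currents makes `A`
an intertwiner, so `det A ≠ 0`, and the bracket with `L` gives `A' = -Mᵀ A` with `tr M = 0`,
so `det A` is a constant `c²`. The gauge transformation by `c⁻¹ Aᵀ` reduces to `A = c`. Then `σ`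
fixes all currents, and by Schur's lemma the other blocks are constant multiples of `1` or `ε`,
so `σ` is a rotation.
-/

noncomputable section

namespace ConformalSuper

namespace ConformalSuperalgebra

variable {k S A B : Type*} [Field k] [CommRing S] [Algebra k S] {δ : Derivation k S S}
  [AddCommGroup A] [Module k A] [Module S A] [IsScalarTower k S A] [AddCommGroup B] [Module k B]

theorem nProd_der_pow_left (𝒜 : ConformalSuperalgebra δ A) (n p : ℕ) (a b : A) :
    𝒜.nProd n ((𝒜.der ^ p) a) b = ((-1) ^ p * (n.descFactorial p : k)) • 𝒜.nProd (n - p) a b := by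
  induction p generalizing n with
  | zero => simp
  | succ p ih =>
    rw [pow_succ', Module.End.mul_apply, 𝒜.nProd_der_left, ih]
    rcases n with _ | n
    · simp
    · rw [Nat.succ_descFactorial_succ, Nat.add_sub_cancel, Nat.add_sub_add_right]
      push_cast
      module

theorem map_nProd_der_pow_right (𝒜 : ConformalSuperalgebra δ A) (f : A →ₗ[k] B)
    (hf : ∀ x, f (𝒜.der x) = 0) (n q : ℕ) (a b : A) :
    f (𝒜.nProd n a ((𝒜.der ^ q) b)) = (n.descFactorial q : k) • f (𝒜.nProd (n - q) a b) := by
  induction q generalizing n with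
  | zero => simp
  | succ q ih =>
    rw [pow_succ', Module.End.mul_apply, 𝒜.nProd_der_right, map_add, hf, zero_add, map_smul, ih]
    rcases n with _ | n
    · simp
    · rw [Nat.succ_descFactorial_succ, Nat.add_sub_cancel, Nat.add_sub_add_right]
      push_cast
      module

theorem map_nProd_der_pow (𝒜 : ConformalSuperalgebra δ A) (f : A →ₗ[k] B)
    (hf : ∀ x, f (𝒜.der x) = 0) (n p q : ℕ) (a b : A) :
    f (𝒜.nProd n ((𝒜.der ^ p) a) ((𝒜.der ^ q) b))
      = ((-1) ^ p * (n.descFactorial (p + q) : k)) • f (𝒜.nProd (n - (p + q)) a b) := by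
  have h : n.descFactorial (p + q) = (n - p).descFactorial q * n.descFactorial p := by
    rw [← Nat.descFactorial_mul_descFactorial (Nat.le_add_right p q), Nat.add_sub_cancel_left]
  rw [nProd_der_pow_left, map_smul, map_nProd_der_pow_right 𝒜 f hf, smul_smul, Nat.sub_sub, h]
  push_cast
  module

end ConformalSuperalgebra

section StructureConstants

variable {k : Type*} [Field k]

theorem sum_gen {M : Type*} [AddCommMonoid M] (f : Gen → M) :
    ∑ u, f u = f .L + ∑ s, f (.J s) + ∑ a, f (.G a) + ∑ a, f (.Gbar a) := by
  have h : (Finset.univ : Finset Gen) = {.L, .J 0, .J 1, .J 2, .G 0, .G 1, .Gbar 0, .Gbar 1} := by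
    decide
  rw [h]
  simp [Fin.sum_univ_succ]
  abel

/-- The coefficient of `λ` in the bracket `[u_λ v]` of two generators. -/
def lamCoeff (i : k) : Gen → Gen → Gen → k
  | .L, .L => Pi.single .L 2
  | .L, .J s => Pi.single (.J s) 1
  | .L, .G a => Pi.single (.G a) (3 / 2)
  | .L, .Gbar a => Pi.single (.Gbar a) (3 / 2)
  | .J s, .L => Pi.single (.J s) 1
  | .G a, .L => Pi.single (.G a) (3 / 2)
  | .G a, .Gbar b => -∑ s, Pi.single (.J s) (4 * pauli i s a b)
  | .Gbar a, .L => Pi.single (.Gbar a) (3 / 2)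
  | .Gbar b, .G a => ∑ s, Pi.single (.J s) (4 * pauli i s a b)
  | _, _ => 0

/-- The coefficient of `∂` in the bracket `[u_λ v]` of two generators. -/
def derCoeff (i : k) : Gen → Gen → Gen → k
  | .L, .L => Pi.single .L 1
  | .L, .J s => Pi.single (.J s) 1
  | .L, .G a => Pi.single (.G a) 1
  | .L, .Gbar a => Pi.single (.Gbar a) 1
  | .G a, .L => Pi.single (.G a) (1 / 2)
  | .G a, .Gbar b => -∑ s, Pi.single (.J s) (2 * pauli i s a b)
  | .Gbar a, .L => Pi.single (.Gbar a) (1 / 2)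
  | .Gbar b, .G a => ∑ s, Pi.single (.J s) (2 * pauli i s a b)
  | _, _ => 0

/-- The constant coefficient of the bracket `[u_λ v]` of two generators. -/
def constCoeff (i : k) : Gen → Gen → Gen → k
  | .J m, .J n => ∑ s, Pi.single (.J s)
      (Matrix.trace ((Jmat i m * Jmat i n - Jmat i n * Jmat i m) * pauli i s))
  | .J s, .G a => ∑ b, Pi.single (.G b) (-(1 / 2) * pauli i s a b)
  | .J s, .Gbar a => ∑ b, Pi.single (.Gbar b) ((1 / 2) * pauli i s b a)
  | .G a, .J s => ∑ b, Pi.single (.G b) ((1 / 2) * pauli i s a b)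
  | .G a, .Gbar b => Pi.single .L (if a = b then 2 else 0)
  | .Gbar a, .J s => ∑ b, Pi.single (.Gbar b) (-(1 / 2) * pauli i s b a)
  | .Gbar b, .G a => Pi.single .L (if a = b then 2 else 0)
  | _, _ => 0

set_option maxHeartbeats 2000000 in
-- A case check over the 512 triples of kinds of generators.
theorem genBracket_eq (i : k) (u v w : Gen) : genBracket i u v w
    = Polynomial.C
        (Polynomial.C (constCoeff i u v w) + Polynomial.C (derCoeff i u v w) * Polynomial.X)
      + Polynomial.C (Polynomial.C (lamCoeff i u v w)) * Polynomial.X := by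
  cases u <;> cases v <;> cases w <;>
    simp only [genBracket, constCoeff, derCoeff, lamCoeff, Pi.single_apply, Finset.sum_apply,
      Pi.sub_apply, Pi.add_apply, Pi.neg_apply, Pi.zero_apply, reduceCtorEq, if_false, if_true,
      Finset.sum_const_zero, Gen.J.injEq, Gen.G.injEq, Gen.Gbar.injEq, Finset.sum_ite_eq,
      Finset.mem_univ, map_zero, zero_mul, add_zero, zero_add,
      sub_zero, neg_zero, map_mul, map_neg, map_ofNat, map_one, one_mul, zero_sub] <;>
    (try split_ifs) <;> (try simp only [map_zero, map_one]) <;> (try ring1)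

theorem lambdaBracket_gen (i : k) (u v : Gen) :
    lambdaBracket i (gen u) (gen v) = genBracket i u v := by
  funext w
  rw [lambdaBracket, Fintype.sum_eq_single u fun u' h => by simp [gen, Pi.single_eq_of_ne h],
    Fintype.sum_eq_single v fun v' h => by simp [gen, Pi.single_eq_of_ne h]]
  simp [gen]

theorem n4Prod_gen_zero (i : k) (u v : Gen) : n4Prod i 0 (gen u) (gen v)
    = ∑ w, (constCoeff i u v w • gen w + derCoeff i u v w • n4Der k (gen w)) := by
  ext1 w
  rw [n4Prod_apply, lambdaBracket_gen, genBracket_eq, Finset.sum_apply,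
    Fintype.sum_eq_single w fun w' h => by simp [gen, n4Der, Pi.single_eq_of_ne h.symm]]
  simp [gen, n4Der, Polynomial.smul_eq_C_mul]

theorem n4Prod_gen_one (i : k) (u v : Gen) : n4Prod i 1 (gen u) (gen v)
    = ∑ w, lamCoeff i u v w • gen w := by
  ext1 w
  rw [n4Prod_apply, lambdaBracket_gen, genBracket_eq, Finset.sum_apply,
    Fintype.sum_eq_single w fun w' h => by simp [gen, Pi.single_eq_of_ne h.symm]]
  simp [gen, Polynomial.smul_eq_C_mul, Polynomial.coeff_C]

theorem n4Prod_gen_of_two_le (i : k) (u v : Gen) {n : ℕ} (hn : 2 ≤ n) :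
    n4Prod i n (gen u) (gen v) = 0 := by
  ext1 w
  rw [n4Prod_apply, lambdaBracket_gen, genBracket_eq]
  obtain ⟨n, rfl⟩ := Nat.exists_eq_add_of_le' hn
  simp

end StructureConstants

section Combinations

variable {k S : Type*} [Field k] [CommRing S] [Algebra k S]

/-- The combination `∑_u w_u u` of the generators with coefficients in `S`. -/
def comb : (Gen → S) →ₗ[S] S ⊗[k] N4 k :=
  Fintype.linearCombination S fun u => 1 ⊗ₜ gen u

theorem comb_apply (w : Gen → S) : comb (k := k) w = ∑ u, w u ⊗ₜ gen u := by
  simp [comb, Fintype.linearCombination_apply, TensorProduct.smul_tmul']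

theorem comb_single (u : Gen) (r : S) : comb (k := k) (Pi.single u r) = r ⊗ₜ gen u := by
  rw [comb, Fintype.linearCombination_apply_single, TensorProduct.smul_tmul', smul_eq_mul, mul_one]

theorem comb_eq_sum_sum (f : Gen → Gen → Gen → S) :
    comb (k := k) (fun w => ∑ u, ∑ v, f u v w) = ∑ u, ∑ v, ∑ w, f u v w ⊗ₜ gen w := by
  simp only [comb_apply, TensorProduct.sum_tmul]
  rw [Finset.sum_comm]
  exact Finset.sum_congr rfl fun u _ => Finset.sum_comm

/-- The coefficient of `λ` in the bracket of two combinations of generators. -/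
def lamProd (i : k) (x y : Gen → S) : Gen → S := fun w =>
  ∑ u, ∑ v, lamCoeff i u v w • (x u * y v)

/-- The coefficient of the derivation in the bracket of two combinations of generators. -/
def derProd (i : k) (x y : Gen → S) : Gen → S := fun w =>
  ∑ u, ∑ v, derCoeff i u v w • (x u * y v)

/-- The constant coefficient of the bracket of two combinations of generators. -/
def constProd (δ : Derivation k S S) (i : k) (x y : Gen → S) : Gen → S := fun w =>
  ∑ u, ∑ v, (constCoeff i u v w • (x u * y v) + lamCoeff i u v w • (δ (x u) * y v)
    - derCoeff i u v w • δ (x u * y v))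

variable [CharZero k] (δ : Derivation k S S)

/-- The `N = 4` conformal superalgebra over the differential ring `(S, δ)`. -/
abbrev n4Over (i : k) : ConformalSuperalgebra δ (S ⊗[k] N4 k) := (n4 i).baseChange δ

theorem der_tmul (i : k) (r : S) (a : N4 k) :
    (n4Over δ i).der (r ⊗ₜ a) = r ⊗ₜ n4Der k a + δ r ⊗ₜ a := rfl

theorem nProd_tmul_gen (i : k) (n : ℕ) (r s : S) (u v : Gen) :
    (n4Over δ i).nProd n (r ⊗ₜ gen u) (s ⊗ₜ gen v)
      = (r * s) ⊗ₜ n4Prod i n (gen u) (gen v)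
        + (δ r * s) ⊗ₜ n4Prod i (n + 1) (gen u) (gen v) := by
  refine (ConformalSuperalgebra.bcProd_tmul (n4 i) δ n r s (gen u) (gen v) (N := 2)
    (fun m hm => n4Prod_gen_of_two_le i u v hm) (M := 2) (by omega)).trans ?_
  rw [Finset.sum_range_succ, Finset.sum_range_one]
  simp [dpow, n4]

theorem nProd_comb (i : k) (n : ℕ) (x y : Gen → S) :
    (n4Over δ i).nProd n (comb x) (comb y)
      = ∑ u, ∑ v, ((x u * y v) ⊗ₜ n4Prod i n (gen u) (gen v)
        + (δ (x u) * y v) ⊗ₜ n4Prod i (n + 1) (gen u) (gen v)) := by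
  simp only [comb_apply, map_sum, LinearMap.sum_apply, nProd_tmul_gen]
  rw [Finset.sum_comm]

theorem nProd_comb_of_two_le (i : k) {n : ℕ} (hn : 2 ≤ n) (x y : Gen → S) :
    (n4Over δ i).nProd n (comb x) (comb y) = 0 := by
  simp [nProd_comb, n4Prod_gen_of_two_le _ _ _ hn,
    n4Prod_gen_of_two_le _ _ _ (Nat.le_succ_of_le hn)]

theorem nProd_comb_one (i : k) (x y : Gen → S) :
    (n4Over δ i).nProd 1 (comb x) (comb y) = comb (lamProd i x y) := by
  unfold lamProd
  simp only [nProd_comb, comb_eq_sum_sum, n4Prod_gen_one, n4Prod_gen_of_two_le i _ _ le_rfl,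
    TensorProduct.tmul_zero, add_zero, TensorProduct.tmul_sum, TensorProduct.smul_tmul]

theorem nProd_comb_zero (i : k) (x y : Gen → S) :
    (n4Over δ i).nProd 0 (comb x) (comb y)
      = (n4Over δ i).der (comb (derProd i x y)) + comb (constProd δ i x y) := by
  unfold derProd constProd
  simp only [nProd_comb, comb_eq_sum_sum, map_sum, ← Finset.sum_add_distrib]
  refine Finset.sum_congr rfl fun u _ => Finset.sum_congr rfl fun v _ => ?_
  simp only [zero_add, n4Prod_gen_zero, n4Prod_gen_one, TensorProduct.tmul_sum,
    ← Finset.sum_add_distrib]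
  refine Finset.sum_congr rfl fun w _ => ?_
  rw [der_tmul, Derivation.map_smul, TensorProduct.sub_tmul, TensorProduct.add_tmul,
    TensorProduct.tmul_add]
  simp only [TensorProduct.smul_tmul]
  abel

end Combinations

section Coordinates

variable {k S : Type*} [Field k] [CommRing S] [Algebra k S]

theorem smul_eq_algebraMap_mul (a : k) (x : S) : a • x = algebraMap k S a * x :=
  Algebra.smul_def a x

theorem trace_mul_pauli (i : k) (M : Matrix (Fin 2) (Fin 2) S) (s : Fin 3) :
    (M * (pauli i s).map (algebraMap k S)).trace
      = ![M 0 1 + M 1 0, algebraMap k S i * (M 0 1 - M 1 0), M 0 0 - M 1 1] s := by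
  fin_cases s <;>
    simp [pauli, Matrix.trace_fin_two, Matrix.mul_apply, Fin.sum_univ_two] <;> ring

theorem derivation_trace_mul_pauli (δ : Derivation k S S) (i : k) (M : Matrix (Fin 2) (Fin 2) S)
    (s : Fin 3) : δ (M * (pauli i s).map (algebraMap k S)).trace
      = (M.map δ * (pauli i s).map (algebraMap k S)).trace := by
  rw [trace_mul_pauli, trace_mul_pauli]
  fin_cases s <;> simp

/-- The coordinates of `L ⊗ r + M + G(v) + Ḡ(w)` with respect to the generators. The matrix `M`
only matters modulo scalar matrices. -/
def coords (i : k) (r : S) (M : Matrix (Fin 2) (Fin 2) S) (v w : Fin 2 → S) : Gen → S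
  | .L => r
  | .J s => (M * (pauli i s).map (algebraMap k S)).trace
  | .G a => v a
  | .Gbar a => w a

theorem coords_comp_G (i : k) (r : S) (M : Matrix (Fin 2) (Fin 2) S) (v w : Fin 2 → S) :
    coords i r M v w ∘ Gen.G = v := rfl

theorem coords_comp_Gbar (i : k) (r : S) (M : Matrix (Fin 2) (Fin 2) S) (v w : Fin 2 → S) :
    coords i r M v w ∘ Gen.Gbar = w := rfl

theorem coords_add (i : k) (r r' : S) (M M' : Matrix (Fin 2) (Fin 2) S) (v w v' w' : Fin 2 → S) :
    coords i r M v w + coords i r' M' v' w'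
      = coords i (r + r') (M + M') (v + v') (w + w') := by
  ext1 u
  cases u <;> simp [coords, add_mul]

theorem smul_coords (i : k) (c r : S) (M : Matrix (Fin 2) (Fin 2) S) (v w : Fin 2 → S) :
    c • coords i r M v w = coords i (c * r) (c • M) (c • v) (c • w) := by
  ext1 u
  cases u <;> simp [coords]

theorem coords_zero (i : k) : coords i (0 : S) 0 0 0 = 0 := by
  ext1 u
  cases u <;> simp [coords]

theorem coords_add_scalar (i : k) (r c : S) (M : Matrix (Fin 2) (Fin 2) S) (v w : Fin 2 → S) :
    coords i r (M + c • 1) v w = coords i r M v w := by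
  ext1 u
  rcases u with _ | s | a | a
  case J => fin_cases s <;> simp [coords, trace_mul_pauli]
  all_goals rfl

/-- The `sl₂`-component `∑_s w_s J^s` of a combination of the generators. -/
def sl2Part (i : k) (w : Gen → S) : Matrix (Fin 2) (Fin 2) S :=
  ∑ s, w (.J s) • (Jmat i s).map (algebraMap k S)

theorem sl2Part_apply (i : k) (w : Gen → S) (a b : Fin 2) :
    sl2Part i w a b = ∑ s, w (.J s) * algebraMap k S (Jmat i s a b) := by
  simp [sl2Part, Matrix.sum_apply]

theorem sl2Part_add (i : k) (x y : Gen → S) : sl2Part i (x + y) = sl2Part i x + sl2Part i y := by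
  simp only [sl2Part, Pi.add_apply, add_smul, Finset.sum_add_distrib]

theorem sl2Part_smul (i : k) (c : S) (x : Gen → S) : sl2Part i (c • x) = c • sl2Part i x := by
  simp only [sl2Part, Pi.smul_apply, smul_assoc, Finset.smul_sum]

theorem sl2Part_eq_zero (i : k) {x : Gen → S} (hx : ∀ s, x (.J s) = 0) : sl2Part i x = 0 := by
  simp [sl2Part, hx]

theorem trace_sl2Part (i : k) (w : Gen → S) : (sl2Part i w).trace = 0 := by
  simp [sl2Part, Jmat, pauli, Matrix.trace_fin_two, Fin.sum_univ_three]

theorem lamProd_coords (i : k) (r r' : S) (M M' : Matrix (Fin 2) (Fin 2) S)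
    (v w v' w' : Fin 2 → S) :
    lamProd i (coords i r M v w) (coords i r' M' v' w')
      = coords i (2 * (r * r'))
        (r • M' + r' • M + (4 : S) • (Matrix.vecMulVec w v' - Matrix.vecMulVec w' v))
        ((3 / 2 : k) • (r • v' + r' • v)) ((3 / 2 : k) • (r • w' + r' • w)) := by
  ext1 u
  rcases u with _ | s | a | a
  case L =>
    simp [lamProd, sum_gen, lamCoeff, coords, smul_eq_algebraMap_mul, map_ofNat (algebraMap k S)]
  case J =>
    simp only [coords, trace_mul_pauli, lamProd, sum_gen, lamCoeff, Finset.sum_apply,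
      Pi.single_apply]
    fin_cases s <;>
      simp [Fin.sum_univ_succ, pauli, smul_eq_algebraMap_mul, map_ofNat (algebraMap k S),
        Matrix.vecMulVec_apply] <;> ring
  all_goals
    fin_cases a <;>
      simp [lamProd, sum_gen, lamCoeff, coords, Pi.single_apply, Fin.sum_univ_succ,
        smul_eq_algebraMap_mul] <;> ring

theorem derProd_coords (i : k) (r r' : S) (M M' : Matrix (Fin 2) (Fin 2) S)
    (v w v' w' : Fin 2 → S) :
    derProd i (coords i r M v w) (coords i r' M' v' w')
      = coords i (r * r')
        (r • M' + (2 : S) • (Matrix.vecMulVec w v' - Matrix.vecMulVec w' v))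
        (r • v' + (1 / 2 : k) • r' • v) (r • w' + (1 / 2 : k) • r' • w) := by
  ext1 u
  rcases u with _ | s | a | a
  case L => simp [derProd, sum_gen, derCoeff, coords, Finset.sum_apply]
  case J =>
    simp only [coords, trace_mul_pauli, derProd, sum_gen, derCoeff, Finset.sum_apply,
      Pi.single_apply]
    fin_cases s <;>
      simp [Fin.sum_univ_succ, pauli, smul_eq_algebraMap_mul, map_ofNat (algebraMap k S),
        Matrix.vecMulVec_apply] <;> ring
  all_goals
    fin_cases a <;>
      simp [derProd, sum_gen, derCoeff, coords, Pi.single_apply, Fin.sum_univ_succ,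
        smul_eq_algebraMap_mul] <;> ring

theorem lamProd_L (i : k) (x y : Gen → S) : lamProd i x y .L = 2 * (x .L * y .L) := by
  simp [lamProd, sum_gen, lamCoeff, smul_eq_algebraMap_mul, map_ofNat (algebraMap k S)]

theorem constProd_L (δ : Derivation k S S) (i : k) (x y : Gen → S) :
    constProd δ i x y .L = δ (x .L) * y .L - x .L * δ (y .L)
      + ∑ a, 2 * (x (.G a) * y (.Gbar a) + x (.Gbar a) * y (.G a)) := by
  simp [constProd, sum_gen, constCoeff, lamCoeff, derCoeff, Fin.sum_univ_succ,
    smul_eq_algebraMap_mul, map_ofNat (algebraMap k S)]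
  ring

theorem trace_commutator_sl2Part (i : k) (x y : Gen → S) (s : Fin 3) :
    ((sl2Part i x * sl2Part i y - sl2Part i y * sl2Part i x)
        * (pauli i s).map (algebraMap k S)).trace
      = ∑ m, ∑ n, algebraMap k S ((Jmat i m * Jmat i n - Jmat i n * Jmat i m) * pauli i s).trace
          * (x (.J m) * y (.J n)) := by
  have h (A : Matrix (Fin 2) (Fin 2) k) :
      algebraMap k S A.trace = (A.map (algebraMap k S)).trace :=
    AddMonoidHom.map_trace (algebraMap k S) A
  have hc (m n : Fin 3) : ((Jmat i m * Jmat i n - Jmat i n * Jmat i m) * pauli i s).map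
      (algebraMap k S) = ((Jmat i m).map (algebraMap k S) * (Jmat i n).map (algebraMap k S)
        - (Jmat i n).map (algebraMap k S) * (Jmat i m).map (algebraMap k S))
        * (pauli i s).map (algebraMap k S) := by
    simp only [← RingHom.mapMatrix_apply, map_mul, map_sub]
  simp only [h, hc]
  simp only [sl2Part, Finset.sum_mul, Finset.mul_sum, sub_mul, Matrix.trace_sub,
    Matrix.trace_sum, smul_mul_assoc, mul_smul_comm, Matrix.trace_smul, smul_eq_mul]
  rw [Finset.sum_comm (f := fun n m => y (.J n) * _)]
  simp only [← Finset.sum_sub_distrib]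
  exact Finset.sum_congr rfl fun m _ => Finset.sum_congr rfl fun n _ => by ring

theorem constProd_J (δ : Derivation k S S) (i : k) (x y : Gen → S) (s : Fin 3) :
    constProd δ i x y (.J s)
      = δ (x (.J s)) * y .L - x .L * δ (y (.J s))
      + ((sl2Part i x * sl2Part i y - sl2Part i y * sl2Part i x)
          * (pauli i s).map (algebraMap k S)).trace
      + ∑ a, ∑ b, 2 * algebraMap k S (pauli i s a b) *
          (x (.G a) * δ (y (.Gbar b)) - δ (x (.G a)) * y (.Gbar b)
            + δ (x (.Gbar b)) * y (.G a) - x (.Gbar b) * δ (y (.G a))) := by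
  rw [trace_commutator_sl2Part]
  simp only [constProd, sum_gen, constCoeff, lamCoeff, derCoeff, Pi.single_apply,
    smul_eq_algebraMap_mul, Derivation.leibniz, smul_eq_mul, Pi.zero_apply, reduceCtorEq, if_false,
    map_zero, zero_mul, add_zero, sub_zero, zero_add, Gen.J.injEq, Pi.neg_apply, map_neg,
    Fin.sum_univ_two, Fin.sum_univ_three]
  fin_cases s <;> simp [map_ofNat (algebraMap k S)] <;> ring

theorem algebraMap_three_halves [CharZero k] :
    algebraMap k S (3 / 2) = 1 + algebraMap k S (1 / 2) := by
  rw [← map_one (algebraMap k S), ← map_add]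
  norm_num

theorem constProd_G [CharZero k] (δ : Derivation k S S) (i : k) (x y : Gen → S) (a : Fin 2) :
    constProd δ i x y (.G a)
      = algebraMap k S (1 / 2) * (δ (x .L) * y (.G a) - x (.G a) * δ (y .L))
      + δ (x (.G a)) * y .L - x .L * δ (y (.G a))
      + ((sl2Part i y)ᵀ *ᵥ (x ∘ Gen.G) - (sl2Part i x)ᵀ *ᵥ (y ∘ Gen.G)) a := by
  simp only [constProd, sum_gen, constCoeff, lamCoeff, derCoeff, Pi.single_apply,
    smul_eq_algebraMap_mul, Derivation.leibniz, smul_eq_mul, Pi.zero_apply, reduceCtorEq, if_false,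
    map_zero, zero_mul, add_zero, sub_zero, zero_add, Gen.G.injEq, Fin.sum_univ_two,
    Fin.sum_univ_three, Pi.sub_apply, Matrix.mulVec, dotProduct, Matrix.transpose_apply,
    sl2Part_apply, Jmat, Matrix.smul_apply, map_mul, Function.comp_apply]
  fin_cases a <;> simp [algebraMap_three_halves] <;> ring

theorem constProd_Gbar [CharZero k] (δ : Derivation k S S) (i : k) (x y : Gen → S) (a : Fin 2) :
    constProd δ i x y (.Gbar a)
      = algebraMap k S (1 / 2) * (δ (x .L) * y (.Gbar a) - x (.Gbar a) * δ (y .L))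
      + δ (x (.Gbar a)) * y .L - x .L * δ (y (.Gbar a))
      + (sl2Part i x *ᵥ (y ∘ Gen.Gbar) - sl2Part i y *ᵥ (x ∘ Gen.Gbar)) a := by
  simp only [constProd, sum_gen, constCoeff, lamCoeff, derCoeff, Pi.single_apply,
    smul_eq_algebraMap_mul, Derivation.leibniz, smul_eq_mul, Pi.zero_apply, reduceCtorEq, if_false,
    map_zero, zero_mul, add_zero, sub_zero, zero_add, Gen.Gbar.injEq, Fin.sum_univ_two,
    Fin.sum_univ_three, Pi.sub_apply, Matrix.mulVec, dotProduct,
    sl2Part_apply, Jmat, Matrix.smul_apply, map_mul, Function.comp_apply]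
  fin_cases a <;> simp [algebraMap_three_halves] <;> ring

variable [CharZero k] {i : k} (hi : i * i = -1)
include hi

theorem sl2Part_coords (r : S) {M : Matrix (Fin 2) (Fin 2) S} (hM : M.trace = 0) (v w : Fin 2 → S) :
    sl2Part i (coords i r M v w) = M := by
  have hI : algebraMap k S i * algebraMap k S i = -1 := by rw [← map_mul, hi, map_neg, map_one]
  have h2 : algebraMap k S 2⁻¹ * 2 = 1 := by
    rw [← map_ofNat (algebraMap k S) 2, ← map_mul, inv_mul_cancel₀ two_ne_zero, map_one]
  have hM1 : M 1 1 = -M 0 0 := eq_neg_of_add_eq_zero_right (Matrix.trace_fin_two M ▸ hM)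
  ext a b
  simp only [sl2Part_apply, coords, trace_mul_pauli, Fin.sum_univ_three]
  fin_cases a <;> fin_cases b <;> simp [Jmat, pauli, hM1]
  · linear_combination M 0 0 * h2
  · linear_combination
      M 0 1 * h2 - algebraMap k S 2⁻¹ * (M 0 1 - M 1 0) * hI
  · linear_combination
      M 1 0 * h2 + algebraMap k S 2⁻¹ * (M 0 1 - M 1 0) * hI
  · linear_combination M 0 0 * h2

theorem exists_sl2Part_coords (r : S) (M : Matrix (Fin 2) (Fin 2) S) (v w : Fin 2 → S) :
    ∃ c : S, sl2Part i (coords i r M v w) = M + c • 1 := by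
  refine ⟨-(algebraMap k S 2⁻¹ * M.trace), ?_⟩
  rw [← coords_add_scalar i r (-(algebraMap k S 2⁻¹ * M.trace)), sl2Part_coords hi]
  have h2 : algebraMap k S 2⁻¹ * 2 = 1 := by
    rw [← map_ofNat (algebraMap k S) 2, ← map_mul, inv_mul_cancel₀ two_ne_zero, map_one]
  rw [Matrix.trace_add, Matrix.trace_smul, Matrix.trace_one, Fintype.card_fin, smul_eq_mul]
  push_cast
  linear_combination -M.trace * h2

theorem coords_parts (w : Gen → S) :
    coords i (w .L) (sl2Part i w) (w ∘ Gen.G) (w ∘ Gen.Gbar) = w := by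
  have hI : algebraMap k S i * algebraMap k S i = -1 := by rw [← map_mul, hi, map_neg, map_one]
  have h2 : algebraMap k S 2⁻¹ * 2 = 1 := by
    rw [← map_ofNat (algebraMap k S) 2, ← map_mul, inv_mul_cancel₀ two_ne_zero, map_one]
  ext1 u
  rcases u with _ | s | a | a
  case J =>
    simp only [coords, trace_mul_pauli, sl2Part_apply, Fin.sum_univ_three]
    fin_cases s <;> simp [Jmat, pauli]
    · linear_combination w (.J 0) * h2
    · linear_combination -2 * algebraMap k S 2⁻¹ * w (.J 1) * hI + w (.J 1) * h2
    · linear_combination w (.J 2) * h2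
  all_goals rfl

theorem constProd_coords (δ : Derivation k S S) (r r' : S) {M M' : Matrix (Fin 2) (Fin 2) S}
    (hM : M.trace = 0) (hM' : M'.trace = 0) (v w v' w' : Fin 2 → S) :
    constProd δ i (coords i r M v w) (coords i r' M' v' w')
      = coords i (δ r * r' - r * δ r' + 2 * (v ⬝ᵥ w') + 2 * (w ⬝ᵥ v'))
        (r' • M.map δ - r • M'.map δ + (M * M' - M' * M)
          + (2 : S) • (Matrix.vecMulVec (δ ∘ w') v - Matrix.vecMulVec w' (δ ∘ v))
          + (2 : S) • (Matrix.vecMulVec (δ ∘ w) v' - Matrix.vecMulVec w (δ ∘ v')))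
        ((1 / 2 : k) • (δ r • v' - δ r' • v) + r' • (δ ∘ v) - r • (δ ∘ v') + (M'ᵀ *ᵥ v - Mᵀ *ᵥ v'))
        ((1 / 2 : k) • (δ r • w' - δ r' • w) + r' • (δ ∘ w) - r • (δ ∘ w')
          + (M *ᵥ w' - M' *ᵥ w)) := by
  ext1 u
  rcases u with _ | s | a | a
  case L =>
    simp [constProd_L, coords, dotProduct]
    ring
  case J =>
    rw [constProd_J, sl2Part_coords hi r hM, sl2Part_coords hi r' hM']
    simp only [coords, derivation_trace_mul_pauli]
    simp only [trace_mul_pauli]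
    fin_cases s <;>
      simp [Fin.sum_univ_succ, pauli, Matrix.vecMulVec_apply] <;> ring
  case G =>
    rw [constProd_G, sl2Part_coords hi r hM, sl2Part_coords hi r' hM']
    fin_cases a <;> simp [coords, coords_comp_G, smul_eq_algebraMap_mul] <;> ring
  case Gbar =>
    rw [constProd_Gbar, sl2Part_coords hi r hM, sl2Part_coords hi r' hM']
    fin_cases a <;> simp [coords, coords_comp_Gbar, smul_eq_algebraMap_mul] <;> ring

end Coordinates

section DerivationExpansion

variable {k : Type*} [Field k]

theorem n4Der_pow_gen (u : Gen) (n : ℕ) :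
    (n4Der k ^ n) (gen u) = Pi.single u (Polynomial.X ^ n) := by
  induction n with
  | zero => rfl
  | succ n ih =>
    rw [pow_succ', Module.End.mul_apply, ih]
    ext1 v
    rcases eq_or_ne v u with rfl | h
    · simp [n4Der, pow_succ']
    · simp [n4Der, Pi.single_eq_of_ne h]

theorem n4_eq_sum (x : N4 k) :
    x = ∑ u, (x u).sum fun n c => c • (n4Der k ^ n) (gen u) := by
  simp only [n4Der_pow_gen, Polynomial.sum_def]
  ext1 v
  rw [Finset.sum_apply, Fintype.sum_eq_single v fun u h => by
    simp [Finset.sum_apply, Pi.single_eq_of_ne h.symm]]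
  conv_lhs => rw [(x v).as_sum_support]
  simp [Finset.sum_apply, Polynomial.smul_X_eq_monomial]

variable {S : Type*} [CommRing S] [Algebra k S]

/-- The coefficient of `∂^n u` of an element of `S ⊗ N4 k`. -/
def delCoeff (n : ℕ) (u : Gen) : S ⊗[k] N4 k →ₗ[k] S :=
  TensorProduct.lift ((LinearMap.lsmul k S).flip.compl₂
    ((Polynomial.lcoeff k n) ∘ₗ LinearMap.proj u))

theorem delCoeff_tmul (n : ℕ) (u : Gen) (r : S) (x : N4 k) :
    delCoeff n u (r ⊗ₜ x) = (x u).coeff n • r := rfl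

theorem delCoeff_comb (n : ℕ) (u : Gen) (w : Gen → S) :
    delCoeff (k := k) n u (comb w) = if n = 0 then w u else 0 := by
  rw [comb_apply, map_sum, Fintype.sum_eq_single u fun v h => by
    simp [delCoeff_tmul, gen, Pi.single_eq_of_ne h.symm]]
  simp [delCoeff_tmul, gen, Polynomial.coeff_one]

theorem comb_injective : Function.Injective (comb : (Gen → S) → S ⊗[k] N4 k) := by
  intro w w' h
  ext1 u
  simpa [delCoeff_comb] using congrArg (delCoeff 0 u) h

variable [CharZero k] (δ : Derivation k S S) (i : k)

theorem der_induction {P : S ⊗[k] N4 k → Prop} (zero : P 0)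
    (add : ∀ x y, P x → P y → P (x + y)) (der : ∀ x, P x → P ((n4Over δ i).der x))
    (tmul_gen : ∀ (r : S) u, P (r ⊗ₜ gen u)) (x : S ⊗[k] N4 k) : P x := by
  have tmul_der_pow (n : ℕ) (r : S) (u : Gen) : P (r ⊗ₜ (n4Der k ^ n) (gen u)) := by
    induction n generalizing r with
    | zero => exact tmul_gen r u
    | succ n ih =>
      have h : r ⊗ₜ[k] (n4Der k ^ (n + 1)) (gen u)
          = (n4Over δ i).der (r ⊗ₜ (n4Der k ^ n) (gen u)) + (-δ r) ⊗ₜ (n4Der k ^ n) (gen u) := by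
        rw [der_tmul, pow_succ', Module.End.mul_apply, TensorProduct.neg_tmul,
          add_neg_cancel_right]
      rw [h]
      exact add _ _ (der _ (ih r)) (ih _)
  induction x using TensorProduct.induction_on with
  | zero => exact zero
  | add x y hx hy => exact add x y hx hy
  | tmul r x =>
    rw [n4_eq_sum x, TensorProduct.tmul_sum]
    refine Finset.sum_induction _ P add zero fun u _ => ?_
    rw [Polynomial.sum_def, TensorProduct.tmul_sum]
    refine Finset.sum_induction _ P add zero fun n _ => ?_
    rw [← TensorProduct.smul_tmul]
    exact tmul_der_pow n _ u

/-- The map `(w_n)_n ↦ ∑_n D^n (∑_u w_{n,u} u)`, where `D` is the derivation of `S ⊗ N4 k`. -/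
def derSum : (ℕ →₀ (Gen → S)) →ₗ[k] S ⊗[k] N4 k :=
  Finsupp.lsum k fun n => ((n4Over δ i).der ^ n) ∘ₗ (comb.restrictScalars k)

theorem derSum_single (n : ℕ) (w : Gen → S) :
    derSum δ i (Finsupp.single n w) = ((n4Over δ i).der ^ n) (comb w) := by
  simp [derSum]

theorem der_derSum (f : ℕ →₀ (Gen → S)) :
    (n4Over δ i).der (derSum δ i f) = derSum δ i (f.mapDomain (· + 1)) := by
  induction f using Finsupp.induction_linear with
  | zero => simp
  | add f g hf hg => rw [map_add, map_add, hf, hg, Finsupp.mapDomain_add, map_add]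
  | single n w =>
    rw [Finsupp.mapDomain_single, derSum_single, derSum_single, pow_succ', Module.End.mul_apply]

theorem derSum_surjective : Function.Surjective (derSum δ i) := by
  intro x
  induction x using der_induction δ i with
  | zero => exact ⟨0, map_zero _⟩
  | add x y hx hy =>
    obtain ⟨f, rfl⟩ := hx
    obtain ⟨g, rfl⟩ := hy
    exact ⟨f + g, map_add _ _ _⟩
  | der x hx =>
    obtain ⟨f, rfl⟩ := hx
    exact ⟨_, (der_derSum δ i f).symm⟩
  | tmul_gen r u => exact ⟨Finsupp.single 0 (Pi.single u r), by simp [derSum_single, comb_single]⟩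

theorem delCoeff_der_succ (n : ℕ) (u : Gen) (x : S ⊗[k] N4 k) :
    delCoeff (n + 1) u ((n4Over δ i).der x) = delCoeff n u x + δ (delCoeff (n + 1) u x) := by
  induction x using TensorProduct.induction_on with
  | zero => simp
  | add x y hx hy =>
    simp only [map_add, hx, hy]
    abel
  | tmul r x =>
    rw [der_tmul, map_add, delCoeff_tmul, delCoeff_tmul, delCoeff_tmul, delCoeff_tmul,
      Derivation.map_smul]
    simp [n4Der]

theorem delCoeff_der_pow {m n : ℕ} (hmn : m ≤ n) (u : Gen) (w : Gen → S) :
    delCoeff n u (((n4Over δ i).der ^ m) (comb w)) = if m = n then w u else 0 := by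
  induction m generalizing n with
  | zero => simp [delCoeff_comb, eq_comm]
  | succ m ih =>
    obtain ⟨n, rfl⟩ := Nat.exists_eq_add_of_le' (Nat.le_of_add_left_le hmn)
    rw [pow_succ', Module.End.mul_apply, delCoeff_der_succ, ih (Nat.le_of_succ_le_succ hmn),
      ih (Nat.le_of_succ_le hmn), if_neg (by omega : ¬m = n + 1)]
    simp

-- `∂^m u` is the leading term of `D^m u`, so the largest index in the support survives.
theorem derSum_injective : Function.Injective (derSum δ i) := by
  rw [injective_iff_map_eq_zero]
  intro f hf
  by_contra h
  have hs : f.support.Nonempty := Finsupp.support_nonempty_iff.2 h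
  have hN := Finset.max'_mem _ hs
  refine Finsupp.mem_support_iff.1 hN ?_
  ext1 u
  have e := congrArg (delCoeff (f.support.max' hs) u) hf
  rw [map_zero, derSum, Finsupp.lsum_apply, Finsupp.sum, map_sum, Finset.sum_eq_single _ _
    (fun h => absurd hN h)] at e
  · simpa [delCoeff_der_pow] using e
  · intro m hm hne
    simp [delCoeff_der_pow δ i (Finset.le_max' _ m hm), hne]

/-- The coefficients `w_n` in the expansion `∑_n D^n (∑_u w_{n,u} u)` of an element. -/
def derExpansion : S ⊗[k] N4 k ≃ₗ[k] (ℕ →₀ (Gen → S)) :=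
  (LinearEquiv.ofBijective (derSum δ i) ⟨derSum_injective δ i, derSum_surjective δ i⟩).symm

theorem derExpansion_derSum (f : ℕ →₀ (Gen → S)) : derExpansion δ i (derSum δ i f) = f :=
  (LinearEquiv.ofBijective (derSum δ i) _).symm_apply_apply f

theorem eq_sum_derExpansion (x : S ⊗[k] N4 k) : x = ∑ n ∈ (derExpansion δ i x).support,
    ((n4Over δ i).der ^ n) (comb (derExpansion δ i x n)) :=
  ((LinearEquiv.ofBijective (derSum δ i) _).apply_symm_apply x).symm

theorem derExpansion_comb (w : Gen → S) : derExpansion δ i (comb w) = Finsupp.single 0 w := by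
  rw [← derExpansion_derSum δ i (Finsupp.single 0 w), derSum_single, pow_zero,
    Module.End.one_apply]

theorem derExpansion_der (x : S ⊗[k] N4 k) :
    derExpansion δ i ((n4Over δ i).der x) = (derExpansion δ i x).mapDomain (· + 1) := by
  obtain ⟨f, rfl⟩ := derSum_surjective δ i x
  rw [der_derSum, derExpansion_derSum, derExpansion_derSum]

theorem derExpansion_der_zero (x : S ⊗[k] N4 k) :
    derExpansion δ i ((n4Over δ i).der x) 0 = 0 := by
  rw [derExpansion_der, Finsupp.mapDomain_of_notMem_range]
  simp

end DerivationExpansion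

section Homomorphisms

variable {k S : Type*} [Field k] [CharZero k] [CommRing S] [Algebra k S] {δ : Derivation k S S}
  {i : k}

theorem hom_ext_gen {f g : S ⊗[k] N4 k →ₗ[S] S ⊗[k] N4 k}
    (hf : ∀ x, f ((n4Over δ i).der x) = (n4Over δ i).der (f x))
    (hg : ∀ x, g ((n4Over δ i).der x) = (n4Over δ i).der (g x))
    (h : ∀ u, f (1 ⊗ₜ gen u) = g (1 ⊗ₜ gen u)) : f = g := by
  refine LinearMap.ext fun x => ?_
  induction x using der_induction δ i with
  | zero => simp
  | add x y hx hy => rw [map_add, map_add, hx, hy]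
  | der x hx => rw [hf, hg, hx]
  | tmul_gen r u =>
    rw [← mul_one r, ← smul_eq_mul, ← TensorProduct.smul_tmul', map_smul, map_smul, h]

theorem map_nProd_of_gen {f : S ⊗[k] N4 k ≃ₗ[S] S ⊗[k] N4 k}
    (hf : ∀ x, f ((n4Over δ i).der x) = (n4Over δ i).der (f x))
    (h : ∀ n u v, f ((n4Over δ i).nProd n (1 ⊗ₜ gen u) (1 ⊗ₜ gen v))
      = (n4Over δ i).nProd n (f (1 ⊗ₜ gen u)) (f (1 ⊗ₜ gen v))) (n : ℕ) (x y : S ⊗[k] N4 k) :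
    f ((n4Over δ i).nProd n x y) = (n4Over δ i).nProd n (f x) (f y) := by
  have hk (c : k) x : f (c • x) = c • f x := f.toLinearMap.map_smul_of_tower c x
  have e (r : S) u : r ⊗ₜ[k] gen u = r • ((1 : S) ⊗ₜ[k] (gen u : N4 k)) := by
    rw [TensorProduct.smul_tmul', smul_eq_mul, mul_one]
  induction x using der_induction δ i generalizing n with
  | zero => simp
  | add x x' hx hx' => simp only [map_add, LinearMap.add_apply, hx, hx']
  | der x hx =>
    rw [hf, (n4Over δ i).nProd_der_left, (n4Over δ i).nProd_der_left, map_neg, hk, hx]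
  | tmul_gen r u =>
    induction y using der_induction δ i generalizing n with
    | zero => simp
    | add x x' hx hx' => simp only [map_add, hx, hx']
    | der x hx =>
      rw [hf, (n4Over δ i).nProd_der_right, (n4Over δ i).nProd_der_right, map_add, hf, hk, hx, hx]
    | tmul_gen s v =>
      rw [e r, e s, (n4Over δ i).nProd_smul_right, f.map_smul, f.map_smul, f.map_smul,
        (n4Over δ i).nProd_smul_right, (n4Over δ i).nProd_smul_left, (n4Over δ i).nProd_smul_left]
      congr 1
      refine (AddEquiv.map_finsum f.toAddEquiv _).trans (finsum_congr fun j => ?_)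
      change f (_ • _) = _
      rw [f.map_smul, h]

end Homomorphisms

section Extension

variable {k S : Type*} [Field k] [CharZero k] [CommRing S] [Algebra k S] (δ : Derivation k S S)
  (i : k)

/-- The additive map underlying `derExtend`. -/
def derExtendAux (θ : Module.End S (Gen → S)) : S ⊗[k] N4 k →ₗ[k] S ⊗[k] N4 k :=
  derSum δ i ∘ₗ Finsupp.mapRange.linearMap (θ.restrictScalars k) ∘ₗ (derExpansion δ i).toLinearMap

theorem derExtendAux_der_pow (θ : Module.End S (Gen → S)) (n : ℕ) (w : Gen → S) :
    derExtendAux δ i θ (((n4Over δ i).der ^ n) (comb w))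
      = ((n4Over δ i).der ^ n) (comb (θ w)) := by
  rw [← derSum_single, ← derSum_single, derExtendAux]
  simp [derExpansion_derSum]

theorem derExtendAux_comb (θ : Module.End S (Gen → S)) (w : Gen → S) :
    derExtendAux δ i θ (comb w) = comb (θ w) :=
  derExtendAux_der_pow δ i θ 0 w

theorem derExtendAux_der (θ : Module.End S (Gen → S)) (x : S ⊗[k] N4 k) :
    derExtendAux δ i θ ((n4Over δ i).der x) = (n4Over δ i).der (derExtendAux δ i θ x) := by
  rw [eq_sum_derExpansion δ i x]
  simp only [map_sum]
  refine Finset.sum_congr rfl fun n _ => ?_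
  have h := derExtendAux_der_pow δ i θ (n + 1) (derExpansion δ i x n)
  rwa [pow_succ', Module.End.mul_apply, Module.End.mul_apply, ← derExtendAux_der_pow] at h

/-- The unique `S`-linear map that agrees with `θ` on combinations of the generators and commutes
with the derivation. -/
def derExtend (θ : Module.End S (Gen → S)) : Module.End S (S ⊗[k] N4 k) :=
  { derExtendAux δ i θ with
    map_smul' := fun r x => by
      change derExtendAux δ i θ (r • x) = r • derExtendAux δ i θ x
      induction x using der_induction δ i generalizing r with
      | zero => simp
      | add x y hx hy => rw [smul_add, map_add, map_add, smul_add, hx, hy]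
      | der x hx =>
        have h := (n4Over δ i).der_smul r x
        rw [← sub_eq_iff_eq_add] at h
        rw [← h, map_sub, derExtendAux_der, derExtendAux_der, hx, hx, (n4Over δ i).der_smul,
          add_sub_cancel_right]
      | tmul_gen s u =>
        rw [← comb_single, ← map_smul, derExtendAux_comb, derExtendAux_comb, map_smul, map_smul] }

theorem derExtend_comb (θ : Module.End S (Gen → S)) (w : Gen → S) :
    derExtend δ i θ (comb w) = comb (θ w) :=
  derExtendAux_comb δ i θ w

theorem derExtend_der (θ : Module.End S (Gen → S)) (x : S ⊗[k] N4 k) :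
    derExtend δ i θ ((n4Over δ i).der x) = (n4Over δ i).der (derExtend δ i θ x) :=
  derExtendAux_der δ i θ x

theorem derExpansion_derExtend (θ : Module.End S (Gen → S)) (x : S ⊗[k] N4 k) (n : ℕ) :
    derExpansion δ i (derExtend δ i θ x) n = θ (derExpansion δ i x n) :=
  (DFunLike.congr_fun (derExpansion_derSum δ i _) n).trans rfl

/-- `derExtend` as a homomorphism of monoids. -/
def derExtendHom : Module.End S (Gen → S) →* Module.End S (S ⊗[k] N4 k) where
  toFun := derExtend δ i
  map_one' := by
    refine hom_ext_gen (derExtend_der δ i 1) (fun x => rfl) fun u => ?_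
    rw [← comb_single, derExtend_comb]
    rfl
  map_mul' θ θ' := by
    refine hom_ext_gen (derExtend_der δ i _) (fun x => ?_) fun u => ?_
    · rw [Module.End.mul_apply, derExtend_der, derExtend_der, Module.End.mul_apply]
    · rw [← comb_single, Module.End.mul_apply, derExtend_comb, derExtend_comb, derExtend_comb,
        Module.End.mul_apply]

/-- An action of a group on the combinations of the generators, extended by `derExtend`. -/
def derExtendEquiv {Γ : Type*} [Group Γ] (ρ : Γ →* Module.End S (Gen → S)) :
    Γ →* (S ⊗[k] N4 k ≃ₗ[S] S ⊗[k] N4 k) :=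
  (LinearMap.GeneralLinearGroup.generalLinearEquiv _ _).toMonoidHom.comp
    ((derExtendHom δ i).comp ρ).toHomUnits

theorem derExtendEquiv_apply {Γ : Type*} [Group Γ] (ρ : Γ →* Module.End S (Gen → S)) (g : Γ)
    (x : S ⊗[k] N4 k) : derExtendEquiv δ i ρ g x = derExtend δ i (ρ g) x := rfl

theorem parity_le_of_der_mem {p : ZMod 2} {N : Submodule S (S ⊗[k] N4 k)}
    (hder : ∀ x ∈ N, (n4Over δ i).der x ∈ N)
    (hgen : ∀ u : Gen, u.parity = p → 1 ⊗ₜ gen u ∈ N) : (n4Over δ i).parity p ≤ N := by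
  have hpow (u : Gen) (hu : u.parity = p) (n : ℕ) : 1 ⊗ₜ (n4Der k ^ n) (gen u) ∈ N := by
    induction n with
    | zero => exact hgen u hu
    | succ n ih => simpa [der_tmul, pow_succ'] using hder _ ih
  change (n4Parity k p).baseChange S ≤ N
  rw [Submodule.baseChange_eq_span, Submodule.span_le]
  rintro _ ⟨a, ha, rfl⟩
  change (1 : S) ⊗ₜ[k] a ∈ N
  rw [n4_eq_sum a, TensorProduct.tmul_sum]
  refine N.sum_mem fun u _ => ?_
  by_cases hu : u.parity = p
  · rw [Polynomial.sum_def, TensorProduct.tmul_sum]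
    refine N.sum_mem fun n _ => ?_
    rw [TensorProduct.tmul_smul]
    exact N.smul_of_tower_mem _ (hpow u hu n)
  · rw [ha u hu, Polynomial.sum_zero_index, TensorProduct.tmul_zero]
    exact N.zero_mem

theorem comb_mem_parity {p : ZMod 2} {w : Gen → S} (hw : ∀ u : Gen, u.parity ≠ p → w u = 0) :
    comb w ∈ (n4Over δ i).parity p := by
  rw [comb_apply]
  refine Submodule.sum_mem _ fun u _ => ?_
  by_cases hu : u.parity = p
  · refine Submodule.tmul_mem_baseChange_of_mem _ fun v hv => ?_
    exact Pi.single_eq_of_ne (by rintro rfl; exact hv hu) _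
  · rw [hw u hu, TensorProduct.zero_tmul]
    exact Submodule.zero_mem _

theorem derExtendEquiv_mem_Aut {Γ : Type*} [Group Γ] (ρ : Γ →* Module.End S (Gen → S)) (g : Γ)
    (hp : ∀ u v : Gen, v.parity ≠ u.parity → ρ g (Pi.single u 1) v = 0)
    (hlam : ∀ x y, (∀ u, δ (x u) = 0) → (∀ u, δ (y u) = 0) →
      lamProd i (ρ g x) (ρ g y) = ρ g (lamProd i x y))
    (hder : ∀ x y, (∀ u, δ (x u) = 0) → (∀ u, δ (y u) = 0) →
      derProd i (ρ g x) (ρ g y) = ρ g (derProd i x y))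
    (hconst : ∀ x y, (∀ u, δ (x u) = 0) → (∀ u, δ (y u) = 0) →
      constProd δ i (ρ g x) (ρ g y) = ρ g (constProd δ i x y)) :
    derExtendEquiv δ i ρ g ∈ (n4Over δ i).Aut := by
  refine ⟨fun p x hx => ?_, map_nProd_of_gen (derExtend_der δ i (ρ g)) fun n u v => ?_,
    derExtend_der δ i (ρ g)⟩
  · refine parity_le_of_der_mem δ i (N := ((n4Over δ i).parity p).comap (derExtend δ i (ρ g)))
      (fun x hx => ?_) (fun u hu => ?_) hx
    · rw [Submodule.mem_comap, derExtend_der]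
      exact (n4Over δ i).der_mem p _ hx
    · rw [Submodule.mem_comap, ← comb_single, derExtend_comb]
      exact comb_mem_parity δ i fun v hv => hp u v (hu.symm ▸ hv)
  · have hc (u v : Gen) : δ ((Pi.single u 1 : Gen → S) v) = 0 := by
      rw [Pi.single_apply]
      split_ifs <;> simp
    rw [← comb_single, ← comb_single, derExtendEquiv_apply, derExtendEquiv_apply,
      derExtendEquiv_apply, derExtend_comb, derExtend_comb]
    rcases n with _ | _ | n
    · rw [nProd_comb_zero, nProd_comb_zero, map_add, derExtend_der, derExtend_comb,
        derExtend_comb, hder _ _ (hc u) (hc v), hconst _ _ (hc u) (hc v)]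
    · rw [zero_add, nProd_comb_one, nProd_comb_one, derExtend_comb, hlam _ _ (hc u) (hc v)]
    · rw [nProd_comb_of_two_le δ i (by omega), nProd_comb_of_two_le δ i (by omega), map_zero]

end Extension

section MatrixDerivation

variable {k S m n o : Type*} [Field k] [CommRing S] [Algebra k S]
  (δ : Derivation k S S)

theorem map_derivation_one [DecidableEq n] : (1 : Matrix n n S).map δ = 0 := by
  ext a b
  rw [Matrix.map_apply, Matrix.one_apply]
  split_ifs <;> simp

variable [Fintype n]

theorem map_derivation_mul (M : Matrix m n S) (N : Matrix n o S) :
    (M * N).map δ = M.map δ * N + M * N.map δ := by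
  ext a b
  simp only [Matrix.map_apply, Matrix.add_apply, Matrix.mul_apply, map_sum, Derivation.leibniz,
    smul_eq_mul, ← Finset.sum_add_distrib]
  exact Finset.sum_congr rfl fun _ _ => by ring

theorem derivation_comp_mulVec (M : Matrix m n S) (v : n → S) :
    δ ∘ (M *ᵥ v) = M.map δ *ᵥ v + M *ᵥ (δ ∘ v) := by
  ext1 a
  simp only [Function.comp_apply, Pi.add_apply, Matrix.mulVec, dotProduct, map_sum,
    Derivation.leibniz, smul_eq_mul, ← Finset.sum_add_distrib, Matrix.map_apply]
  exact Finset.sum_congr rfl fun _ _ => by ring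

theorem map_derivation_inv [DecidableEq n] {Y Z : Matrix n n S} (hYZ : Y * Z = 1)
    (hZY : Z * Y = 1) : Z.map δ = -(Z * (Y.map δ * Z)) := by
  have h := congrArg (fun M => Z * M.map δ) hYZ
  simp only [map_derivation_mul, Matrix.mul_add, map_derivation_one, Matrix.mul_zero] at h
  rw [← Matrix.mul_assoc Z Y, hZY, Matrix.one_mul] at h
  rw [eq_neg_iff_add_eq_zero, add_comm, h]

theorem map_derivation_sl2Part [CharZero k] (i : k) {x : Gen → S} (hx : ∀ u, δ (x u) = 0) :
    (sl2Part i x).map δ = 0 := by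
  ext a b
  simp [sl2Part_apply, hx]

end MatrixDerivation

section SpecialLinear

variable {S : Type*} [CommRing S]

theorem coe_mul_coe_inv (Y : SL(2, S)) : Y.1 * (Y⁻¹).1 = 1 := by
  rw [← Matrix.SpecialLinearGroup.coe_mul, mul_inv_cancel, Matrix.SpecialLinearGroup.coe_one]

theorem coe_inv_mul_coe (Y : SL(2, S)) : (Y⁻¹).1 * Y.1 = 1 := by
  simpa using coe_mul_coe_inv Y⁻¹

theorem trace_conj (Y : SL(2, S)) (M : Matrix (Fin 2) (Fin 2) S) :
    (Y.1 * M * (Y⁻¹).1).trace = M.trace := by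
  rw [Matrix.trace_mul_comm, ← mul_assoc, coe_inv_mul_coe, one_mul]

theorem conj_mul_conj (Y : SL(2, S)) (M N : Matrix (Fin 2) (Fin 2) S) :
    Y.1 * M * (Y⁻¹).1 * (Y.1 * N * (Y⁻¹).1) = Y.1 * (M * N) * (Y⁻¹).1 := by
  rw [mul_assoc, ← mul_assoc (Y⁻¹).1, ← mul_assoc (Y⁻¹).1, coe_inv_mul_coe, one_mul]
  simp only [mul_assoc]

theorem vecMulVec_mulVec_inv_transpose (Y : SL(2, S)) (v w : Fin 2 → S) :
    Matrix.vecMulVec (Y.1 *ᵥ w) ((Y⁻¹).1ᵀ *ᵥ v) = Y.1 * Matrix.vecMulVec w v * (Y⁻¹).1 := by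
  rw [Matrix.mul_vecMulVec, Matrix.vecMulVec_mul, Matrix.mulVec_transpose]

theorem inv_transpose_mulVec_dotProduct (Y : SL(2, S)) (v w : Fin 2 → S) :
    ((Y⁻¹).1ᵀ *ᵥ v) ⬝ᵥ (Y.1 *ᵥ w) = v ⬝ᵥ w := by
  rw [Matrix.mulVec_transpose, Matrix.dotProduct_mulVec, Matrix.vecMul_vecMul, coe_inv_mul_coe,
    Matrix.vecMul_one]

theorem mul_add_mul_of_trace_eq_zero {A : Matrix (Fin 2) (Fin 2) S} (hA : A.trace = 0)
    (N : Matrix (Fin 2) (Fin 2) S) : A * N + N * A = N.trace • A + (A * N).trace • 1 := by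
  rw [Matrix.trace_fin_two] at hA
  have h := eq_neg_of_add_eq_zero_right hA
  ext a b
  fin_cases a <;> fin_cases b <;>
    simp [Matrix.trace_fin_two, Matrix.mul_apply, Fin.sum_univ_two, h] <;> ring

end SpecialLinear

section Parallel

variable {k S : Type*} [Field k] [CommRing S] [Algebra k S]

/-- `L ⊗ r + (r A + P) + G(v) + Ḡ(w)` is flat for the connection `δ - A`, where `A` is a matrix
acting on `P` by the adjoint, on `v` by the dual and on `w` by the standard representation. -/
structure IsParallel (δ : Derivation k S S) (A : Matrix (Fin 2) (Fin 2) S) (r : S)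
    (P : Matrix (Fin 2) (Fin 2) S) (v w : Fin 2 → S) : Prop where
  trace : P.trace = 0
  scalar : δ r = 0
  adjoint : P.map δ = A * P - P * A
  dual : δ ∘ v = -(Aᵀ *ᵥ v)
  standard : δ ∘ w = A *ᵥ w

theorem isParallel_zero [CharZero k] (δ : Derivation k S S) (i : k) {x : Gen → S}
    (hx : ∀ u, δ (x u) = 0) :
    IsParallel δ 0 (x .L) (sl2Part i x) (x ∘ Gen.G) (x ∘ Gen.Gbar) where
  trace := trace_sl2Part i x
  scalar := hx _
  adjoint := by rw [map_derivation_sl2Part δ i hx, zero_mul, mul_zero, sub_zero]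
  dual := by
    rw [Matrix.transpose_zero, Matrix.zero_mulVec, neg_zero]
    exact funext fun _ => hx _
  standard := by
    rw [Matrix.zero_mulVec]
    exact funext fun _ => hx _

theorem IsParallel.gauge {δ : Derivation k S S} {r : S} {P : Matrix (Fin 2) (Fin 2) S}
    {v w : Fin 2 → S} (h : IsParallel δ 0 r P v w) (Y : SL(2, S)) :
    IsParallel δ (Y.1.map δ * (Y⁻¹).1) r (Y.1 * P * (Y⁻¹).1) ((Y⁻¹).1ᵀ *ᵥ v) (Y.1 *ᵥ w) := by
  have hA : Y.1.map δ * (Y⁻¹).1 * Y.1 = Y.1.map δ := by rw [mul_assoc, coe_inv_mul_coe, mul_one]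
  have hZ := map_derivation_inv δ (coe_mul_coe_inv Y) (coe_inv_mul_coe Y)
  constructor
  · rw [trace_conj, h.trace]
  · exact h.scalar
  · rw [map_derivation_mul, map_derivation_mul, h.adjoint, hZ, ← mul_assoc (_ * _) (Y.1 * P),
      ← mul_assoc _ Y.1 P, hA]
    noncomm_ring
  · rw [derivation_comp_mulVec, h.dual, Matrix.transpose_map, hZ, Matrix.mulVec_mulVec,
      ← Matrix.transpose_mul]
    simp [Matrix.neg_mulVec]
  · rw [derivation_comp_mulVec, h.standard, Matrix.mulVec_mulVec, Matrix.mulVec_mulVec, hA]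
    simp

theorem constProd_of_isParallel [CharZero k] {δ : Derivation k S S} {i : k} (hi : i * i = -1)
    {A P Q : Matrix (Fin 2) (Fin 2) S} (hA : A.trace = 0) {r s : S} {v w v' w' : Fin 2 → S}
    (h : IsParallel δ A r P v w) (h' : IsParallel δ A s Q v' w') :
    constProd δ i (coords i r (r • A + P) v w) (coords i s (s • A + Q) v' w')
      = coords i (2 * (v ⬝ᵥ w') + 2 * (w ⬝ᵥ v'))
        ((2 * (v ⬝ᵥ w') + 2 * (w ⬝ᵥ v')) • A + (P * Q - Q * P))
        (Qᵀ *ᵥ v - Pᵀ *ᵥ v') (P *ᵥ w' - Q *ᵥ w) := by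
  have trace_eq {r P v w} (h : IsParallel δ A r P v w) : (r • A + P).trace = 0 := by
    rw [Matrix.trace_add, Matrix.trace_smul, hA, h.trace, smul_zero, add_zero]
  have map_eq {r P v w} (h : IsParallel δ A r P v w) :
      (r • A + P).map δ = r • A.map δ + (A * P - P * A) := by
    rw [← h.adjoint]
    ext a b
    simp [h.scalar]
  have vec_eq {r P v w s Q v' w'} (h : IsParallel δ A r P v w) (h' : IsParallel δ A s Q v' w') :
      Matrix.vecMulVec (δ ∘ w') v - Matrix.vecMulVec w' (δ ∘ v)
        = (v ⬝ᵥ w') • A + (A * Matrix.vecMulVec w' v).trace • 1 := by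
    rw [h'.standard, h.dual, Matrix.vecMulVec_neg, sub_neg_eq_add, ← Matrix.mul_vecMulVec,
      Matrix.mulVec_transpose, ← Matrix.vecMulVec_mul, mul_add_mul_of_trace_eq_zero hA,
      Matrix.trace_vecMulVec, dotProduct_comm]
  rw [constProd_coords hi δ _ _ (trace_eq h) (trace_eq h'), map_eq h, map_eq h', vec_eq h h',
    vec_eq h' h, h.scalar, h'.scalar, h.dual, h'.dual, h.standard, h'.standard]
  rw [← coords_add_scalar i _ (2 * (A * Matrix.vecMulVec w' v).trace
    + 2 * (A * Matrix.vecMulVec w v').trace) (_ • A + _)]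
  congr 1
  · rw [zero_mul, mul_zero, sub_zero, zero_add]
  · rw [dotProduct_comm v']
    simp only [mul_add, add_mul, mul_smul_comm, smul_mul_assoc]
    module
  · simp only [zero_smul, sub_zero, smul_zero, zero_add, Matrix.transpose_add,
      Matrix.transpose_smul, Matrix.add_mulVec, Matrix.smul_mulVec]
    module
  · simp only [zero_smul, sub_zero, smul_zero, zero_add, Matrix.add_mulVec, Matrix.smul_mulVec]
    module

end Parallel

section Gauge

variable {k S : Type*} [Field k] [CommRing S] [Algebra k S] (δ : Derivation k S S) (i : k)

theorem derivation_det_fin_two {A N : Matrix (Fin 2) (Fin 2) S} (h : A.map δ = N * A) :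
    δ A.det = N.trace * A.det := by
  have hA (a b : Fin 2) : δ (A a b) = N a 0 * A 0 b + N a 1 * A 1 b := by
    simpa [Matrix.mul_apply] using congrFun (congrFun h a) b
  simp only [Matrix.det_fin_two, map_sub, Derivation.leibniz, hA, smul_eq_mul,
    Matrix.trace_fin_two]
  ring

theorem trace_map_derivation_mul_inv (Y : SL(2, S)) : (Y.1.map δ * (Y⁻¹).1).trace = 0 := by
  have h : Y.1.map δ = Y.1.map δ * (Y⁻¹).1 * Y.1 := by
    rw [mul_assoc, coe_inv_mul_coe, mul_one]
  simpa [Y.2] using (derivation_det_fin_two δ h).symm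

/-- The action of `Y ∈ SL₂(S)` on combinations of the generators: `L ↦ L + Y' Y⁻¹` and
`M ↦ Y M Y⁻¹`, with the `G`s in the dual and the `Ḡ`s in the standard representation. -/
def gaugeEnd (Y : SL(2, S)) : Module.End S (Gen → S) where
  toFun x := coords i (x .L) (x .L • (Y.1.map δ * (Y⁻¹).1) + Y.1 * sl2Part i x * (Y⁻¹).1)
    ((Y⁻¹).1ᵀ *ᵥ (x ∘ Gen.G)) (Y.1 *ᵥ (x ∘ Gen.Gbar))
  map_add' x y := by
    rw [coords_add]
    congr 1
    · rw [sl2Part_add, Pi.add_apply, add_smul, mul_add, add_mul]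
      abel
    · exact Matrix.mulVec_add _ _ _
    · exact Matrix.mulVec_add _ _ _
  map_smul' c x := by
    rw [RingHom.id_apply, smul_coords]
    congr 1
    · rw [sl2Part_smul, Pi.smul_apply, smul_eq_mul, mul_smul, mul_smul_comm, smul_mul_assoc,
        smul_add]
    · exact Matrix.mulVec_smul _ _ _
    · exact Matrix.mulVec_smul _ _ _

theorem coords_eq_zero_of_parity_ne {u v : Gen} (h : v.parity ≠ u.parity) {r : S}
    {M : Matrix (Fin 2) (Fin 2) S} {p q : Fin 2 → S}
    (heven : (Pi.single u 1 : Gen → S) ∘ Gen.G = 0 → (Pi.single u 1 : Gen → S) ∘ Gen.Gbar = 0 →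
      p = 0 ∧ q = 0)
    (hodd : (Pi.single u 1 : Gen → S) .L = 0 → sl2Part i (Pi.single u 1 : Gen → S) = 0 →
      r = 0 ∧ M = 0) : coords i r M p q v = 0 := by
  have single_comp {f : Fin 2 → Gen} (hf : ∀ a, f a ≠ u) : (Pi.single u 1 : Gen → S) ∘ f = 0 :=
    funext fun a => Pi.single_eq_of_ne (hf a) _
  rcases u with _ | s | a | a
  case L | J =>
    obtain ⟨rfl, rfl⟩ := heven (single_comp (by simp)) (single_comp (by simp))
    cases v <;> first | rfl | exact absurd rfl h
  all_goals
    obtain ⟨rfl, rfl⟩ := hodd (Pi.single_eq_of_ne (by simp) _)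
      (sl2Part_eq_zero i fun s => Pi.single_eq_of_ne (by simp) _)
    cases v <;> first | exact absurd rfl h | simp [coords]

theorem gaugeEnd_single (Y : SL(2, S)) {u v : Gen} (h : v.parity ≠ u.parity) :
    gaugeEnd δ i Y (Pi.single u 1) v = 0 := by
  refine coords_eq_zero_of_parity_ne i h (fun hG hGbar => ?_) fun hL hJ => ⟨hL, ?_⟩
  · rw [hG, hGbar, Matrix.mulVec_zero, Matrix.mulVec_zero]
    exact ⟨rfl, rfl⟩
  · rw [hL, hJ, zero_smul, mul_zero, zero_mul, add_zero]

variable [CharZero k] {i}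

theorem gaugeEnd_coords (hi : i * i = -1) (Y : SL(2, S)) (r : S) (M : Matrix (Fin 2) (Fin 2) S)
    (v w : Fin 2 → S) : gaugeEnd δ i Y (coords i r M v w)
      = coords i r (r • (Y.1.map δ * (Y⁻¹).1) + Y.1 * M * (Y⁻¹).1) ((Y⁻¹).1ᵀ *ᵥ v) (Y.1 *ᵥ w) := by
  obtain ⟨c, hc⟩ := exists_sl2Part_coords hi r M v w
  change coords i r (r • (Y.1.map δ * (Y⁻¹).1) + Y.1 * sl2Part i (coords i r M v w) * (Y⁻¹).1)
    ((Y⁻¹).1ᵀ *ᵥ v) (Y.1 *ᵥ w) = _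
  rw [hc, mul_add, add_mul, ← add_assoc, mul_smul_comm, mul_one, smul_mul_assoc, coe_mul_coe_inv,
    coords_add_scalar]

theorem gaugeEnd_one (hi : i * i = -1) : gaugeEnd δ i (1 : SL(2, S)) = 1 := by
  refine LinearMap.ext fun x => ?_
  rw [← coords_parts hi x, gaugeEnd_coords δ hi, Matrix.SpecialLinearGroup.coe_one,
    map_derivation_one]
  simp

theorem gaugeEnd_mul (hi : i * i = -1) (Y Z : SL(2, S)) :
    gaugeEnd δ i (Y * Z) = gaugeEnd δ i Y * gaugeEnd δ i Z := by
  refine LinearMap.ext fun x => ?_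
  have log_deriv : (Y * Z).1.map δ * ((Y * Z)⁻¹).1
      = Y.1.map δ * (Y⁻¹).1 + Y.1 * (Z.1.map δ * (Z⁻¹).1) * (Y⁻¹).1 := by
    rw [mul_inv_rev, Matrix.SpecialLinearGroup.coe_mul, Matrix.SpecialLinearGroup.coe_mul,
      map_derivation_mul, add_mul, mul_assoc (Y.1.map _), ← mul_assoc Z.1, coe_mul_coe_inv,
      one_mul]
    simp only [mul_assoc]
  rw [Module.End.mul_apply, ← coords_parts hi x, gaugeEnd_coords δ hi, gaugeEnd_coords δ hi,
    gaugeEnd_coords δ hi, log_deriv]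
  rw [mul_inv_rev, Matrix.SpecialLinearGroup.coe_mul, Matrix.SpecialLinearGroup.coe_mul]
  congr 1
  · simp only [smul_add, mul_add, add_mul, mul_smul_comm, smul_mul_assoc, mul_assoc, add_assoc]
  · rw [Matrix.transpose_mul, Matrix.mulVec_mulVec]
  · rw [Matrix.mulVec_mulVec]

theorem lamProd_gaugeEnd (hi : i * i = -1) (Y : SL(2, S)) (x y : Gen → S) :
    lamProd i (gaugeEnd δ i Y x) (gaugeEnd δ i Y y) = gaugeEnd δ i Y (lamProd i x y) := by
  rw [← coords_parts hi x, ← coords_parts hi y]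
  simp only [gaugeEnd_coords δ hi, lamProd_coords]
  congr 1
  · rw [vecMulVec_mulVec_inv_transpose, vecMulVec_mulVec_inv_transpose]
    simp only [mul_add, add_mul, mul_sub, sub_mul, mul_smul_comm, smul_mul_assoc]
    module
  · simp only [Matrix.mulVec_smul, Matrix.mulVec_add]
  · simp only [Matrix.mulVec_smul, Matrix.mulVec_add]

theorem derProd_gaugeEnd (hi : i * i = -1) (Y : SL(2, S)) (x y : Gen → S) :
    derProd i (gaugeEnd δ i Y x) (gaugeEnd δ i Y y) = gaugeEnd δ i Y (derProd i x y) := by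
  rw [← coords_parts hi x, ← coords_parts hi y]
  simp only [gaugeEnd_coords δ hi, derProd_coords]
  congr 1
  · rw [vecMulVec_mulVec_inv_transpose, vecMulVec_mulVec_inv_transpose]
    simp only [mul_add, add_mul, mul_sub, sub_mul, mul_smul_comm, smul_mul_assoc]
    module
  · simp only [Matrix.mulVec_smul, Matrix.mulVec_add]
  · simp only [Matrix.mulVec_smul, Matrix.mulVec_add]

variable {δ}

theorem constProd_of_derivation_eq_zero (hi : i * i = -1) {x y : Gen → S}
    (hx : ∀ u, δ (x u) = 0) (hy : ∀ u, δ (y u) = 0) :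
    constProd δ i x y
      = coords i (2 * ((x ∘ Gen.G) ⬝ᵥ (y ∘ Gen.Gbar)) + 2 * ((x ∘ Gen.Gbar) ⬝ᵥ (y ∘ Gen.G)))
        (sl2Part i x * sl2Part i y - sl2Part i y * sl2Part i x)
        ((sl2Part i y)ᵀ *ᵥ (x ∘ Gen.G) - (sl2Part i x)ᵀ *ᵥ (y ∘ Gen.G))
        (sl2Part i x *ᵥ (y ∘ Gen.Gbar) - sl2Part i y *ᵥ (x ∘ Gen.Gbar)) := by
  have h := constProd_of_isParallel hi (Matrix.trace_zero _ S) (isParallel_zero δ i hx)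
    (isParallel_zero δ i hy)
  simpa only [smul_zero, zero_add, coords_parts hi] using h

theorem constProd_gaugeEnd (hi : i * i = -1) (Y : SL(2, S)) {x y : Gen → S}
    (hx : ∀ u, δ (x u) = 0) (hy : ∀ u, δ (y u) = 0) :
    constProd δ i (gaugeEnd δ i Y x) (gaugeEnd δ i Y y) = gaugeEnd δ i Y (constProd δ i x y) := by
  have conj_transpose (P : Matrix (Fin 2) (Fin 2) S) (v : Fin 2 → S) :
      (Y.1 * P * (Y⁻¹).1)ᵀ *ᵥ ((Y⁻¹).1ᵀ *ᵥ v) = (Y⁻¹).1ᵀ *ᵥ (Pᵀ *ᵥ v) := by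
    rw [Matrix.mulVec_mulVec, Matrix.mulVec_mulVec, ← Matrix.transpose_mul,
      ← Matrix.transpose_mul, ← mul_assoc, ← mul_assoc, coe_inv_mul_coe, one_mul]
  have conj (P : Matrix (Fin 2) (Fin 2) S) (w : Fin 2 → S) :
      (Y.1 * P * (Y⁻¹).1) *ᵥ (Y.1 *ᵥ w) = Y.1 *ᵥ (P *ᵥ w) := by
    rw [Matrix.mulVec_mulVec, Matrix.mulVec_mulVec, mul_assoc, coe_inv_mul_coe, mul_one]
  rw [constProd_of_derivation_eq_zero hi hx hy, gaugeEnd_coords δ hi]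
  refine (constProd_of_isParallel hi (trace_map_derivation_mul_inv δ Y)
    ((isParallel_zero δ i hx).gauge Y) ((isParallel_zero δ i hy).gauge Y)).trans ?_
  rw [inv_transpose_mulVec_dotProduct, dotProduct_comm (Y.1 *ᵥ _),
    inv_transpose_mulVec_dotProduct, conj, conj, conj_transpose, conj_transpose, conj_mul_conj,
    conj_mul_conj, ← Matrix.mulVec_sub, ← Matrix.mulVec_sub, mul_sub, sub_mul,
    dotProduct_comm (x ∘ Gen.Gbar)]

/-- `gaugeEnd` as an action of `SL₂(S)`. -/
def gaugeHom (δ : Derivation k S S) (hi : i * i = -1) : SL(2, S) →* Module.End S (Gen → S) where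
  toFun := gaugeEnd δ i
  map_one' := gaugeEnd_one δ hi
  map_mul' := gaugeEnd_mul δ hi

theorem gauge_mem_Aut (hi : i * i = -1) (Y : SL(2, S)) :
    derExtendEquiv δ i (gaugeHom δ hi) Y ∈ (n4Over δ i).Aut :=
  derExtendEquiv_mem_Aut δ i (gaugeHom δ hi) Y (fun _ _ h => gaugeEnd_single δ i Y h)
    (fun x y _ _ => lamProd_gaugeEnd δ hi Y x y) (fun x y _ _ => derProd_gaugeEnd δ hi Y x y)
    (fun _ _ hx hy => constProd_gaugeEnd hi Y hx hy)

end Gauge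

section Rotation

variable {k S : Type*} [Field k] [CommRing S] [Algebra k S]

/-- The matrix `ε` of the standard symplectic form. It intertwines the standard representation
of `SL₂(S)` with its dual. -/
def eps (S : Type*) [CommRing S] : Matrix (Fin 2) (Fin 2) S := !![0, 1; -1, 0]

theorem eps_mulVec (v : Fin 2 → S) : eps S *ᵥ v = ![v 1, -v 0] := by
  ext a
  fin_cases a <;> simp [eps, Matrix.mulVec, dotProduct]

theorem mul_eps (Y : SL(2, S)) : Y.1 * eps S = eps S * (Y⁻¹).1ᵀ := by
  rw [Matrix.SpecialLinearGroup.coe_inv, Matrix.adjugate_fin_two]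
  ext a b
  fin_cases a <;> fin_cases b <;> simp [eps, Matrix.mul_apply]

theorem inv_transpose_mul_eps (Y : SL(2, S)) : (Y⁻¹).1ᵀ * eps S = eps S * Y.1 := by
  rw [Matrix.SpecialLinearGroup.coe_inv, Matrix.adjugate_fin_two]
  ext a b
  fin_cases a <;> fin_cases b <;> simp [eps, Matrix.mul_apply]

theorem transpose_mul_eps {P : Matrix (Fin 2) (Fin 2) S} (hP : P.trace = 0) :
    Pᵀ * eps S = -(eps S * P) := by
  have h := eq_neg_of_add_eq_zero_right (P.trace_fin_two ▸ hP)
  ext a b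
  fin_cases a <;> fin_cases b <;>
    simp [eps, Matrix.mul_apply, Matrix.vecMul, dotProduct, Fin.sum_univ_two, h]

/-- The `G`-component of the image of `G(v) + Ḡ(w)` under `X ∈ SL₂(k)`. -/
def rotG (X : SL(2, k)) (v w : Fin 2 → S) : Fin 2 → S := X.1 0 0 • v - X.1 0 1 • (eps S *ᵥ w)

/-- The `Ḡ`-component of the image of `G(v) + Ḡ(w)` under `X ∈ SL₂(k)`. -/
def rotGbar (X : SL(2, k)) (v w : Fin 2 → S) : Fin 2 → S := X.1 1 0 • (eps S *ᵥ v) + X.1 1 1 • w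

theorem algebraMap_det (X : SL(2, k)) :
    algebraMap k S (X.1 0 0) * algebraMap k S (X.1 1 1)
      - algebraMap k S (X.1 0 1) * algebraMap k S (X.1 1 0) = 1 := by
  rw [← map_mul, ← map_mul, ← map_sub, ← Matrix.det_fin_two, X.2, map_one]

theorem exists_vecMulVec_rot (X : SL(2, k)) (v w v' w' : Fin 2 → S) :
    ∃ c : S, Matrix.vecMulVec (rotGbar X v w) (rotG X v' w')
        - Matrix.vecMulVec (rotGbar X v' w') (rotG X v w)
      = Matrix.vecMulVec w v' - Matrix.vecMulVec w' v + c • 1 := by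
  have h := algebraMap_det (S := S) X
  refine ⟨algebraMap k S (X.1 1 0 * X.1 0 0) * (v 1 * v' 0 - v 0 * v' 1)
    - algebraMap k S (X.1 1 0 * X.1 0 1) * (v ⬝ᵥ w' - v' ⬝ᵥ w)
    - algebraMap k S (X.1 1 1 * X.1 0 1) * (w 0 * w' 1 - w 1 * w' 0), ?_⟩
  simp only [rotG, rotGbar, eps_mulVec]
  ext a b
  fin_cases a <;> fin_cases b <;>
    simp [Matrix.vecMulVec_apply, smul_eq_algebraMap_mul, dotProduct]
  · linear_combination (w 0 * v' 0 - w' 0 * v 0) * h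
  · linear_combination (w 0 * v' 1 - w' 0 * v 1) * h
  · linear_combination (w 1 * v' 0 - w' 1 * v 0) * h
  · linear_combination (w 1 * v' 1 - w' 1 * v 1) * h

theorem dotProduct_rot (X : SL(2, k)) (v w v' w' : Fin 2 → S) :
    rotG X v w ⬝ᵥ rotGbar X v' w' + rotGbar X v w ⬝ᵥ rotG X v' w' = v ⬝ᵥ w' + w ⬝ᵥ v' := by
  simp only [rotG, rotGbar, eps_mulVec, dotProduct, Fin.sum_univ_two, Pi.add_apply, Pi.sub_apply,
    Pi.smul_apply, Matrix.cons_val_zero, Matrix.cons_val_one]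
  simp only [smul_eq_algebraMap_mul]
  linear_combination (v 0 * w' 0 + v 1 * w' 1 + w 0 * v' 0 + w 1 * v' 1) * algebraMap_det (S := S) X

/-- The action of `X ∈ SL₂(k)` on combinations of the generators, which fixes `L` and the `J`s. -/
def rotEnd (i : k) (X : SL(2, k)) : Module.End S (Gen → S) where
  toFun x := coords i (x .L) (sl2Part i x) (rotG X (x ∘ Gen.G) (x ∘ Gen.Gbar))
    (rotGbar X (x ∘ Gen.G) (x ∘ Gen.Gbar))
  map_add' x y := by
    rw [coords_add, ← sl2Part_add]
    congr 1
    · simp only [rotG, Matrix.mulVec_add, Pi.add_comp]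
      module
    · simp only [rotGbar, Matrix.mulVec_add, Pi.add_comp]
      module
  map_smul' c x := by
    rw [RingHom.id_apply, smul_coords, ← sl2Part_smul]
    congr 1
    · simp only [rotG, Matrix.mulVec_smul, Pi.smul_comp, smul_sub, smul_comm c]
    · simp only [rotGbar, Matrix.mulVec_smul, Pi.smul_comp, smul_add, smul_comm c]

theorem rotEnd_single (i : k) (X : SL(2, k)) {u v : Gen} (h : v.parity ≠ u.parity) :
    rotEnd i X (Pi.single u (1 : S)) v = 0 := by
  refine coords_eq_zero_of_parity_ne i h (fun hG hGbar => ?_) fun hL hJ => ⟨hL, hJ⟩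
  rw [hG, hGbar, rotG, rotGbar, Matrix.mulVec_zero]
  simp

theorem mulVec_rotGbar {P : Matrix (Fin 2) (Fin 2) S} (hP : P.trace = 0) (X : SL(2, k))
    (v w : Fin 2 → S) : P *ᵥ rotGbar X v w = rotGbar X (-(Pᵀ *ᵥ v)) (P *ᵥ w) := by
  have h : P * eps S = -(eps S * Pᵀ) := by
    simpa using transpose_mul_eps ((Matrix.trace_transpose P).trans hP)
  rw [rotGbar, rotGbar, Matrix.mulVec_add, Matrix.mulVec_smul, Matrix.mulVec_smul,
    Matrix.mulVec_mulVec, h, Matrix.mulVec_neg, Matrix.neg_mulVec, Matrix.mulVec_mulVec]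

theorem transpose_mulVec_rotG {P : Matrix (Fin 2) (Fin 2) S} (hP : P.trace = 0) (X : SL(2, k))
    (v w : Fin 2 → S) : Pᵀ *ᵥ rotG X v w = rotG X (Pᵀ *ᵥ v) (-(P *ᵥ w)) := by
  rw [rotG, rotG, Matrix.mulVec_sub, Matrix.mulVec_smul, Matrix.mulVec_smul, Matrix.mulVec_mulVec,
    transpose_mul_eps hP, Matrix.neg_mulVec, Matrix.mulVec_neg, Matrix.mulVec_mulVec]

theorem derivation_eps_mulVec (δ : Derivation k S S) (v : Fin 2 → S) (a : Fin 2) :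
    δ ((eps S *ᵥ v) a) = (eps S *ᵥ (δ ∘ v)) a := by
  rw [eps_mulVec, eps_mulVec]
  fin_cases a <;> simp

theorem derivation_comp_rotG (δ : Derivation k S S) (X : SL(2, k)) (v w : Fin 2 → S) :
    δ ∘ rotG X v w = rotG X (δ ∘ v) (δ ∘ w) := by
  ext1 a
  simp only [rotG, Function.comp_apply, Pi.sub_apply, Pi.smul_apply, map_sub, Derivation.map_smul,
    derivation_eps_mulVec]

theorem derivation_comp_rotGbar (δ : Derivation k S S) (X : SL(2, k)) (v w : Fin 2 → S) :
    δ ∘ rotGbar X v w = rotGbar X (δ ∘ v) (δ ∘ w) := by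
  ext1 a
  simp only [rotGbar, Function.comp_apply, Pi.add_apply, Pi.smul_apply, map_add,
    Derivation.map_smul, derivation_eps_mulVec]

theorem IsParallel.rot {δ : Derivation k S S} {A P : Matrix (Fin 2) (Fin 2) S} {r : S}
    {v w : Fin 2 → S} (h : IsParallel δ A r P v w) (hA : A.trace = 0) (X : SL(2, k)) :
    IsParallel δ A r P (rotG X v w) (rotGbar X v w) where
  trace := h.trace
  scalar := h.scalar
  adjoint := h.adjoint
  dual := by
    rw [derivation_comp_rotG, h.dual, h.standard, transpose_mulVec_rotG hA]
    simp only [rotG, Matrix.mulVec_neg]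
    module
  standard := by rw [derivation_comp_rotGbar, h.dual, h.standard, mulVec_rotGbar hA]

variable [CharZero k] {i : k}

theorem rotEnd_coords (hi : i * i = -1) (X : SL(2, k)) (r : S) (M : Matrix (Fin 2) (Fin 2) S)
    (v w : Fin 2 → S) :
    rotEnd i X (coords i r M v w) = coords i r M (rotG X v w) (rotGbar X v w) := by
  obtain ⟨c, hc⟩ := exists_sl2Part_coords hi r M v w
  change coords i r (sl2Part i (coords i r M v w)) (rotG X v w) (rotGbar X v w) = _
  rw [hc, coords_add_scalar]

theorem rotEnd_one (hi : i * i = -1) : rotEnd i (1 : SL(2, k)) = (1 : Module.End S _) := by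
  refine LinearMap.ext fun x => ?_
  rw [← coords_parts hi x, rotEnd_coords hi]
  simp [rotG, rotGbar]

theorem rotEnd_mul (hi : i * i = -1) (X Z : SL(2, k)) :
    rotEnd i (X * Z) = rotEnd i X * (rotEnd i Z : Module.End S _) := by
  refine LinearMap.ext fun x => ?_
  rw [Module.End.mul_apply, ← coords_parts hi x, rotEnd_coords hi, rotEnd_coords hi,
    rotEnd_coords hi]
  simp only [rotG, rotGbar, eps_mulVec]
  congr 1 <;> ext a <;> fin_cases a <;>
    simp [Matrix.mul_apply, Fin.sum_univ_two, smul_eq_algebraMap_mul] <;> ring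

theorem lamProd_rotEnd (hi : i * i = -1) (X : SL(2, k)) (x y : Gen → S) :
    lamProd i (rotEnd i X x) (rotEnd i X y) = rotEnd i X (lamProd i x y) := by
  rw [← coords_parts hi x, ← coords_parts hi y]
  simp only [rotEnd_coords hi, lamProd_coords]
  obtain ⟨c, hc⟩ := exists_vecMulVec_rot X (x ∘ Gen.G) (x ∘ Gen.Gbar) (y ∘ Gen.G) (y ∘ Gen.Gbar)
  rw [hc, smul_add, ← add_assoc, ← mul_smul, coords_add_scalar]
  congr 1 <;> simp only [rotG, rotGbar, Matrix.mulVec_smul, Matrix.mulVec_add] <;> module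

theorem derProd_rotEnd (hi : i * i = -1) (X : SL(2, k)) (x y : Gen → S) :
    derProd i (rotEnd i X x) (rotEnd i X y) = rotEnd i X (derProd i x y) := by
  rw [← coords_parts hi x, ← coords_parts hi y]
  simp only [rotEnd_coords hi, derProd_coords]
  obtain ⟨c, hc⟩ := exists_vecMulVec_rot X (x ∘ Gen.G) (x ∘ Gen.Gbar) (y ∘ Gen.G) (y ∘ Gen.Gbar)
  rw [hc, smul_add, ← add_assoc, ← mul_smul, coords_add_scalar]
  congr 1 <;> simp only [rotG, rotGbar, Matrix.mulVec_smul, Matrix.mulVec_add] <;> module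

theorem constProd_rotEnd (hi : i * i = -1) (X : SL(2, k)) {δ : Derivation k S S} {x y : Gen → S}
    (hx : ∀ u, δ (x u) = 0) (hy : ∀ u, δ (y u) = 0) :
    constProd δ i (rotEnd i X x) (rotEnd i X y) = rotEnd i X (constProd δ i x y) := by
  have hA := Matrix.trace_zero (Fin 2) S
  have hP := trace_sl2Part (S := S) i
  have h := constProd_of_isParallel hi hA ((isParallel_zero δ i hx).rot hA X)
    ((isParallel_zero δ i hy).rot hA X)
  rw [constProd_of_derivation_eq_zero hi hx hy, rotEnd_coords hi]
  simp only [smul_zero, zero_add] at h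
  refine h.trans ?_
  congr 1
  · rw [← mul_add, dotProduct_rot, mul_add]
  · rw [transpose_mulVec_rotG (hP y), transpose_mulVec_rotG (hP x)]
    simp only [rotG, Matrix.mulVec_sub, Matrix.mulVec_neg]
    module
  · rw [mulVec_rotGbar (hP x), mulVec_rotGbar (hP y)]
    simp only [rotGbar, Matrix.mulVec_sub, Matrix.mulVec_neg]
    module

/-- `rotEnd` as an action of `SL₂(k)`. -/
def rotHom (S : Type*) [CommRing S] [Algebra k S] (hi : i * i = -1) :
    SL(2, k) →* Module.End S (Gen → S) where
  toFun := rotEnd i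
  map_one' := rotEnd_one hi
  map_mul' := rotEnd_mul hi

theorem rot_mem_Aut (δ : Derivation k S S) (hi : i * i = -1) (X : SL(2, k)) :
    derExtendEquiv δ i (rotHom S hi) X ∈ (n4Over δ i).Aut :=
  derExtendEquiv_mem_Aut δ i (rotHom S hi) X (fun _ _ h => rotEnd_single i X h)
    (fun x y _ _ => lamProd_rotEnd hi X x y) (fun x y _ _ => derProd_rotEnd hi X x y)
    (fun _ _ hx hy => constProd_rotEnd hi X hx hy)

theorem gaugeEnd_commute_rotEnd (δ : Derivation k S S) (hi : i * i = -1) (Y : SL(2, S))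
    (X : SL(2, k)) : Commute (gaugeEnd δ i Y) (rotEnd i X) := by
  refine LinearMap.ext fun x => ?_
  rw [Module.End.mul_apply, Module.End.mul_apply, ← coords_parts hi x, rotEnd_coords hi,
    gaugeEnd_coords δ hi, gaugeEnd_coords δ hi, rotEnd_coords hi]
  congr 1
  · simp only [rotG, Matrix.mulVec_sub, Matrix.mulVec_smul, Matrix.mulVec_mulVec,
      inv_transpose_mul_eps]
  · simp only [rotGbar, Matrix.mulVec_add, Matrix.mulVec_smul, Matrix.mulVec_mulVec, mul_eps]

/-- The homomorphism `(Y, X) ↦ Φ(Y, X)` before passing to the quotient. -/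
def autHom (δ : Derivation k S S) (hi : i * i = -1) : SL(2, S) × SL(2, k) →* (n4Over δ i).Aut :=
  MonoidHom.noncommCoprod
    ((derExtendEquiv δ i (gaugeHom δ hi)).codRestrict _ (gauge_mem_Aut hi))
    ((derExtendEquiv δ i (rotHom S hi)).codRestrict _ (rot_mem_Aut δ hi)) fun Y X => by
      refine Subtype.ext (LinearEquiv.ext fun x => ?_)
      have h := congrArg (derExtendHom δ i) (gaugeEnd_commute_rotEnd δ hi Y X).eq
      rw [map_mul, map_mul] at h
      exact LinearMap.congr_fun h x

theorem autHom_comb_coords (δ : Derivation k S S) (hi : i * i = -1) (Y : SL(2, S)) (X : SL(2, k))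
    (r : S) (M : Matrix (Fin 2) (Fin 2) S) (v w : Fin 2 → S) :
    (autHom δ hi (Y, X)).1 (comb (coords i r M v w))
      = comb (coords i r (r • (Y.1.map δ * (Y⁻¹).1) + Y.1 * M * (Y⁻¹).1)
        ((Y⁻¹).1ᵀ *ᵥ rotG X v w) (Y.1 *ᵥ rotGbar X v w)) := by
  change derExtend δ i (gaugeEnd δ i Y) (derExtend δ i (rotEnd i X) (comb _)) = _
  rw [derExtend_comb, derExtend_comb, rotEnd_coords hi, gaugeEnd_coords δ hi]

end Rotation

section AntidiagonalSums

open Finset.HasAntidiagonal (antidiagonal mem_antidiagonal)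

variable {B : Type*} [AddCommMonoid B]

theorem sum_support_eq_sum_antidiagonal {V : Type*} [Zero V] (f g : ℕ →₀ V) (N : ℕ)
    (F : ℕ → V → V → B) (hl : ∀ p y, F p 0 y = 0) (hr : ∀ p x, F p x 0 = 0) :
    (∑ p ∈ f.support, ∑ q ∈ g.support, if p + q = N then F p (f p) (g q) else 0)
      = ∑ z ∈ antidiagonal N, F z.1 (f z.1) (g z.2) := by
  rw [← Finset.sum_product', ← Finset.sum_filter]
  refine Finset.sum_subset
    (fun z hz => mem_antidiagonal.2 (Finset.mem_filter.1 hz).2) fun z hz hz' => ?_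
  by_cases hp : z.1 ∈ f.support
  · by_cases hq : z.2 ∈ g.support
    · exact absurd (Finset.mem_filter.2
        ⟨Finset.mem_product.2 ⟨hp, hq⟩, (mem_antidiagonal (a := z)).1 hz⟩) hz'
    · rw [Finsupp.notMem_support_iff.1 hq, hr]
  · rw [Finsupp.notMem_support_iff.1 hp, hl]

theorem sum_antidiagonal_eq_left {n : ℕ} {F : ℕ × ℕ → B} (h : ∀ p q, F (p, q + 1) = 0) :
    ∑ z ∈ antidiagonal n, F z = F (n, 0) := by
  rcases n with _ | n
  · simp
  · simp [Finset.Nat.sum_antidiagonal_succ', h]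

theorem sum_antidiagonal_eq_right {n : ℕ} {F : ℕ × ℕ → B} (h : ∀ p q, F (p + 1, q) = 0) :
    ∑ z ∈ antidiagonal n, F z = F (0, n) := by
  rcases n with _ | n
  · simp
  · simp [Finset.Nat.sum_antidiagonal_succ, h]

theorem sum_antidiagonal_eq_zero_of_lt {P n : ℕ} (hn : P + P < n) {F : ℕ × ℕ → B}
    (hl : ∀ p q, P < p → F (p, q) = 0) (hr : ∀ p q, P < q → F (p, q) = 0) :
    ∑ z ∈ antidiagonal n, F z = 0 := by
  refine Finset.sum_eq_zero fun z hz => ?_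
  have hz := mem_antidiagonal.1 hz
  rcases le_or_gt z.1 P with h | h
  · exact hr _ _ (by omega)
  · exact hl _ _ h

theorem sum_antidiagonal_eq_middle {P : ℕ} {F : ℕ × ℕ → B}
    (hl : ∀ p q, P < p → F (p, q) = 0) (hr : ∀ p q, P < q → F (p, q) = 0) :
    ∑ z ∈ antidiagonal (P + P), F z = F (P, P) := by
  refine Finset.sum_eq_single (P, P) (fun z hz hne => ?_) fun h =>
    absurd (mem_antidiagonal (a := (P, P)).2 rfl) h
  have hz := mem_antidiagonal.1 hz
  rcases lt_trichotomy z.1 P with h | h | h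
  · exact hr _ _ (by omega)
  · exact absurd (Prod.ext h (by dsimp only; omega)) hne
  · exact hl _ _ h

end AntidiagonalSums

section ProductCoefficients

open Finset.HasAntidiagonal (antidiagonal)

variable {k S : Type*} [Field k] [CommRing S] [Algebra k S] (δ : Derivation k S S) (i : k)

theorem constProd_zero_left (y : Gen → S) : constProd δ i 0 y = 0 := by
  ext1 w
  simp [constProd]

theorem constProd_zero_right (x : Gen → S) : constProd δ i x 0 = 0 := by
  ext1 w
  simp [constProd]

theorem lamProd_zero_left (y : Gen → S) : lamProd i 0 y = 0 := by
  ext1 w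
  simp [lamProd]

theorem lamProd_zero_right (x : Gen → S) : lamProd i x 0 = 0 := by
  ext1 w
  simp [lamProd]

variable [CharZero k]

theorem derExpansion_comb_zero (w : Gen → S) : derExpansion δ i (comb w) 0 = w := by
  rw [derExpansion_comb, Finsupp.single_eq_same]

theorem derExpansion_comb_succ (w : Gen → S) (n : ℕ) :
    derExpansion δ i (comb w) (n + 1) = 0 := by
  rw [derExpansion_comb, Finsupp.single_eq_of_ne (Nat.succ_ne_zero n)]

theorem derExpansion_nProd_der_pow (N p q : ℕ) (a b : Gen → S) :
    derExpansion δ i ((n4Over δ i).nProd N (((n4Over δ i).der ^ p) (comb a))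
        (((n4Over δ i).der ^ q) (comb b))) 0
      = (if p + q = N then ((-1) ^ p * (N.factorial : k)) • constProd δ i a b else 0)
        + if p + q + 1 = N then ((-1) ^ p * (N.factorial : k)) • lamProd i a b else 0 := by
  refine (ConformalSuperalgebra.map_nProd_der_pow _
    (Finsupp.lapply 0 ∘ₗ (derExpansion δ i).toLinearMap)
    (derExpansion_der_zero δ i) N p q _ _).trans ?_
  change _ • derExpansion δ i _ 0 = _
  rcases lt_trichotomy (p + q) N with h | h | h
  · rw [if_neg h.ne, zero_add]
    by_cases h1 : p + q + 1 = N
    · have hd : (p + q + 1).descFactorial (p + q) = (p + q + 1).factorial := by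
        simpa using Nat.factorial_mul_descFactorial (Nat.le_succ (p + q))
      rw [if_pos h1, ← h1, Nat.add_sub_cancel_left, nProd_comb_one, derExpansion_comb_zero, hd]
    · rw [if_neg h1, nProd_comb_of_two_le δ i (by omega), (derExpansion δ i).map_zero,
        Finsupp.zero_apply, smul_zero]
  · rw [if_pos h, if_neg (by omega), add_zero, h, Nat.sub_self, Nat.descFactorial_self,
      nProd_comb_zero, map_add, Finsupp.add_apply, derExpansion_der_zero, zero_add,
      derExpansion_comb_zero]
  · rw [if_neg h.ne', if_neg (by omega), Nat.descFactorial_of_lt h, Nat.cast_zero, mul_zero,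
      zero_smul, add_zero]

theorem derExpansion_nProd_eq_sum (N : ℕ) (x y : S ⊗[k] N4 k) :
    derExpansion δ i ((n4Over δ i).nProd N x y) 0
      = ∑ z ∈ antidiagonal N, ((-1) ^ z.1 * (N.factorial : k)) •
          constProd δ i (derExpansion δ i x z.1) (derExpansion δ i y z.2)
        + ∑ p ∈ (derExpansion δ i x).support, ∑ q ∈ (derExpansion δ i y).support,
          if p + q + 1 = N then ((-1) ^ p * (N.factorial : k)) •
            lamProd i (derExpansion δ i x p) (derExpansion δ i y q) else 0 := by
  rw [← sum_support_eq_sum_antidiagonal _ _ _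
    (fun p a b => ((-1) ^ p * (N.factorial : k)) • constProd δ i a b)
    (by simp [constProd_zero_left]) (by simp [constProd_zero_right])]
  conv_lhs => rw [eq_sum_derExpansion δ i x, eq_sum_derExpansion δ i y]
  simp only [map_sum, LinearMap.sum_apply, Finsupp.finsetSum_apply, derExpansion_nProd_der_pow,
    Finset.sum_add_distrib]
  congr 1 <;> rw [Finset.sum_comm]

theorem derExpansion_nProd_zero (x y : S ⊗[k] N4 k) :
    derExpansion δ i ((n4Over δ i).nProd 0 x y) 0
      = constProd δ i (derExpansion δ i x 0) (derExpansion δ i y 0) := by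
  simp [derExpansion_nProd_eq_sum]

theorem derExpansion_nProd_succ (n : ℕ) (x y : S ⊗[k] N4 k) :
    derExpansion δ i ((n4Over δ i).nProd (n + 1) x y) 0
      = ∑ z ∈ antidiagonal (n + 1), ((-1) ^ z.1 * ((n + 1).factorial : k)) •
          constProd δ i (derExpansion δ i x z.1) (derExpansion δ i y z.2)
        + ∑ z ∈ antidiagonal n, ((-1) ^ z.1 * ((n + 1).factorial : k)) •
          lamProd i (derExpansion δ i x z.1) (derExpansion δ i y z.2) := by
  rw [derExpansion_nProd_eq_sum, ← sum_support_eq_sum_antidiagonal _ _ n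
    (fun p a b => ((-1) ^ p * ((n + 1).factorial : k)) • lamProd i a b)
    (by simp [lamProd_zero_left]) (by simp [lamProd_zero_right])]
  simp only [add_left_inj]

theorem derExpansion_nProd_succ_comb_right (n : ℕ) (x : S ⊗[k] N4 k) (w : Gen → S) :
    derExpansion δ i ((n4Over δ i).nProd (n + 1) x (comb w)) 0
      = ((-1) ^ n * ((n + 1).factorial : k)) •
        (lamProd i (derExpansion δ i x n) w - constProd δ i (derExpansion δ i x (n + 1)) w) := by
  rw [derExpansion_nProd_succ, sum_antidiagonal_eq_left,
    sum_antidiagonal_eq_left]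
  · simp only [derExpansion_comb_zero, pow_succ]
    module
  · intro p q
    rw [derExpansion_comb_succ, lamProd_zero_right, smul_zero]
  · intro p q
    rw [derExpansion_comb_succ, constProd_zero_right, smul_zero]

theorem derExpansion_nProd_succ_comb_left (n : ℕ) (x : S ⊗[k] N4 k) (w : Gen → S) :
    derExpansion δ i ((n4Over δ i).nProd (n + 1) (comb w) x) 0
      = ((n + 1).factorial : k) •
        (constProd δ i w (derExpansion δ i x (n + 1)) + lamProd i w (derExpansion δ i x n)) := by
  rw [derExpansion_nProd_succ, sum_antidiagonal_eq_right,
    sum_antidiagonal_eq_right]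
  · simp only [derExpansion_comb_zero, pow_zero, one_mul, smul_add]
  · intro p q
    rw [derExpansion_comb_succ, lamProd_zero_left, smul_zero]
  · intro p q
    rw [derExpansion_comb_succ, constProd_zero_left, smul_zero]

end ProductCoefficients

theorem exists_top_index {V : Type*} [Zero V] (f : ℕ →₀ V) {p : V → Prop} (h0 : ¬p 0) {n : ℕ}
    (hn : p (f n)) : ∃ P, n ≤ P ∧ p (f P) ∧ ∀ m, P < m → ¬p (f m) := by
  classical
  have hs {m : ℕ} (hm : p (f m)) : m ∈ f.support.filter fun m => p (f m) :=
    Finset.mem_filter.2 ⟨Finsupp.mem_support_iff.2 fun h => h0 (h ▸ hm), hm⟩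
  obtain ⟨P, hP, hmax⟩ := Finset.exists_max_image _ id ⟨n, hs hn⟩
  exact ⟨P, hmax n (hs hn), (Finset.mem_filter.1 hP).2,
    fun m hm hc => (hmax m (hs hc)).not_gt hm⟩

section Currents

variable {k S : Type*} [Field k] [CommRing S] [Algebra k S]

theorem lamProd_current (i : k) (M : Matrix (Fin 2) (Fin 2) S) (r : S)
    (N : Matrix (Fin 2) (Fin 2) S) (v w : Fin 2 → S) :
    lamProd i (coords i 0 M 0 0) (coords i r N v w) = coords i 0 (r • M) 0 0 := by
  rw [lamProd_coords]
  simp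

theorem derProd_current (i : k) (M : Matrix (Fin 2) (Fin 2) S) (r : S)
    (N : Matrix (Fin 2) (Fin 2) S) (v w : Fin 2 → S) :
    derProd i (coords i 0 M 0 0) (coords i r N v w) = 0 := by
  rw [derProd_coords]
  simp [coords_zero]

variable [CharZero k] {i : k}

theorem constProd_current (hi : i * i = -1) (δ : Derivation k S S)
    {M N : Matrix (Fin 2) (Fin 2) S} (hM : M.trace = 0) (hN : N.trace = 0) (v w : Fin 2 → S) :
    constProd δ i (coords i 0 M 0 0) (coords i 0 N v w)
      = coords i 0 (M * N - N * M) (-(Mᵀ *ᵥ v)) (M *ᵥ w) := by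
  rw [constProd_coords hi δ _ _ hM hN]
  have h0 : δ ∘ (0 : Fin 2 → S) = 0 := funext fun _ => map_zero δ
  simp [h0]

theorem coords_zero_eq_zero_iff (hi : i * i = -1) {M : Matrix (Fin 2) (Fin 2) S}
    (hM : M.trace = 0) {v w : Fin 2 → S} :
    coords i 0 M v w = 0 ↔ M = 0 ∧ v = 0 ∧ w = 0 := by
  refine ⟨fun h => ⟨?_, ?_, ?_⟩, by rintro ⟨rfl, rfl, rfl⟩; exact coords_zero i⟩
  · rw [← sl2Part_coords hi 0 hM v w, h]
    exact sl2Part_eq_zero i fun _ => rfl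
  · rw [← coords_comp_G i 0 M v w, h]
    rfl
  · rw [← coords_comp_Gbar i 0 M v w, h]
    rfl

variable (δ : Derivation k S S)

theorem nProd_succ_current (i : k) (n : ℕ) (M N : Matrix (Fin 2) (Fin 2) S) (v w : Fin 2 → S) :
    (n4Over δ i).nProd (n + 1) (comb (coords i 0 M 0 0)) (comb (coords i 0 N v w)) = 0 := by
  rcases n with _ | n
  · rw [zero_add, nProd_comb_one, lamProd_current, zero_smul, coords_zero, map_zero]
  · exact nProd_comb_of_two_le δ i (by omega) _ _

theorem nProd_zero_current (hi : i * i = -1) {M N : Matrix (Fin 2) (Fin 2) S}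
    (hM : M.trace = 0) (hN : N.trace = 0) (v w : Fin 2 → S) :
    (n4Over δ i).nProd 0 (comb (coords i 0 M 0 0)) (comb (coords i 0 N v w))
      = comb (coords i 0 (M * N - N * M) (-(Mᵀ *ᵥ v)) (M *ᵥ w)) := by
  rw [nProd_comb_zero, derProd_current, constProd_current hi δ hM hN, map_zero, map_zero, zero_add]

/-- A current: an element of the differential submodule generated by `J^1, J^2, J^3`. -/
def IsCurrent (i : k) (x : S ⊗[k] N4 k) : Prop :=
  ∀ n, ∃ M : Matrix (Fin 2) (Fin 2) S, M.trace = 0 ∧ derExpansion δ i x n = coords i 0 M 0 0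

variable {δ}

theorem comb_mem_parity_zero (i : k) (r : S) (M : Matrix (Fin 2) (Fin 2) S) :
    comb (coords i r M 0 0) ∈ (n4Over δ i).parity 0 := by
  refine comb_mem_parity δ i fun u hu => ?_
  rcases u with _ | s | a | a
  · exact absurd rfl hu
  · exact absurd rfl hu
  · rfl
  · rfl

theorem comb_mem_parity_one (i : k) (v w : Fin 2 → S) :
    comb (coords i 0 0 v w) ∈ (n4Over δ i).parity 1 := by
  refine comb_mem_parity δ i fun u hu => ?_
  rcases u with _ | s | a | a
  · rfl
  · simp [coords]
  · exact absurd rfl hu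
  · exact absurd rfl hu

theorem derExpansion_apply_eq_zero {p : ZMod 2} {x : S ⊗[k] N4 k}
    (hx : x ∈ (n4Over δ i).parity p) (n : ℕ) {u : Gen} (hu : u.parity ≠ p) :
    derExpansion δ i x n u = 0 := by
  classical
  let θ : Module.End S (Gen → S) :=
    LinearMap.pi fun u => if u.parity = p then 0 else LinearMap.proj u
  have hker : (n4Over δ i).parity p ≤ LinearMap.ker (derExtend δ i θ) := by
    refine parity_le_of_der_mem δ i (fun x hx => ?_) fun u hu => ?_
    · rw [LinearMap.mem_ker, derExtend_der, LinearMap.mem_ker.1 hx, map_zero]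
    · rw [LinearMap.mem_ker, ← comb_single, derExtend_comb]
      have h : θ (Pi.single u 1) = 0 := by
        ext1 v
        rcases eq_or_ne v u with rfl | hv
        · simp [θ, hu]
        · by_cases hvp : v.parity = p <;> simp [θ, hvp, Pi.single_eq_of_ne hv]
      rw [h, map_zero]
  have h : derExpansion δ i (derExtend δ i θ x) n u = 0 := by
    rw [LinearMap.mem_ker.1 (hker hx), (derExpansion δ i).map_zero]
    rfl
  rw [derExpansion_derExtend] at h
  simpa [θ, hu] using h

theorem derExpansion_of_even (hi : i * i = -1) {x : S ⊗[k] N4 k}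
    (hx : x ∈ (n4Over δ i).parity 0) (n : ℕ) : derExpansion δ i x n
      = coords i (derExpansion δ i x n .L) (sl2Part i (derExpansion δ i x n)) 0 0 := by
  have hG : derExpansion δ i x n ∘ Gen.G = 0 := funext fun a =>
    derExpansion_apply_eq_zero hx n (by decide : (1 : ZMod 2) ≠ 0)
  have hGbar : derExpansion δ i x n ∘ Gen.Gbar = 0 := funext fun a =>
    derExpansion_apply_eq_zero hx n (by decide : (1 : ZMod 2) ≠ 0)
  simpa only [hG, hGbar] using (coords_parts hi (derExpansion δ i x n)).symm

theorem derExpansion_of_odd (hi : i * i = -1) {x : S ⊗[k] N4 k}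
    (hx : x ∈ (n4Over δ i).parity 1) (n : ℕ) : derExpansion δ i x n
      = coords i 0 0 (derExpansion δ i x n ∘ Gen.G) (derExpansion δ i x n ∘ Gen.Gbar) := by
  have hL : derExpansion δ i x n .L = 0 :=
    derExpansion_apply_eq_zero hx n (by decide : (0 : ZMod 2) ≠ 1)
  have hJ : sl2Part i (derExpansion δ i x n) = 0 := sl2Part_eq_zero i fun s =>
    derExpansion_apply_eq_zero hx n (by decide : (0 : ZMod 2) ≠ 1)
  simpa only [hL, hJ] using (coords_parts hi (derExpansion δ i x n)).symm

theorem eq_comb_derExpansion_zero {x : S ⊗[k] N4 k} (h : ∀ n, derExpansion δ i x (n + 1) = 0) :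
    x = comb (derExpansion δ i x 0) := by
  refine (derExpansion δ i).injective (Finsupp.ext fun n => ?_)
  rcases n with _ | n
  · rw [derExpansion_comb_zero]
  · rw [h, derExpansion_comb_succ]

end Currents

section AutomorphismsOfCurrents

variable {k S : Type*} [Field k] [CharZero k] [CommRing S] [IsDomain S] [Algebra k S]
  {δ : Derivation k S S} {i : k} {σ : S ⊗[k] N4 k ≃ₗ[S] S ⊗[k] N4 k}

-- If `P` is the largest index whose coefficient has an `L`-part `r ≠ 0`, then `2 r ^ 2` is the
-- `L`-part of the coefficient of the product of degree `2 P + 1`.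
theorem derExpansion_apply_L_eq_zero {x : S ⊗[k] N4 k} (hx : x ∈ (n4Over δ i).parity 0)
    (h : ∀ n, (n4Over δ i).nProd (n + 1) x x = 0) (n : ℕ) : derExpansion δ i x n .L = 0 := by
  by_contra hn
  obtain ⟨P, -, hP, hmax⟩ := exists_top_index (derExpansion δ i x) (p := fun w => w .L ≠ 0)
    (fun h => h rfl) hn
  simp only [not_not] at hmax
  have odd_eq_zero (m : ℕ) (a : Fin 2) :
      derExpansion δ i x m (.G a) = 0 ∧ derExpansion δ i x m (.Gbar a) = 0 :=
    ⟨derExpansion_apply_eq_zero hx m (by decide : (1 : ZMod 2) ≠ 0),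
      derExpansion_apply_eq_zero hx m (by decide : (1 : ZMod 2) ≠ 0)⟩
  have constProd_apply_L (m l : ℕ) :
      constProd δ i (derExpansion δ i x m) (derExpansion δ i x l) .L
        = δ (derExpansion δ i x m .L) * derExpansion δ i x l .L
          - derExpansion δ i x m .L * δ (derExpansion δ i x l .L) := by
    simp [constProd_L, odd_eq_zero]
  have key := congrFun (derExpansion_nProd_succ δ i (P + P) x x) .L
  simp only [h, Pi.add_apply, Finset.sum_apply, Pi.smul_apply, constProd_apply_L, lamProd_L,
    map_zero, Finsupp.zero_apply, Pi.zero_apply] at key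
  rw [sum_antidiagonal_eq_zero_of_lt (Nat.lt_succ_self _), sum_antidiagonal_eq_middle,
    zero_add] at key
  · have := charZero_of_injective_algebraMap (FaithfulSMul.algebraMap_injective k S)
    have h2 := (smul_eq_zero.1 key.symm).resolve_left (mul_ne_zero
      (pow_ne_zero _ (neg_ne_zero.2 one_ne_zero)) (Nat.cast_ne_zero.2 (Nat.factorial_ne_zero _)))
    exact hP (mul_self_eq_zero.1 ((mul_eq_zero.1 h2).resolve_left two_ne_zero))
  · intro p q hp
    simp [hmax p hp]
  · intro p q hq
    simp [hmax q hq]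
  · intro p q hp
    simp [hmax p hp]
  · intro p q hq
    simp [hmax q hq]

end AutomorphismsOfCurrents

section Expansions

variable {k S : Type*} [Field k] [CharZero k] [CommRing S] [Algebra k S]
  (δ : Derivation k S S) (i : k)

theorem derExpansion_der_succ (x : S ⊗[k] N4 k) (n : ℕ) :
    derExpansion δ i ((n4Over δ i).der x) (n + 1) = derExpansion δ i x n := by
  rw [derExpansion_der]
  exact Finsupp.mapDomain_apply (add_left_injective 1) _ n

theorem exists_eq_comb_add_der (x : S ⊗[k] N4 k) :
    ∃ y, x = comb (derExpansion δ i x 0) + (n4Over δ i).der y := by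
  induction x using der_induction δ i with
  | zero => exact ⟨0, by simp⟩
  | add x y hx hy =>
    obtain ⟨x', hx⟩ := hx
    obtain ⟨y', hy⟩ := hy
    refine ⟨x' + y', ?_⟩
    rw [(derExpansion δ i).map_add, Finsupp.add_apply, map_add, map_add, add_add_add_comm, ← hx,
      ← hy]
  | der x _ => exact ⟨x, by rw [derExpansion_der_zero, map_zero, zero_add]⟩
  | tmul_gen r u =>
    exact ⟨0, by rw [← comb_single, derExpansion_comb_zero, map_zero, add_zero]⟩

theorem nProd_zero_eq (x y : S ⊗[k] N4 k) :
    (n4Over δ i).nProd 0 x y = (n4Over δ i).nProd 0 (comb (derExpansion δ i x 0)) y := by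
  obtain ⟨z, hz⟩ := exists_eq_comb_add_der δ i x
  conv_lhs => rw [hz, map_add, LinearMap.add_apply, (n4Over δ i).nProd_der_left]
  rw [Nat.cast_zero, zero_smul, neg_zero, add_zero]

theorem comb_derExpansion_nProd_zero {a : Gen → S} (ha : ∀ w, derProd i a w = 0)
    (x : S ⊗[k] N4 k) (n : ℕ) :
    comb (derExpansion δ i ((n4Over δ i).nProd 0 (comb a) x) n)
      = (n4Over δ i).nProd 0 (comb a) (comb (derExpansion δ i x n)) := by
  induction x using der_induction δ i generalizing n with
  | zero => simp
  | add x y hx hy =>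
    simp only [map_add, (derExpansion δ i).map_add, Finsupp.add_apply, hx, hy]
  | der x hx =>
    rw [(n4Over δ i).nProd_der_right, Nat.cast_zero, zero_smul, add_zero]
    rcases n with _ | n
    · simp only [derExpansion_der_zero, map_zero]
    · simp only [derExpansion_der_succ, hx]
  | tmul_gen r u =>
    rw [← comb_single, nProd_comb_zero, ha, map_zero, map_zero, zero_add]
    rcases n with _ | n
    · simp only [derExpansion_comb_zero, nProd_comb_zero, ha, map_zero, zero_add]
    · simp only [derExpansion_comb_succ, map_zero]

variable {δ i} {σ : S ⊗[k] N4 k ≃ₗ[S] S ⊗[k] N4 k}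

theorem derExpansion_map_zero (hσ : σ ∈ (n4Over δ i).Aut) (x : S ⊗[k] N4 k) :
    derExpansion δ i (σ x) 0 = derExpansion δ i (σ (comb (derExpansion δ i x 0))) 0 := by
  obtain ⟨y, hy⟩ := exists_eq_comb_add_der δ i x
  conv_lhs => rw [hy, map_add, hσ.2.2, (derExpansion δ i).map_add, Finsupp.add_apply,
    derExpansion_der_zero, add_zero]

theorem derExpansion_map_commutator (hi : i * i = -1) (hσ : σ ∈ (n4Over δ i).Aut)
    {A N C M : Matrix (Fin 2) (Fin 2) S} (hA : A.trace = 0) (hN : N.trace = 0) (hC : C.trace = 0)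
    (hM : M.trace = 0) {n : ℕ}
    (hAC : derExpansion δ i (σ (comb (coords i 0 A 0 0))) 0 = coords i 0 C 0 0)
    (hNM : derExpansion δ i (σ (comb (coords i 0 N 0 0))) n = coords i 0 M 0 0) :
    derExpansion δ i (σ (comb (coords i 0 (A * N - N * A) 0 0))) n
      = coords i 0 (C * M - M * C) 0 0 := by
  have h : comb (coords i 0 (A * N - N * A) 0 0)
      = (n4Over δ i).nProd 0 (comb (coords i 0 A 0 0)) (comb (coords i 0 N 0 0)) := by
    rw [nProd_zero_current δ hi hA hN, Matrix.mulVec_zero, Matrix.mulVec_zero, neg_zero]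
  refine comb_injective (k := k) ?_
  rw [h, hσ.2.1, nProd_zero_eq, hAC, comb_derExpansion_nProd_zero, hNM,
    nProd_zero_current δ hi hC hM, Matrix.mulVec_zero, Matrix.mulVec_zero, neg_zero]
  intro w
  rw [← coords_parts hi w, derProd_current]

end Expansions

section CurrentsToCurrents

theorem trace_commutator {n R : Type*} [Fintype n] [CommRing R] (A B : Matrix n n R) :
    (A * B - B * A).trace = 0 := by
  rw [Matrix.trace_sub, Matrix.trace_mul_comm, sub_self]

theorem eq_zero_of_double_commutator {R : Type*} [CommRing R] [IsDomain R] [CharZero R]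
    {e : Matrix (Fin 2) (Fin 2) R} (he : e.trace = 0)
    (h : ∀ c : Matrix (Fin 2) (Fin 2) R, c.trace = 0 →
      (c * e - e * c) * e - e * (c * e - e * c) = 0) : e = 0 := by
  rw [Matrix.trace_fin_two] at he
  have he11 := eq_neg_of_add_eq_zero_right he
  have entry (c : Matrix (Fin 2) (Fin 2) R) (hc : c.trace = 0) (a b : Fin 2) :
      ((c * e - e * c) * e - e * (c * e - e * c)) a b = 0 := by rw [h c hc, Matrix.zero_apply]
  have h10 : e 1 0 = 0 := by
    have h : -2 * e 1 0 ^ 2 = 0 := by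
      rw [← entry !![0, 1; 0, 0] (by simp [Matrix.trace_fin_two]) 1 0]
      simp [Matrix.mul_apply, Matrix.vecMul, dotProduct, Fin.sum_univ_two]
      ring
    simpa using h
  have h01 : e 0 1 = 0 := by
    have h : -2 * e 0 1 ^ 2 = 0 := by
      rw [← entry !![0, 0; 1, 0] (by simp [Matrix.trace_fin_two]) 0 1]
      simp [Matrix.mul_apply, Matrix.vecMul, dotProduct, Fin.sum_univ_two]
      ring
    simpa using h
  have h00 : e 0 0 = 0 := by
    have h : 4 * e 0 0 ^ 2 = 0 := by
      rw [← entry !![0, 1; 0, 0] (by simp [Matrix.trace_fin_two]) 0 1]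
      simp [Matrix.mul_apply, Matrix.vecMul, dotProduct, Fin.sum_univ_two, he11, h10]
      ring
    simpa using h
  ext a b
  fin_cases a <;> fin_cases b <;> simp [h00, h01, h10, he11]

variable {k S : Type*} [Field k] [CharZero k] [CommRing S] [IsDomain S] [Algebra k S]
  {δ : Derivation k S S} {i : k} {σ : S ⊗[k] N4 k ≃ₗ[S] S ⊗[k] N4 k}

theorem isCurrent_map (hi : i * i = -1) (hσ : σ ∈ (n4Over δ i).Aut)
    (M : Matrix (Fin 2) (Fin 2) S) : IsCurrent δ i (σ (comb (coords i 0 M 0 0))) := by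
  have heven := hσ.1 0 _ (comb_mem_parity_zero (δ := δ) i 0 M)
  have hL := derExpansion_apply_L_eq_zero heven fun n => by
    rw [← hσ.2.1, nProd_succ_current, map_zero]
  exact fun n => ⟨_, trace_sl2Part i _, (derExpansion_of_even hi heven n).trans (by rw [hL])⟩

theorem exists_derExpansion_map_zero_eq (hi : i * i = -1) (hσ : σ ∈ (n4Over δ i).Aut)
    (C : Matrix (Fin 2) (Fin 2) S) : ∃ A : Matrix (Fin 2) (Fin 2) S, A.trace = 0 ∧
      derExpansion δ i (σ (comb (coords i 0 A 0 0))) 0 = coords i 0 C 0 0 := by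
  obtain ⟨A, hA, h⟩ := isCurrent_map hi (inv_mem hσ) C 0
  refine ⟨A, hA, ?_⟩
  rw [← h, ← derExpansion_map_zero hσ]
  exact (congrArg (derExpansion δ i · 0) (σ.apply_symm_apply _)).trans
    (derExpansion_comb_zero δ i _)

theorem constProd_top_eq_zero {x y : S ⊗[k] N4 k} (hx : IsCurrent δ i x)
    (hy : IsCurrent δ i y) (h : ∀ n, (n4Over δ i).nProd (n + 1) x y = 0) {P : ℕ} (hP : 0 < P)
    (hxP : ∀ n, P < n → derExpansion δ i x n = 0) (hyP : ∀ n, P < n → derExpansion δ i y n = 0) :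
    constProd δ i (derExpansion δ i x P) (derExpansion δ i y P) = 0 := by
  obtain ⟨n, hn⟩ : ∃ n, n + 1 = P + P := ⟨P + P - 1, by omega⟩
  have lamProd_eq_zero (p q : ℕ) :
      lamProd i (derExpansion δ i x p) (derExpansion δ i y q) = 0 := by
    obtain ⟨M, -, hM⟩ := hx p
    obtain ⟨N, -, hN⟩ := hy q
    rw [hM, hN, lamProd_current, zero_smul, coords_zero]
  have key := derExpansion_nProd_succ δ i n x y
  rw [h, (derExpansion δ i).map_zero, Finsupp.zero_apply, hn] at key
  simp only [lamProd_eq_zero, smul_zero, Finset.sum_const_zero, add_zero] at key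
  rw [sum_antidiagonal_eq_middle] at key
  · exact (smul_eq_zero.1 key.symm).resolve_left (mul_ne_zero
      (pow_ne_zero _ (neg_ne_zero.2 one_ne_zero)) (Nat.cast_ne_zero.2 (Nat.factorial_ne_zero _)))
  · intro p q hp
    simp only [hxP p hp, constProd_zero_left, smul_zero]
  · intro p q hq
    simp only [hyP q hq, constProd_zero_right, smul_zero]

-- If `P ≥ 1` is the largest index with a nonzero coefficient `e` of `σ N`, the product of degree
-- `2 P` of `σ [A, N]` and `σ N` shows `[[c, e], e] = 0` for the `0`-th coefficient `c` of `σ A`,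
-- and `c` is arbitrary.
theorem exists_map_comb_current (hi : i * i = -1) (hσ : σ ∈ (n4Over δ i).Aut)
    {N : Matrix (Fin 2) (Fin 2) S} (hN : N.trace = 0) :
    ∃ N' : Matrix (Fin 2) (Fin 2) S, N'.trace = 0 ∧
      σ (comb (coords i 0 N 0 0)) = comb (coords i 0 N' 0 0) := by
  have := charZero_of_injective_algebraMap (FaithfulSMul.algebraMap_injective k S)
  have hx := isCurrent_map hi hσ N
  suffices hsucc : ∀ n, derExpansion δ i (σ (comb (coords i 0 N 0 0))) (n + 1) = 0 by
    obtain ⟨N', hN', h⟩ := hx 0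
    exact ⟨N', hN', (eq_comb_derExpansion_zero hsucc).trans (congrArg comb h)⟩
  intro n
  by_contra hn
  obtain ⟨P, hnP, hP, hmax⟩ := exists_top_index (derExpansion δ i (σ (comb (coords i 0 N 0 0))))
    (p := (· ≠ 0)) (fun h => h rfl) hn
  simp only [not_not] at hmax
  obtain ⟨e, he, hxe⟩ := hx P
  refine hP (hxe.trans ?_)
  rw [eq_zero_of_double_commutator he fun c hc => ?_, coords_zero]
  obtain ⟨A, hA, hAc⟩ := exists_derExpansion_map_zero_eq hi hσ c
  have hbracket {m : ℕ} {M : Matrix (Fin 2) (Fin 2) S} :=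
    derExpansion_map_commutator (n := m) (M := M) hi hσ hA hN hc
  have h := constProd_top_eq_zero (isCurrent_map hi hσ (A * N - N * A)) hx
    (fun n => by rw [← hσ.2.1, nProd_succ_current, map_zero]) (Nat.zero_lt_of_lt hnP)
    (fun m hm => ?_) hmax
  · rw [hbracket he hAc hxe, hxe, constProd_current hi δ (trace_commutator _ _) he,
      Matrix.mulVec_zero, Matrix.mulVec_zero, neg_zero,
      coords_zero_eq_zero_iff hi (trace_commutator _ _)] at h
    exact h.1
  · rw [hbracket (M := 0) (Matrix.trace_zero _ _) hAc ((hmax m hm).trans (coords_zero i).symm)]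
    simp [coords_zero]

theorem exists_map_eq_current (hi : i * i = -1) (hσ : σ ∈ (n4Over δ i).Aut)
    {C : Matrix (Fin 2) (Fin 2) S} (hC : C.trace = 0) :
    ∃ A : Matrix (Fin 2) (Fin 2) S, A.trace = 0 ∧
      σ (comb (coords i 0 A 0 0)) = comb (coords i 0 C 0 0) := by
  obtain ⟨A, hA, h⟩ := exists_map_comb_current hi (inv_mem hσ) hC
  exact ⟨A, hA, by rw [← h]; exact σ.apply_symm_apply _⟩

end CurrentsToCurrents

section GeneratorsToGenerators

theorem eq_zero_of_forall_mulVec_eq_zero {R : Type*} [CommRing R] {v : Fin 2 → R}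
    (h : ∀ C : Matrix (Fin 2) (Fin 2) R, C.trace = 0 → C *ᵥ v = 0) : v = 0 := by
  have h0 := congrFun (h !![0, 0; 1, 0] (by simp [Matrix.trace_fin_two])) 1
  have h1 := congrFun (h !![0, 1; 0, 0] (by simp [Matrix.trace_fin_two])) 0
  ext a
  fin_cases a
  · simpa [Matrix.mulVec, dotProduct] using h0
  · simpa [Matrix.mulVec, dotProduct] using h1

theorem eq_zero_of_smul_eq_commutator {R : Type*} [CommRing R] [IsDomain R] [CharZero R] {r : R}
    {M : Matrix (Fin 2) (Fin 2) R} (hM : M.trace = 0)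
    (h : ∀ C ∈ ({!![0, 1; 0, 0], !![1, 0; 0, -1]} : Set (Matrix (Fin 2) (Fin 2) R)),
      r • C = M * C - C * M) : r = 0 ∧ M = 0 := by
  have hM11 := eq_neg_of_add_eq_zero_right ((Matrix.trace_fin_two M).symm.trans hM)
  have hH : r • !![1, 0; 0, -1] = !![0, -(2 * M 0 1); 2 * M 1 0, 0] := by
    rw [h _ (by simp)]
    ext a b
    fin_cases a <;> fin_cases b <;> simp [Matrix.mul_apply, Matrix.vecMul, dotProduct] <;>
      ring
  have hE : r • !![0, 1; 0, 0] = !![-M 1 0, 2 * M 0 0; 0, M 1 0] := by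
    rw [h _ (by simp)]
    ext a b
    fin_cases a <;> fin_cases b <;>
      simp [Matrix.mul_apply, Matrix.vecMul, dotProduct, hM11, two_mul]
  have hr : r = 0 := by simpa using congrFun (congrFun hH 0) 0
  have h01 : M 0 1 = 0 := by simpa using congrFun (congrFun hH 0) 1
  have h10 : M 1 0 = 0 := by simpa using congrFun (congrFun hH 1) 0
  have h00 : M 0 0 = 0 := by simpa [hr] using congrFun (congrFun hE 0) 1
  refine ⟨hr, ?_⟩
  ext a b
  fin_cases a <;> fin_cases b <;> simp [h00, h01, h10, hM11]

variable {k S : Type*} [Field k] [CharZero k] [CommRing S] [IsDomain S] [Algebra k S]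
  {δ : Derivation k S S} {i : k} {σ : S ⊗[k] N4 k ≃ₗ[S] S ⊗[k] N4 k}

theorem nProd_succ_current_map (hi : i * i = -1) (hσ : σ ∈ (n4Over δ i).Aut)
    {C : Matrix (Fin 2) (Fin 2) S} (hC : C.trace = 0) (n : ℕ) (v w : Fin 2 → S) :
    (n4Over δ i).nProd (n + 1) (comb (coords i 0 C 0 0)) (σ (comb (coords i 0 0 v w))) = 0 := by
  obtain ⟨A, -, h⟩ := exists_map_eq_current hi hσ hC
  rw [← h, ← hσ.2.1, nProd_succ_current, map_zero]

theorem exists_map_comb_odd (hi : i * i = -1) (hσ : σ ∈ (n4Over δ i).Aut) (v w : Fin 2 → S) :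
    ∃ v' w', σ (comb (coords i 0 0 v w)) = comb (coords i 0 0 v' w') := by
  have hx := derExpansion_of_odd hi (hσ.1 1 _ (comb_mem_parity_one (δ := δ) i v w))
  refine ⟨_, _, (eq_comb_derExpansion_zero fun n => ?_).trans (congrArg comb (hx 0))⟩
  generalize hσx : σ (comb (coords i 0 0 v w)) = x at hx
  have key (C : Matrix (Fin 2) (Fin 2) S) (hC : C.trace = 0) :
      Cᵀ *ᵥ (derExpansion δ i x (n + 1) ∘ Gen.G) = 0
        ∧ C *ᵥ (derExpansion δ i x (n + 1) ∘ Gen.Gbar) = 0 := by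
    have h := derExpansion_nProd_succ_comb_left δ i n x (coords i 0 C 0 0)
    rw [← hσx, nProd_succ_current_map hi hσ hC, hσx, (derExpansion δ i).map_zero,
      Finsupp.zero_apply, hx n, hx (n + 1), lamProd_current, zero_smul, coords_zero, add_zero,
      constProd_current hi δ hC (Matrix.trace_zero _ _)] at h
    have h := (smul_eq_zero.1 h.symm).resolve_left (Nat.cast_ne_zero.2 (Nat.factorial_ne_zero _))
    rw [coords_zero_eq_zero_iff hi (trace_commutator _ _), neg_eq_zero] at h
    exact h.2
  have hG : derExpansion δ i x (n + 1) ∘ Gen.G = 0 := eq_zero_of_forall_mulVec_eq_zero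
    fun C hC => by simpa using (key Cᵀ (by rwa [Matrix.trace_transpose])).1
  have hGbar : derExpansion δ i x (n + 1) ∘ Gen.Gbar = 0 :=
    eq_zero_of_forall_mulVec_eq_zero fun C hC => (key C hC).2
  rw [hx (n + 1), hG, hGbar, coords_zero]

theorem nProd_succ_map_L (hi : i * i = -1) (hσ : σ ∈ (n4Over δ i).Aut)
    {C : Matrix (Fin 2) (Fin 2) S} (hC : C.trace = 0) (n : ℕ) :
    (n4Over δ i).nProd (n + 1) (σ (comb (coords i 1 0 0 0))) (comb (coords i 0 C 0 0))
      = (if n = 0 then (1 : S) else 0) • comb (coords i 0 C 0 0) := by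
  obtain ⟨A, -, h⟩ := exists_map_eq_current hi hσ hC
  rw [← h, ← hσ.2.1, ← map_smul]
  rcases n with _ | n
  · simp [nProd_comb_one, lamProd_coords]
  · rw [nProd_comb_of_two_le δ i (by omega), if_neg (Nat.succ_ne_zero n), zero_smul]

theorem smul_eq_commutator_of_map_L (hi : i * i = -1) (hσ : σ ∈ (n4Over δ i).Aut)
    {C : Matrix (Fin 2) (Fin 2) S} (hC : C.trace = 0) (hC' : C.map δ = 0) {n : ℕ} {r r' : S}
    {M M' : Matrix (Fin 2) (Fin 2) S} (hM' : M'.trace = 0)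
    (hn : derExpansion δ i (σ (comb (coords i 1 0 0 0))) n = coords i r M 0 0)
    (hn' : derExpansion δ i (σ (comb (coords i 1 0 0 0))) (n + 1) = coords i r' M' 0 0) :
    (r - if n = 0 then 1 else 0) • C = M' * C - C * M' := by
  have h := derExpansion_nProd_succ_comb_right δ i n (σ (comb (coords i 1 0 0 0)))
    (coords i 0 C 0 0)
  rw [nProd_succ_map_L hi hσ hC, ← map_smul, derExpansion_comb_zero, hn, hn'] at h
  have h : (if n = 0 then (1 : S) else 0) • coords i 0 C 0 0
      = lamProd i (coords i r M 0 0) (coords i 0 C 0 0)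
        - constProd δ i (coords i r' M' 0 0) (coords i 0 C 0 0) := by
    rcases n with _ | n
    · simpa using h
    · rw [if_neg (Nat.succ_ne_zero n), zero_smul] at h ⊢
      exact ((smul_eq_zero.1 h.symm).resolve_left (mul_ne_zero
        (pow_ne_zero _ (neg_ne_zero.2 one_ne_zero))
        (Nat.cast_ne_zero.2 (Nat.factorial_ne_zero _)))).symm
  have h0 : δ ∘ (0 : Fin 2 → S) = 0 := funext fun _ => map_zero δ
  rw [eq_sub_iff_add_eq, lamProd_coords, constProd_coords hi δ _ _ hM' hC, smul_coords,
    coords_add] at h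
  have h := congrArg (sl2Part i) h
  rw [sl2Part_coords hi, sl2Part_coords hi] at h
  · have h : (if n = 0 then C else 0) + (M' * C - C * M') = r • C := by simpa [hC', h0] using h
    rw [sub_smul, ← h, ite_smul, one_smul, zero_smul, add_sub_cancel_left]
  · simp [hC]
  · rw [Matrix.trace_add, Matrix.trace_smul, hC]
    simp [hC', h0, Matrix.trace_mul_comm M' C]

theorem exists_map_comb_L (hi : i * i = -1) (hσ : σ ∈ (n4Over δ i).Aut) :
    ∃ M : Matrix (Fin 2) (Fin 2) S, M.trace = 0 ∧
      σ (comb (coords i 1 0 0 0)) = comb (coords i 1 M 0 0) := by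
  have := charZero_of_injective_algebraMap (FaithfulSMul.algebraMap_injective k S)
  have hx := derExpansion_of_even hi (hσ.1 0 _ (comb_mem_parity_zero (δ := δ) i 1 0))
  have key (n : ℕ) := eq_zero_of_smul_eq_commutator (trace_sl2Part i _) fun C hC =>
    smul_eq_commutator_of_map_L (C := C) hi hσ
      (by rcases hC with rfl | rfl <;> simp [Matrix.trace_fin_two])
      (by
        rcases hC with rfl | rfl <;> ext a b <;> fin_cases a <;> fin_cases b <;> simp)
      (trace_sl2Part i _) (hx n) (hx (n + 1))
  have hL := sub_eq_zero.1 (key 0).1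
  rw [if_pos rfl] at hL
  refine ⟨_, trace_sl2Part i _, (eq_comb_derExpansion_zero fun n => ?_).trans
    (congrArg comb ((hx 0).trans (by rw [hL])))⟩
  have hL' := sub_eq_zero.1 (key (n + 1)).1
  rw [if_neg (Nat.succ_ne_zero n)] at hL'
  rw [hx, hL', (key n).2, coords_zero]

end GeneratorsToGenerators

/-- `σ` sends `L` to `L + M`, a current `N ∈ sl₂(S)` to `φ N`, and the odd element `G(v) + Ḡ(w)`
to `G(A v + C w) + Ḡ(B v + E w)`. Only the values of `φ` at traceless matrices are relevant. -/
structure ActsBy {k S : Type*} [Field k] [CommRing S] [Algebra k S] (i : k)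
    (σ : S ⊗[k] N4 k ≃ₗ[S] S ⊗[k] N4 k)
    (φ : Matrix (Fin 2) (Fin 2) S → Matrix (Fin 2) (Fin 2) S)
    (M A B C E : Matrix (Fin 2) (Fin 2) S) : Prop where
  trace_φ : ∀ N, N.trace = 0 → (φ N).trace = 0
  map_J : ∀ N, N.trace = 0 → σ (comb (coords i 0 N 0 0)) = comb (coords i 0 (φ N) 0 0)
  trace_M : M.trace = 0
  map_L : σ (comb (coords i 1 0 0 0)) = comb (coords i 1 M 0 0)
  map_G : ∀ v w, σ (comb (coords i 0 0 v w))
    = comb (coords i 0 0 (A *ᵥ v + C *ᵥ w) (B *ᵥ v + E *ᵥ w))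

section ExistsActsBy

theorem coords_odd_eq_sum {k S : Type*} [Field k] [CommRing S] [Algebra k S] (i : k)
    (v w : Fin 2 → S) :
    coords i 0 0 v w = ∑ a, v a • coords i 0 0 (Pi.single a 1) 0
      + ∑ a, w a • coords i 0 0 0 (Pi.single a 1) := by
  simp only [smul_coords, Fin.sum_univ_two, coords_add]
  congr 1
  · simp
  · simp
  · ext a
    fin_cases a <;> simp
  · ext a
    fin_cases a <;> simp

variable {k S : Type*} [Field k] [CharZero k] [CommRing S] [IsDomain S] [Algebra k S]
  {δ : Derivation k S S} {i : k} {σ : S ⊗[k] N4 k ≃ₗ[S] S ⊗[k] N4 k}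

theorem exists_actsBy (hi : i * i = -1) (hσ : σ ∈ (n4Over δ i).Aut) :
    ∃ φ M A B C E, ActsBy i σ φ M A B C E := by
  have hJ (N : Matrix (Fin 2) (Fin 2) S) : ∃ N' : Matrix (Fin 2) (Fin 2) S,
      N.trace = 0 → N'.trace = 0 ∧ σ (comb (coords i 0 N 0 0)) = comb (coords i 0 N' 0 0) := by
    by_cases hN : N.trace = 0
    · obtain ⟨N', h⟩ := exists_map_comb_current hi hσ hN
      exact ⟨N', fun _ => h⟩
    · exact ⟨0, fun h => absurd h hN⟩
  choose φ hφ using hJ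
  obtain ⟨M, hM, hL⟩ := exists_map_comb_L hi hσ
  choose A B hG using fun b : Fin 2 => exists_map_comb_odd hi hσ (Pi.single b 1) 0
  choose C E hGbar using fun b : Fin 2 => exists_map_comb_odd hi hσ 0 (Pi.single b 1)
  refine ⟨φ, M, (Matrix.of A)ᵀ, (Matrix.of B)ᵀ, (Matrix.of C)ᵀ, (Matrix.of E)ᵀ,
    fun N hN => (hφ N hN).1, fun N hN => (hφ N hN).2, hM, hL, fun v w => ?_⟩
  rw [coords_odd_eq_sum i v w]
  simp only [map_add, map_sum, map_smul, hG, hGbar]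
  simp only [← map_smul, ← map_sum, ← map_add, Fin.sum_univ_two, smul_coords, coords_add]
  congr 2
  · simp
  · simp
  · ext a
    fin_cases a <;> simp <;> ring
  · ext a
    fin_cases a <;> simp <;> ring

end ExistsActsBy

section Constraints

variable {k S : Type*} [Field k] [CommRing S] [Algebra k S] {i : k}
  {σ : S ⊗[k] N4 k ≃ₗ[S] S ⊗[k] N4 k} {φ : Matrix (Fin 2) (Fin 2) S → Matrix (Fin 2) (Fin 2) S}
  {M A B C E N : Matrix (Fin 2) (Fin 2) S}

theorem ActsBy.map_comb_coords (h : ActsBy i σ φ M A B C E) (r : S) (hN : N.trace = 0)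
    (v w : Fin 2 → S) :
    σ (comb (coords i r N v w))
      = comb (coords i r (r • M + φ N) (A *ᵥ v + C *ᵥ w) (B *ᵥ v + E *ᵥ w)) := by
  have split (r : S) (M N : Matrix (Fin 2) (Fin 2) S) (v w : Fin 2 → S) :
      coords i r (r • M + N) v w
        = r • coords i 1 M 0 0 + coords i 0 N 0 0 + coords i 0 0 v w := by
    simp only [smul_coords, coords_add, mul_one, smul_zero, add_zero, zero_add]
  have hsource := split r 0 N v w
  rw [smul_zero, zero_add] at hsource
  rw [hsource, split]
  simp only [map_add, map_smul, h.map_L, h.map_J N hN, h.map_G]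

variable [CharZero k] {δ : Derivation k S S}

theorem ActsBy.intertwine (h : ActsBy i σ φ M A B C E) (hi : i * i = -1)
    (hσ : σ ∈ (n4Over δ i).Aut) (hN : N.trace = 0) :
    (φ N)ᵀ * A = A * Nᵀ ∧ φ N * B = -(B * Nᵀ) ∧ (φ N)ᵀ * C = -(C * N) ∧ φ N * E = E * N := by
  have bracket (v w : Fin 2 → S) :
      coords i 0 0 (A *ᵥ -(Nᵀ *ᵥ v) + C *ᵥ (N *ᵥ w)) (B *ᵥ -(Nᵀ *ᵥ v) + E *ᵥ (N *ᵥ w))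
        = coords i 0 0 (-((φ N)ᵀ *ᵥ (A *ᵥ v + C *ᵥ w))) (φ N *ᵥ (B *ᵥ v + E *ᵥ w)) := by
    have e := hσ.2.1 0 (comb (coords i 0 N 0 0)) (comb (coords i 0 0 v w))
    have h0 := Matrix.trace_zero (Fin 2) S
    simp only [h.map_J N hN, h.map_G, nProd_zero_current δ hi hN h0,
      nProd_zero_current δ hi (h.trace_φ N hN) h0, mul_zero, zero_mul, sub_zero] at e
    exact comb_injective e
  have dual (v w : Fin 2 → S) := congrArg (· ∘ Gen.G) (bracket v w)
  have standard (v w : Fin 2 → S) := congrArg (· ∘ Gen.Gbar) (bracket v w)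
  simp only [coords_comp_G, coords_comp_Gbar] at dual standard
  refine ⟨?_, ?_, ?_, ?_⟩ <;> refine Matrix.mulVec_injective (funext fun v => ?_)
  · simpa only [Matrix.mulVec_zero, Matrix.mulVec_neg, Matrix.mulVec_mulVec, add_zero,
      neg_inj] using (dual v 0).symm
  · simpa only [Matrix.mulVec_zero, Matrix.mulVec_neg, Matrix.neg_mulVec, Matrix.mulVec_mulVec,
      add_zero] using (standard v 0).symm
  · simpa only [Matrix.mulVec_zero, Matrix.neg_mulVec, Matrix.mulVec_mulVec, neg_zero, zero_add,
      neg_inj, neg_neg] using congrArg Neg.neg (dual 0 v).symm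
  · simpa only [Matrix.mulVec_zero, Matrix.mulVec_mulVec, neg_zero, zero_add]
      using (standard 0 v).symm

theorem nProd_zero_comb_L (hi : i * i = -1) (hM : M.trace = 0) (v w : Fin 2 → S) :
    (n4Over δ i).nProd 0 (comb (coords i 1 M 0 0)) (comb (coords i 0 0 v w))
      = (n4Over δ i).der (comb (coords i 0 0 v w))
        + comb (coords i 0 0 (-(δ ∘ v) - Mᵀ *ᵥ v) (-(δ ∘ w) + M *ᵥ w)) := by
  rw [nProd_comb_zero, derProd_coords, constProd_coords hi δ 1 0 hM (Matrix.trace_zero _ _)]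
  congr 3
  all_goals simp [Pi.comp_zero, sub_eq_add_neg]

theorem ActsBy.deriv (h : ActsBy i σ φ M A B C E) (hi : i * i = -1) (hσ : σ ∈ (n4Over δ i).Aut) :
    A.map δ = -(Mᵀ * A) ∧ B.map δ = M * B ∧ C.map δ = -(Mᵀ * C) ∧ E.map δ = M * E := by
  have bracket (v w : Fin 2 → S) :
      coords i 0 0 (A *ᵥ -(δ ∘ v) + C *ᵥ -(δ ∘ w)) (B *ᵥ -(δ ∘ v) + E *ᵥ -(δ ∘ w))
        = coords i 0 0 (-(δ ∘ (A *ᵥ v + C *ᵥ w)) - Mᵀ *ᵥ (A *ᵥ v + C *ᵥ w))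
          (-(δ ∘ (B *ᵥ v + E *ᵥ w)) + M *ᵥ (B *ᵥ v + E *ᵥ w)) := by
    have e := hσ.2.1 0 (comb (coords i 1 0 0 0)) (comb (coords i 0 0 v w))
    rw [h.map_L, h.map_G, nProd_zero_comb_L hi (Matrix.trace_zero _ _),
      nProd_zero_comb_L hi h.trace_M, map_add, hσ.2.2, h.map_G, add_right_inj,
      Matrix.transpose_zero, Matrix.zero_mulVec, Matrix.zero_mulVec, sub_zero, add_zero,
      h.map_G] at e
    exact comb_injective e
  have dual (v w : Fin 2 → S) := congrArg (· ∘ Gen.G) (bracket v w)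
  have standard (v w : Fin 2 → S) := congrArg (· ∘ Gen.Gbar) (bracket v w)
  simp only [coords_comp_G, coords_comp_Gbar] at dual standard
  have comp_add (x y : Fin 2 → S) : δ ∘ (x + y) = δ ∘ x + δ ∘ y := funext fun _ => map_add δ _ _
  have comp_zero : δ ∘ (0 : Fin 2 → S) = 0 := funext fun _ => map_zero δ
  simp only [comp_add, derivation_comp_mulVec, Matrix.mulVec_neg, Matrix.mulVec_add,
    Matrix.mulVec_mulVec] at dual standard
  refine ⟨?_, ?_, ?_, ?_⟩ <;> refine Matrix.mulVec_injective (funext fun v => ?_)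
  · have e := dual v 0
    simp only [comp_zero, Matrix.mulVec_zero, Matrix.neg_mulVec] at e ⊢
    linear_combination e
  · have e := standard v 0
    simp only [comp_zero, Matrix.mulVec_zero] at e
    linear_combination e
  · have e := dual 0 v
    simp only [comp_zero, Matrix.mulVec_zero, Matrix.neg_mulVec] at e ⊢
    linear_combination e
  · have e := standard 0 v
    simp only [comp_zero, Matrix.mulVec_zero] at e
    linear_combination e

theorem ActsBy.derExpansion_map_L (h : ActsBy i σ φ M A B C E) (hi : i * i = -1)
    (hσ : σ ∈ (n4Over δ i).Aut) (x : S ⊗[k] N4 k) :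
    derExpansion δ i (σ x) 0 .L = derExpansion δ i x 0 .L := by
  rw [derExpansion_map_zero hσ, ← coords_parts hi (derExpansion δ i x 0),
    h.map_comb_coords _ (trace_sl2Part i _), derExpansion_comb_zero]
  rfl

theorem ActsBy.pairing (h : ActsBy i σ φ M A B C E) (hi : i * i = -1)
    (hσ : σ ∈ (n4Over δ i).Aut) : Aᵀ * E + Bᵀ * C = 1 := by
  have hL (v w v' w' : Fin 2 → S) : derExpansion δ i ((n4Over δ i).nProd 0
      (comb (coords i 0 0 v w)) (comb (coords i 0 0 v' w'))) 0 .L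
        = 2 * (v ⬝ᵥ w') + 2 * (w ⬝ᵥ v') := by
    have h0 := Matrix.trace_zero (Fin 2) S
    rw [derExpansion_nProd_zero, derExpansion_comb_zero, derExpansion_comb_zero,
      constProd_coords hi δ 0 0 h0 h0]
    simp [coords]
  have two_isUnit : IsUnit (2 : S) := by
    simpa only [map_ofNat] using (IsUnit.mk0 (2 : k) two_ne_zero).map (algebraMap k S)
  ext a b
  have e := h.derExpansion_map_L hi hσ ((n4Over δ i).nProd 0
    (comb (coords i 0 0 (Pi.single a 1) 0)) (comb (coords i 0 0 0 (Pi.single b 1))))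
  rw [hσ.2.1, h.map_G, h.map_G, hL, hL] at e
  simp only [Matrix.mulVec_zero, Matrix.mulVec_single_one, add_zero, zero_add, mul_zero,
    zero_dotProduct, ← mul_add] at e
  have e' := two_isUnit.mul_left_cancel e
  simpa [Matrix.mul_apply, dotProduct, Matrix.one_apply, Pi.single_apply, eq_comm] using e'

theorem ActsBy.derivation_det (h : ActsBy i σ φ M A B C E) (hi : i * i = -1)
    (hσ : σ ∈ (n4Over δ i).Aut) : δ A.det = 0 := by
  have hA : A.map δ = -Mᵀ * A := by rw [(h.deriv hi hσ).1, neg_mul]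
  rw [derivation_det_fin_two δ hA, Matrix.trace_neg, Matrix.trace_transpose, h.trace_M, neg_zero,
    zero_mul]

theorem eq_zero_of_forall_mul_mul_adjugate_eq_zero {R : Type*} [CommRing R] [IsReduced R]
    {A : Matrix (Fin 2) (Fin 2) R}
    (h : ∀ N : Matrix (Fin 2) (Fin 2) R, N.trace = 0 → A * N * A.adjugate = 0) : A = 0 := by
  have hE := h !![0, 1; 0, 0] (by simp [Matrix.trace_fin_two])
  have hF := h !![0, 0; 1, 0] (by simp [Matrix.trace_fin_two])
  have entry {N : Matrix (Fin 2) (Fin 2) R} (hN : A * N * A.adjugate = 0) (a b : Fin 2) :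
      (A * N * A.adjugate) a b = 0 := by rw [hN, Matrix.zero_apply]
  have h00 : A 0 0 ^ 2 = 0 := by
    simpa [Matrix.adjugate_fin_two, Matrix.mul_apply, Fin.sum_univ_two, sq] using entry hE 0 1
  have h10 : A 1 0 ^ 2 = 0 := by
    simpa [Matrix.adjugate_fin_two, Matrix.mul_apply, Fin.sum_univ_two, sq] using entry hE 1 0
  have h01 : A 0 1 ^ 2 = 0 := by
    simpa [Matrix.adjugate_fin_two, Matrix.mul_apply, Fin.sum_univ_two, sq] using entry hF 0 1
  have h11 : A 1 1 ^ 2 = 0 := by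
    simpa [Matrix.adjugate_fin_two, Matrix.mul_apply, Fin.sum_univ_two, sq] using entry hF 1 0
  rw [pow_eq_zero_iff two_ne_zero] at h00 h10 h01 h11
  ext a b
  fin_cases a <;> fin_cases b <;> assumption

theorem ActsBy.det_ne_zero [IsReduced S] (h : ActsBy i σ φ M A B C E) (hi : i * i = -1)
    (hσ : σ ∈ (n4Over δ i).Aut) (hA : A ≠ 0) : A.det ≠ 0 := fun hdet =>
  hA <| eq_zero_of_forall_mul_mul_adjugate_eq_zero fun N hN => by
    rw [← N.transpose_transpose, ← (h.intertwine hi hσ (N.trace_transpose.trans hN)).1, mul_assoc,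
      Matrix.mul_adjugate, hdet, zero_smul, mul_zero]

theorem eq_of_map_comb (hi : i * i = -1) {τ : S ⊗[k] N4 k ≃ₗ[S] S ⊗[k] N4 k}
    (hσ : σ ∈ (n4Over δ i).Aut) (hτ : τ ∈ (n4Over δ i).Aut)
    (h : ∀ (r : S) (N : Matrix (Fin 2) (Fin 2) S) (v w : Fin 2 → S), N.trace = 0 →
      σ (comb (coords i r N v w)) = τ (comb (coords i r N v w))) : σ = τ :=
  LinearEquiv.toLinearMap_injective <| hom_ext_gen hσ.2.2 hτ.2.2 fun u => by
    rw [← comb_single, ← coords_parts hi (Pi.single u 1)]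
    exact h _ _ _ _ (trace_sl2Part i _)

end Constraints

section Schur

theorem exists_eq_smul_one_of_commute {n R : Type*} [Fintype n] [DecidableEq n] [CommRing R]
    {P : Matrix n n R} (h : ∀ N : Matrix n n R, N.trace = 0 → Commute N P) :
    ∃ c : R, P = c • 1 := by
  obtain ⟨c, hc⟩ := Matrix.mem_range_scalar_of_commute_single fun a b hab =>
    h (Matrix.single a b 1) (Matrix.trace_single_eq_of_ne _ _ _ hab)
  exact ⟨c, by rw [← hc, Matrix.scalar_apply, Matrix.smul_one_eq_diagonal]⟩

variable {k S : Type*} [Field k] [CommRing S] [Algebra k S] {δ : Derivation k S S}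

theorem exists_eq_const_smul_one (hδ : ∀ f, δ f = 0 → ∃ c, f = algebraMap k S c)
    {P : Matrix (Fin 2) (Fin 2) S} (hP : P.map δ = 0)
    (h : ∀ N : Matrix (Fin 2) (Fin 2) S, N.trace = 0 → N * P = P * N) : ∃ c : k, P = c • 1 := by
  obtain ⟨f, rfl⟩ := exists_eq_smul_one_of_commute h
  obtain ⟨c, rfl⟩ := hδ f (by simpa using congrFun (congrFun hP 0) 0)
  exact ⟨c, algebraMap_smul S c _⟩

theorem eps_mul_eps : eps S * eps S = -1 := by
  ext a b
  fin_cases a <;> fin_cases b <;> simp [eps, Matrix.mul_apply]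

theorem exists_eq_const_smul_eps (hδ : ∀ f, δ f = 0 → ∃ c, f = algebraMap k S c)
    {P : Matrix (Fin 2) (Fin 2) S} (hP : P.map δ = 0)
    (h : ∀ N : Matrix (Fin 2) (Fin 2) S, N.trace = 0 → N * P = -(P * Nᵀ)) :
    ∃ c : k, P = c • eps S := by
  have map_eps : (eps S).map δ = 0 := by
    ext a b
    fin_cases a <;> fin_cases b <;> simp [eps]
  obtain ⟨c, hc⟩ := exists_eq_const_smul_one hδ (P := P * eps S)
    (by rw [map_derivation_mul, hP, map_eps, zero_mul, mul_zero, add_zero]) fun N hN => by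
      rw [← mul_assoc, h N hN, neg_mul, mul_assoc, transpose_mul_eps hN, mul_neg, neg_neg,
        mul_assoc]
  refine ⟨-c, ?_⟩
  calc P = -(P * eps S * eps S) := by rw [mul_assoc, eps_mul_eps, mul_neg_one, neg_neg]
    _ = -c • eps S := by rw [hc, smul_mul_assoc, one_mul, neg_smul]

end Schur

section Rigidity

variable {k S : Type*} [Field k] [CharZero k] [CommRing S] [Algebra k S] {δ : Derivation k S S}
  {i c : k} {σ : S ⊗[k] N4 k ≃ₗ[S] S ⊗[k] N4 k}
  {φ : Matrix (Fin 2) (Fin 2) S → Matrix (Fin 2) (Fin 2) S} {M B C E : Matrix (Fin 2) (Fin 2) S}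

theorem ActsBy.eq_self_of_smul_one (h : ActsBy i σ φ M (c • 1) B C E) (hi : i * i = -1)
    (hσ : σ ∈ (n4Over δ i).Aut) (hc : c ≠ 0) : (∀ N, N.trace = 0 → φ N = N) ∧ M = 0 := by
  have smul_injective := smul_right_injective (Matrix (Fin 2) (Fin 2) S) hc
  constructor
  · intro N hN
    refine Matrix.transpose_injective (smul_injective ?_)
    simpa using (h.intertwine hi hσ hN).1
  · have map_A : (c • (1 : Matrix (Fin 2) (Fin 2) S)).map δ = 0 := by
      rw [Matrix.map_smul _ _ (δ.map_smul c), map_derivation_one, smul_zero]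
    refine Matrix.transpose_injective (smul_injective ?_)
    simpa [map_A] using (h.deriv hi hσ).1.symm

theorem ActsBy.exists_const (hδ : ∀ f, δ f = 0 → ∃ c, f = algebraMap k S c)
    (h : ActsBy i σ φ M (c • 1) B C E) (hi : i * i = -1) (hσ : σ ∈ (n4Over δ i).Aut)
    (hc : c ≠ 0) : ∃ d e f : k, B = d • eps S ∧ C = e • eps S ∧ E = f • 1 := by
  obtain ⟨hφ, rfl⟩ := h.eq_self_of_smul_one hi hσ hc
  obtain ⟨-, dB, dC, dE⟩ := h.deriv hi hσ
  simp only [Matrix.transpose_zero, zero_mul, neg_zero] at dB dC dE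
  obtain ⟨d, hd⟩ := exists_eq_const_smul_eps hδ dB fun N hN => by
    simpa only [hφ N hN] using (h.intertwine hi hσ hN).2.1
  obtain ⟨e, he⟩ := exists_eq_const_smul_eps hδ dC fun N hN => by
    have hN' := N.trace_transpose.trans hN
    simpa only [hφ _ hN', Matrix.transpose_transpose] using (h.intertwine hi hσ hN').2.2.1
  obtain ⟨f, hf⟩ := exists_eq_const_smul_one hδ dE fun N hN => by
    simpa only [hφ N hN] using (h.intertwine hi hσ hN).2.2.2
  exact ⟨d, e, f, hd, he, hf⟩

theorem ActsBy.exists_rot_eq [Nontrivial S] (hδ : ∀ f, δ f = 0 → ∃ c, f = algebraMap k S c)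
    (h : ActsBy i σ φ M (c • 1) B C E) (hi : i * i = -1) (hσ : σ ∈ (n4Over δ i).Aut)
    (hc : c ≠ 0) : ∃ X : SL(2, k), (autHom δ hi (1, X)).1 = σ := by
  obtain ⟨hφ, rfl⟩ := h.eq_self_of_smul_one hi hσ hc
  obtain ⟨d, e, f, rfl, rfl, rfl⟩ := h.exists_const hδ hi hσ hc
  have hdet : c * f + d * e = 1 := by
    refine FaithfulSMul.algebraMap_injective k S ?_
    have := congrFun (congrFun (h.pairing hi hσ) 0) 0
    simpa [eps, Matrix.mul_apply, smul_eq_algebraMap_mul, mul_comm] using this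
  let X : SL(2, k) := ⟨!![c, -e; d, f], by
    rw [Matrix.det_fin_two_of]
    linear_combination hdet⟩
  refine ⟨X, eq_of_map_comb hi (autHom δ hi (1, X)).2 hσ fun r N v w hN => ?_⟩
  rw [autHom_comb_coords, h.map_comb_coords r hN, hφ N hN, Matrix.SpecialLinearGroup.coe_one,
    inv_one, Matrix.SpecialLinearGroup.coe_one, map_derivation_one]
  congr 2
  · simp
  · rw [rotG, Matrix.transpose_one, Matrix.one_mulVec, Matrix.smul_mulVec, Matrix.smul_mulVec,
      Matrix.one_mulVec]
    simp only [X, Matrix.of_apply, Matrix.cons_val', Matrix.cons_val_zero, Matrix.cons_val_one]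
    module
  · simp [X, rotGbar, Matrix.smul_mulVec]

end Rigidity

section Surjective

theorem exists_rot_ne_zero {k S : Type*} [Field k] [CommRing S] [Nontrivial S] [Algebra k S]
    {A B C E : Matrix (Fin 2) (Fin 2) S} (h : Aᵀ * E + Bᵀ * C = 1) :
    ∃ X : SL(2, k), X.1 0 0 • A - X.1 0 1 • (eps S * B) ≠ 0 := by
  by_cases hA : A = 0
  · refine ⟨⟨!![0, -1; 1, 0], by simp⟩, fun h0 => ?_⟩
    have heps : eps S * B = 0 := by simpa using h0
    have hB : B = 0 := by
      rw [← neg_eq_zero, ← neg_one_mul, ← eps_mul_eps, mul_assoc, heps, mul_zero]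
    simp [hA, hB] at h
  · exact ⟨1, by simpa using hA⟩

variable {k S : Type*} [Field k] [CharZero k] [CommRing S] [Algebra k S] {δ : Derivation k S S}
  {i : k} {σ : S ⊗[k] N4 k ≃ₗ[S] S ⊗[k] N4 k}
  {φ φ' : Matrix (Fin 2) (Fin 2) S → Matrix (Fin 2) (Fin 2) S}
  {M A B C E M' A' B' C' E' : Matrix (Fin 2) (Fin 2) S}

theorem ActsBy.eq_of_autHom_mul (h : ActsBy i σ φ M A B C E) (hi : i * i = -1) (Y : SL(2, S))
    (X : SL(2, k)) (h' : ActsBy i ((autHom δ hi (Y, X)).1 * σ) φ' M' A' B' C' E') :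
    A' = (Y⁻¹).1ᵀ * (X.1 0 0 • A - X.1 0 1 • (eps S * B)) := by
  refine Matrix.mulVec_injective (funext fun v => ?_)
  have e := h'.map_G v 0
  rw [LinearEquiv.mul_apply, h.map_G, autHom_comb_coords] at e
  have dual := congrArg (· ∘ Gen.G) (comb_injective e)
  simp only [coords_comp_G, Matrix.mulVec_zero, add_zero, rotG] at dual
  rw [← dual, ← Matrix.mulVec_mulVec, Matrix.sub_mulVec, Matrix.smul_mulVec, Matrix.smul_mulVec,
    Matrix.mulVec_mulVec]

variable [IsDomain S]

theorem ActsBy.exists_autHom_eq_of_ne_zero (hδ : ∀ f, δ f = 0 → ∃ c, f = algebraMap k S c)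
    (hk : ∀ a : k, IsSquare a) (h : ActsBy i σ φ M A B C E) (hi : i * i = -1)
    (hσ : σ ∈ (n4Over δ i).Aut) (hA : A ≠ 0) : ∃ z, autHom δ hi z = ⟨σ, hσ⟩ := by
  obtain ⟨d, hd⟩ := hδ _ (h.derivation_det hi hσ)
  obtain ⟨c, rfl⟩ := hk d
  have hc : c ≠ 0 := by
    rintro rfl
    exact h.det_ne_zero hi hσ hA (by rw [hd, mul_zero, map_zero])
  let Z : SL(2, S) := ⟨(c⁻¹ • A)ᵀ, by
    rw [Matrix.det_transpose, ← algebraMap_smul S, Matrix.det_smul, hd, ← map_pow, ← map_mul,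
      Fintype.card_fin, ← sq, ← mul_pow, inv_mul_cancel₀ hc, one_pow, map_one]⟩
  have hZ : A = c • Z.1ᵀ := (smul_inv_smul₀ hc A).symm
  have hτ : (autHom δ hi (Z, 1)).1 * σ ∈ (n4Over δ i).Aut := mul_mem (autHom δ hi (Z, 1)).2 hσ
  obtain ⟨φ', M', A', B', C', E', h'⟩ := exists_actsBy hi hτ
  obtain rfl : A' = c • 1 := by
    rw [h.eq_of_autHom_mul hi Z 1 h', hZ]
    simp [← Matrix.transpose_mul, coe_mul_coe_inv, -Matrix.SpecialLinearGroup.coe_inv]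
  obtain ⟨X, hX⟩ := h'.exists_rot_eq hδ hi hτ hc
  refine ⟨(Z, 1)⁻¹ * (1, X), ?_⟩
  rw [map_mul, map_inv, inv_mul_eq_iff_eq_mul]
  exact Subtype.ext hX

theorem autHom_surjective (hδ : ∀ f, δ f = 0 → ∃ c, f = algebraMap k S c)
    (hk : ∀ a : k, IsSquare a) (hi : i * i = -1) : Function.Surjective (autHom δ hi) := by
  rintro ⟨σ, hσ⟩
  obtain ⟨φ, M, A, B, C, E, h⟩ := exists_actsBy hi hσ
  obtain ⟨X, hX⟩ := exists_rot_ne_zero (k := k) (h.pairing hi hσ)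
  have hτ : (autHom δ hi (1, X)).1 * σ ∈ (n4Over δ i).Aut := mul_mem (autHom δ hi (1, X)).2 hσ
  obtain ⟨φ', M', A', B', C', E', h'⟩ := exists_actsBy hi hτ
  have hA' : A' ≠ 0 := by
    rw [h.eq_of_autHom_mul hi 1 X h']
    simpa using hX
  obtain ⟨z, hz⟩ := h'.exists_autHom_eq_of_ne_zero hδ hk hi hτ hA'
  refine ⟨(1, X)⁻¹ * z, ?_⟩
  rw [map_mul, map_inv, inv_mul_eq_iff_eq_mul, hz]
  rfl

end Surjective

section Kernel

/-- The subgroup generated by `(-I, -I)`. -/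
def signsOver (S k : Type*) [CommRing S] [CommRing k] : Subgroup (SL(2, S) × SL(2, k)) :=
  Subgroup.zpowers (-1, -1)

variable {k S : Type*} [Field k] [CharZero k] [CommRing S] [Algebra k S] {δ : Derivation k S S}
  {i : k} {Y : SL(2, S)} {X : SL(2, k)}

theorem autHom_neg_one (δ : Derivation k S S) (hi : i * i = -1) : autHom δ hi (-1, -1) = 1 := by
  refine Subtype.ext (eq_of_map_comb hi (autHom δ hi (-1, -1)).2 (one_mem _) fun r N v w _ => ?_)
  have map_neg_one : (-1 : Matrix (Fin 2) (Fin 2) S).map δ = 0 := by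
    rw [Matrix.map_neg _ (map_neg δ), map_derivation_one, neg_zero]
  rw [autHom_comb_coords, inv_neg, inv_one, Matrix.SpecialLinearGroup.coe_neg,
    Matrix.SpecialLinearGroup.coe_one, map_neg_one]
  change _ = comb (coords i r N v w)
  congr 2
  · simp
  · simp [rotG, Matrix.neg_mulVec]
  · simp [rotGbar, Matrix.neg_mulVec]

theorem eq_of_autHom_eq_one (hi : i * i = -1) (h : autHom δ hi (Y, X) = 1)
    {N : Matrix (Fin 2) (Fin 2) S} (hN : N.trace = 0) (v w : Fin 2 → S) :
    Y.1 * N * (Y⁻¹).1 = N ∧ (Y⁻¹).1ᵀ *ᵥ rotG X v w = v ∧ Y.1 *ᵥ rotGbar X v w = w := by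
  have e := autHom_comb_coords δ hi Y X 0 N v w
  rw [h, zero_smul, zero_add] at e
  have e' := comb_injective e
  refine ⟨?_, ?_, ?_⟩
  · rw [← sl2Part_coords hi 0 ((trace_conj Y N).trans hN), ← e', sl2Part_coords hi 0 hN]
  · exact (congrArg (· ∘ Gen.G) e').symm
  · exact (congrArg (· ∘ Gen.Gbar) e').symm

theorem eq_one_of_autHom_one_left [Nontrivial S] (hi : i * i = -1)
    (h : autHom δ hi (1, X) = 1) : X = 1 := by
  have fixed (v w : Fin 2 → S) := eq_of_autHom_eq_one hi h (Matrix.trace_zero _ _) v w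
  simp only [inv_one, Matrix.SpecialLinearGroup.coe_one, Matrix.transpose_one,
    Matrix.one_mulVec, rotG, rotGbar, eps_mulVec] at fixed
  have inj := FaithfulSMul.algebraMap_injective k S
  obtain ⟨-, hG, hGbar⟩ := fixed (Pi.single 0 1) 0
  obtain ⟨-, hG', hGbar'⟩ := fixed 0 (Pi.single 0 1)
  have h00 : X.1 0 0 = 1 := inj (by simpa [smul_eq_algebraMap_mul] using congrFun hG 0)
  have h01 : X.1 0 1 = 0 := inj (by simpa [smul_eq_algebraMap_mul] using congrFun hG' 1)
  have h10 : X.1 1 0 = 0 := inj (by simpa [smul_eq_algebraMap_mul] using congrFun hGbar 1)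
  have h11 : X.1 1 1 = 1 := inj (by simpa [smul_eq_algebraMap_mul] using congrFun hGbar' 0)
  refine Subtype.ext (Matrix.ext fun a b => ?_)
  fin_cases a <;> fin_cases b
  exacts [h00, h01, h10, h11]

theorem eq_one_or_eq_neg_one_of_autHom_eq_one [NoZeroDivisors S] (hi : i * i = -1)
    (h : autHom δ hi (Y, X) = 1) : Y = 1 ∨ Y = -1 := by
  obtain ⟨c, hc⟩ := exists_eq_smul_one_of_commute (P := Y.1) fun N hN => by
    have hconj := (eq_of_autHom_eq_one hi h hN 0 0).1
    calc N * Y.1 = Y.1 * N * (Y⁻¹).1 * Y.1 := by rw [hconj]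
      _ = Y.1 * N := by rw [mul_assoc, coe_inv_mul_coe, mul_one]
  have hdet : c * c = 1 := by
    simpa [hc, Matrix.det_smul, sq] using Y.2
  refine (mul_self_eq_one_iff.1 hdet).imp ?_ ?_ <;> rintro rfl <;>
    exact Subtype.ext (hc.trans (by simp))

theorem ker_autHom [IsDomain S] (δ : Derivation k S S) (hi : i * i = -1) :
    (autHom δ hi).ker = signsOver S k := by
  refine le_antisymm ?_ ((Subgroup.zpowers_le).2 (autHom_neg_one δ hi))
  rintro ⟨Y, X⟩ h
  rw [MonoidHom.mem_ker] at h
  rcases eq_one_or_eq_neg_one_of_autHom_eq_one hi h with rfl | rfl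
  · rw [eq_one_of_autHom_one_left hi h]
    exact one_mem _
  · have split : ((-1 : SL(2, S)), X) = (-1, -1) * (1, -X) := by simp
    have hX : -X = 1 := eq_one_of_autHom_one_left hi (by
      rwa [split, map_mul, autHom_neg_one, one_mul] at h)
    rw [split, hX]
    exact mul_mem (Subgroup.mem_zpowers _) (one_mem _)

end Kernel

section Formulas

section Embeddings

variable {k S : Type*} [Field k] [CommRing S] [Algebra k S]

/-- The inclusion of `sl₂(S)` in `S ⊗ N4 k` as `⨁ₛ S ⊗ Jˢ`. Since `tr(σˢ σᵗ) = 2δₛₜ`, the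
coefficient of `Jˢ` in a traceless matrix `M` is `tr(M σˢ)`. -/
def ofSl2Over (i : k) (M : Matrix (Fin 2) (Fin 2) S) : S ⊗[k] N4 k :=
  ∑ s, Matrix.trace (M * (pauli i s).map (algebraMap k S)) ⊗ₜ[k] gen (Gen.J s)

/-- The element `G(v)` of the paper. -/
def gVecOver (v : Fin 2 → S) : S ⊗[k] N4 k := ∑ a, v a ⊗ₜ[k] gen (Gen.G a)

/-- The element `Ḡ(v)` of the paper. -/
def gbarVecOver (v : Fin 2 → S) : S ⊗[k] N4 k := ∑ a, v a ⊗ₜ[k] gen (Gen.Gbar a)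

theorem comb_coords (i : k) (r : S) (M : Matrix (Fin 2) (Fin 2) S) (v w : Fin 2 → S) :
    comb (coords i r M v w)
      = r ⊗ₜ[k] gen .L + ofSl2Over i M + gVecOver v + gbarVecOver w := by
  rw [comb_apply, sum_gen]
  rfl

theorem comb_coords_J (i : k) (M : Matrix (Fin 2) (Fin 2) S) :
    comb (coords i 0 M 0 0) = ofSl2Over i M := by
  simp [comb_coords, gVecOver, gbarVecOver]

theorem comb_coords_G (i : k) (v : Fin 2 → S) : comb (coords i 0 0 v 0) = gVecOver (k := k) v := by
  simp [comb_coords, ofSl2Over, gbarVecOver]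

theorem comb_coords_Gbar (i : k) (w : Fin 2 → S) :
    comb (coords i 0 0 0 w) = gbarVecOver (k := k) w := by
  simp [comb_coords, ofSl2Over, gVecOver]

theorem comb_coords_L (i : k) (M : Matrix (Fin 2) (Fin 2) S) :
    comb (coords i 1 M 0 0) = 1 ⊗ₜ[k] gen .L + ofSl2Over i M := by
  simp [comb_coords, gVecOver, gbarVecOver]

theorem gVecOver_smul (c : k) (v : Fin 2 → S) :
    gVecOver (k := k) (c • v) = c • gVecOver v := by
  simp only [gVecOver, Finset.smul_sum, Pi.smul_apply, TensorProduct.smul_tmul']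

theorem gbarVecOver_smul (c : k) (v : Fin 2 → S) :
    gbarVecOver (k := k) (c • v) = c • gbarVecOver v := by
  simp only [gbarVecOver, Finset.smul_sum, Pi.smul_apply, TensorProduct.smul_tmul']

theorem gVecOver_single (a : Fin 2) :
    gVecOver (k := k) (Pi.single a (1 : S)) = 1 ⊗ₜ gen (.G a) := by
  fin_cases a <;> simp [gVecOver]

theorem gbarVecOver_single (a : Fin 2) :
    gbarVecOver (k := k) (Pi.single a (1 : S)) = 1 ⊗ₜ gen (.Gbar a) := by
  fin_cases a <;> simp [gbarVecOver]

variable [CharZero k] {δ : Derivation k S S} {i : k}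

theorem ofSl2Over_Jmat (hi : i * i = -1) (s : Fin 3) :
    ofSl2Over i ((Jmat i s).map (algebraMap k S)) = 1 ⊗ₜ[k] gen (.J s) := by
  rw [← comb_coords_J, ← comb_single, ← coords_parts hi (Pi.single (.J s) 1)]
  congr 2
  simp [sl2Part, Pi.single_apply]

theorem aut_ext {σ τ : S ⊗[k] N4 k ≃ₗ[S] S ⊗[k] N4 k}
    (hσ : σ ∈ (n4Over δ i).Aut) (hτ : τ ∈ (n4Over δ i).Aut)
    (hL : σ (1 ⊗ₜ gen .L) = τ (1 ⊗ₜ gen .L))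
    (hJ : ∀ s, σ (1 ⊗ₜ gen (.J s)) = τ (1 ⊗ₜ gen (.J s)))
    (hG : ∀ v, σ (gVecOver v) = τ (gVecOver v))
    (hGbar : ∀ v, σ (gbarVecOver v) = τ (gbarVecOver v)) : σ = τ :=
  LinearEquiv.toLinearMap_injective <| hom_ext_gen hσ.2.2 hτ.2.2 fun
    | .L => hL
    | .J s => hJ s
    | .G a => gVecOver_single (k := k) (S := S) a ▸ hG _
    | .Gbar a => gbarVecOver_single (k := k) (S := S) a ▸ hGbar _

end Embeddings

variable {k S : Type*} [Field k] [CharZero k] [CommRing S] [Algebra k S] (δ : Derivation k S S)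
  {i : k} (hi : i * i = -1) (Y : SL(2, S)) (X : SL(2, k))

theorem autHom_L :
    (autHom δ hi (Y, X)).1 (1 ⊗ₜ gen .L)
      = 1 ⊗ₜ gen .L + ofSl2Over i (Y.1.map δ * (Y⁻¹).1) := by
  have h := autHom_comb_coords δ hi Y X 1 0 0 0
  simpa [comb_coords_L, rotG, rotGbar, ofSl2Over, -Matrix.SpecialLinearGroup.coe_inv] using h

theorem autHom_J (s : Fin 3) :
    (autHom δ hi (Y, X)).1 (1 ⊗ₜ gen (.J s))
      = ofSl2Over i (Y.1 * (Jmat i s).map (algebraMap k S) * (Y⁻¹).1) := by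
  rw [← ofSl2Over_Jmat hi, ← comb_coords_J, autHom_comb_coords, ← comb_coords_J]
  simp [rotG, rotGbar]

theorem autHom_gVecOver (v : Fin 2 → S) :
    (autHom δ hi (Y, X)).1 (gVecOver v)
      = X.1 0 0 • gVecOver ((Y⁻¹).1ᵀ *ᵥ v) + X.1 1 0 • gbarVecOver ((Y.1 * eps S) *ᵥ v) := by
  rw [← comb_coords_G i, autHom_comb_coords, ← gVecOver_smul, ← gbarVecOver_smul,
    ← comb_coords_G i, ← comb_coords_Gbar i, ← map_add, coords_add]
  simp only [rotG, rotGbar, zero_smul, Matrix.mul_zero, Matrix.zero_mul, add_zero, zero_add,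
    sub_zero, smul_zero, Matrix.mulVec_zero, Matrix.mulVec_smul, Matrix.mulVec_mulVec]

theorem autHom_gbarVecOver (v : Fin 2 → S) :
    (autHom δ hi (Y, X)).1 (gbarVecOver v)
      = -X.1 0 1 • gVecOver (((Y⁻¹).1ᵀ * eps S) *ᵥ v) + X.1 1 1 • gbarVecOver (Y.1 *ᵥ v) := by
  rw [← comb_coords_Gbar i, autHom_comb_coords, ← gVecOver_smul, ← gbarVecOver_smul,
    ← comb_coords_G i, ← comb_coords_Gbar i, ← map_add, coords_add]
  simp only [rotG, rotGbar, zero_smul, Matrix.mul_zero, Matrix.zero_mul, add_zero, zero_add,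
    zero_sub, smul_zero, Matrix.mulVec_zero, neg_smul, Matrix.mulVec_neg, Matrix.mulVec_smul,
    Matrix.mulVec_mulVec]

end Formulas

section Quotient

instance signsOver_normal (S k : Type*) [CommRing S] [CommRing k] : (signsOver S k).Normal := by
  refine ⟨fun x hx g => ?_⟩
  obtain ⟨n, rfl⟩ := Subgroup.mem_zpowers_iff.1 hx
  have h : Commute g (-1, -1) := Prod.ext (by simp) (by simp)
  rwa [(h.zpow_right n).eq, mul_inv_cancel_right]

variable {k S : Type*} [Field k] [CharZero k] [CommRing S] [IsDomain S] [Algebra k S]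
  {δ : Derivation k S S} {i : k}

/-- The isomorphism of `(SL₂(S) × SL₂(k)) / ⟨(-I, -I)⟩` with the automorphism group that
`autHom` induces when the constants of `δ` lie in `k` and `k` is quadratically closed. -/
def autEquiv (hδ : ∀ f, δ f = 0 → ∃ c, f = algebraMap k S c) (hk : ∀ a : k, IsSquare a)
    (hi : i * i = -1) : (SL(2, S) × SL(2, k)) ⧸ signsOver S k ≃* (n4Over δ i).Aut :=
  (QuotientGroup.quotientMulEquivOfEq (ker_autHom δ hi).symm).trans
    (QuotientGroup.quotientKerEquivOfSurjective (autHom δ hi) (autHom_surjective hδ hk hi))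

theorem autEquiv_mk (hδ : ∀ f, δ f = 0 → ∃ c, f = algebraMap k S c) (hk : ∀ a : k, IsSquare a)
    (hi : i * i = -1) (z : SL(2, S) × SL(2, k)) :
    autEquiv hδ hk hi (QuotientGroup.mk z) = autHom δ hi z := rfl

end Quotient

section Constants

variable {k : Type*} [Field k] [CharZero k]

theorem coeff_ddt (f : Shat k) (q : ℚ) : (ddt k f).coeff (q - 1) = (q : k) * f.coeff q := by
  change (ddtLinear k f).coeff (q - 1) = _
  induction f using AddMonoidAlgebra.induction_linear with
  | zero => simp
  | add f g hf hg => simp [hf, hg, mul_add]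
  | single p c =>
    rw [ddtLinear_single, AddMonoidAlgebra.coeff_single, AddMonoidAlgebra.coeff_single]
    by_cases h : p = q
    · rw [h, Finsupp.single_eq_same, Finsupp.single_eq_same]
    · rw [Finsupp.single_eq_of_ne (fun h' => h (sub_left_injective h').symm),
        Finsupp.single_eq_of_ne (Ne.symm h), mul_zero]

theorem exists_eq_algebraMap_of_ddt_eq_zero (f : Shat k) (h : ddt k f = 0) :
    ∃ c, f = algebraMap k (Shat k) c := by
  refine ⟨f.coeff 0, AddMonoidAlgebra.coeff_injective (Finsupp.ext fun q => ?_)⟩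
  change f.coeff q = (AddMonoidAlgebra.single 0 (f.coeff 0)).coeff q
  rw [AddMonoidAlgebra.coeff_single]
  by_cases hq : q = 0
  · rw [hq, Finsupp.single_eq_same]
  · have hcoeff := coeff_ddt f q
    rw [h, AddMonoidAlgebra.coeff_zero, Finsupp.zero_apply] at hcoeff
    rw [Finsupp.single_eq_of_ne hq]
    exact (mul_eq_zero.1 hcoeff.symm).resolve_left (Rat.cast_ne_zero.2 hq)

end Constants

end ConformalSuper

end

theorem proposition3p62_general {k S : Type*} [Field k] [CharZero k] [CommRing S] [IsDomain S]
    [Algebra k S] (δ : Derivation k S S) (hδ : ∀ f, δ f = 0 → ∃ c, f = algebraMap k S c)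
    (hk : ∀ a : k, IsSquare a) (i : k) (hi : i * i = -1) :
    ∃! Φ : (SL(2, S) × SL(2, k)) ⧸ signsOver S k ≃* ((n4 i).baseChange δ).Aut,
      ∀ (Y : SL(2, S)) (X : SL(2, k)),
        let σ : S ⊗[k] N4 k ≃ₗ[S] S ⊗[k] N4 k := (Φ (QuotientGroup.mk (Y, X))).1
        σ (1 ⊗ₜ[k] gen .L) = 1 ⊗ₜ[k] gen .L + ofSl2Over i (Y.1.map δ * (Y⁻¹).1) ∧
        (∀ s, σ (1 ⊗ₜ[k] gen (.J s))
          = ofSl2Over i (Y.1 * (Jmat i s).map (algebraMap k S) * (Y⁻¹).1)) ∧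
        (∀ v, σ (gVecOver v)
          = X.1 0 0 • gVecOver ((Y⁻¹).1ᵀ *ᵥ v) + X.1 1 0 • gbarVecOver ((Y.1 * eps S) *ᵥ v)) ∧
        (∀ v, σ (gbarVecOver v)
          = -X.1 0 1 • gVecOver (((Y⁻¹).1ᵀ * eps S) *ᵥ v)
            + X.1 1 1 • gbarVecOver (Y.1 *ᵥ v)) := by
  refine ⟨autEquiv hδ hk hi, fun Y X => ⟨autHom_L δ hi Y X, autHom_J δ hi Y X,
    autHom_gVecOver δ hi Y X, autHom_gbarVecOver δ hi Y X⟩, fun Ψ hΨ => MulEquiv.ext fun q => ?_⟩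
  obtain ⟨⟨Y, X⟩, rfl⟩ := QuotientGroup.mk_surjective q
  obtain ⟨hL, hJ, hG, hGbar⟩ := hΨ Y X
  rw [autEquiv_mk]
  exact Subtype.ext (aut_ext (Ψ _).2 (autHom δ hi (Y, X)).2
    (hL.trans (autHom_L δ hi Y X).symm)
    (fun s => (hJ s).trans (autHom_J δ hi Y X s).symm)
    (fun v => (hG v).trans (autHom_gVecOver δ hi Y X v).symm)
    fun v => (hGbar v).trans (autHom_gbarVecOver δ hi Y X v).symm)

theorem proposition3p62 {k : Type*} [Field k] [IsAlgClosed k] [CharZero k]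
    (i : k) (hi : i * i = -1) :
    ∃! Φ : (SL(2, Shat k) × SL(2, k)) ⧸ signs k ≃*
        ((n4 i).baseChange (ddt k)).Aut,
      ∀ (Y : SL(2, Shat k)) (X : SL(2, k)),
        let σ : Shat k ⊗[k] N4 k ≃ₗ[Shat k]
            Shat k ⊗[k] N4 k :=
          (Φ (QuotientGroup.mk (Y, X))).1
        let Ym : Matrix (Fin 2) (Fin 2) (Shat k) := Y.1
        let Yinv : Matrix (Fin 2) (Fin 2) (Shat k) := (Y⁻¹).1
        let ε : Matrix (Fin 2) (Fin 2) (Shat k) := !![0, 1; -1, 0]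
        let c : k := X.1 0 0
        let d : k := X.1 1 0
        let e : k := -X.1 0 1
        let f : k := X.1 1 1
        σ (1 ⊗ₜ[k] gen .L) = 1 ⊗ₜ[k] gen .L
            + ofSl2 i (Ym.map (ddt k) * Yinv) ∧
        (∀ s, σ (1 ⊗ₜ[k] gen (.J s)) = ofSl2 i
            (Ym * (Jmat i s).map (algebraMap k (Shat k)) * Yinv)) ∧
        (∀ v, σ (gVec v) = c • gVec (Yinvᵀ *ᵥ v)
            + d • gbarVec ((Ym * ε) *ᵥ v)) ∧
        (∀ v, σ (gbarVec v) = e • gVec ((Yinvᵀ * ε) *ᵥ v)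
            + f • gbarVec (Ym *ᵥ v)) :=
  proposition3p62_general (ddt k) exists_eq_algebraMap_of_ddt_eq_zero IsAlgClosed.exists_eq_mul_self
    i hi
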